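/- Consider on $\mathbb{R}_+\times\mathbb{R}^2$ the Boussinesq system with critical dissipation $$\partial_t v+v\cdot\nabla v+|D|v+\nabla p=\theta e_2,\qquad \partial_t\theta+v\cdot\nabla\theta=0,\qquad \operatorname{div}v=0,\qquad v|_{t=0}=v^0,\quad \theta|_{t=0}=\theta^0,$$ where $v=(v^1,v^2)$ is the (real) velocity field, $\theta$ the (real) temperature, $p$ the pressure, $e_2=(0,1)$ and $|D|$ is the Fourier multiplier with symbol $|\xi|$ (that is, $|D|=(-\Delta)^{1/2}$). A global weak solution is a pair $$(v,\theta)\in \big(L^\infty_{\rm loc}(\mathbb{R}_+;L^2)\cap L^2_{\rm loc}(\mathbb{R}_+;\dot H^{1/2})\big)\times L^\infty(\mathbb{R}_+;L^2)$$ with $\operatorname{div}v(t)=0$ in the sense of distributions for almost every $t>0$, such that $$\int_0^\infty\!\!\int_{\mathbb{R}^2}\big(v\cdot\partial_t\varphi+v\cdot (v\cdot\nabla)\varphi-v\cdot|D|\varphi+\theta\,\varphi^2\big)\,dx\,dt+\int_{\mathbb{R}^2}v^0\cdot\varphi(0,\cdot)\,dx=0$$ for all $\varphi=(\varphi^1,\varphi^2)\in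 C_c^\infty([0,\infty)\times\mathbb{R}^2;\mathbb{R}^2)$ with $\operatorname{div}\varphi(t,\cdot)=0$ for all $t\ge0$ (here $\varphi^2$ is the second component of $\varphi$), and $$\int_0^\infty\!\!\int_{\mathbb{R}^2}\theta\,\big(\partial_t\psi+v\cdot\nabla\psi\big)\,dx\,dt+\int_{\mathbb{R}^2}\theta^0\,\psi(0,\cdot)\,dx=0$$ for all $\psi\in C_c^\infty([0,\infty)\times\mathbb{R}^2;\mathbb{R})$. Proposition 5.1. There is a function $C:\mathbb{R}^2\to\mathbb{R}$ such that the following holds for every divergence-free vector field $v^0\in L^2(\mathbb{R}^2;\mathbb{R}^2)$ and every $\theta^0\in L^2(\mathbb{R}^2)$, with $C_0=C(\|v^0\|_{L^2},\|\theta^0\|_{L^2})$. 1. There exists a global weak solution $(v,\theta)$ with initial data $(v^0,\theta^0)$ such that, for all $t\ge0$, $$\|v(t)\|_{L^2}^2+\int_0^t\|v(\tau)\|_{\dot H^{1/2}}^2\,d\tau\le C_0(1+t^2),\qquad \|\theta(t)\|_{L^2}\le\|\theta^0\|_{L^2}.$$ 2. If in addition $\theta^0\in L^p$ for some $p\in[1,\infty]$,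 then there exists a global weak solution which satisfies these two estimates and also, for all $t\ge0$, $$\|\theta(t)\|_{L^p}\le\|\theta^0\|_{L^p}.$$ -/

import Mathlib

open MeasureTheory
open scoped ENNReal FourierTransform

noncomputable section

namespace Boussinesq

/-- The Euclidean plane. -/
abbrev Plane : Type := EuclideanSpace ℝ (Fin 2)

/-- Real scalar fields in `L²(ℝ²)`. -/
abbrev L2Scalar : Type := Lp ℝ 2 (volume : Measure Plane)

/-- Real vector fields in `L²(ℝ²; ℝ²)`. -/
abbrev L2Vector : Type := Lp Plane 2 (volume : Measure Plane)

/-- A smooth compactly supported function. -/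
def IsTest {E F : Type*} [NormedAddCommGroup E] [NormedSpace ℝ E]
    [NormedAddCommGroup F] [NormedSpace ℝ F] (f : E → F) : Prop :=
  ContDiff ℝ ((⊤ : ℕ∞) : WithTop ℕ∞) f ∧ HasCompactSupport f

/-- The divergence `∂₁ f¹ + ∂₂ f²` of a differentiable vector field. -/
def divergence (f : Plane → Plane) (x : Plane) : ℝ :=
  ∑ i : Fin 2, (fderiv ℝ f x (EuclideanSpace.single i 1)) i

/-- `div u = 0` in the sense of distributions, for `u ∈ L²`: `∫ u · ∇ψ = 0` for all test
functions `ψ`. -/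
def IsDivFree (u : L2Vector) : Prop :=
  ∀ ψ : Plane → ℝ, IsTest ψ → ∫ x, fderiv ℝ ψ x (u x) = 0

/-- The operator `|D|` on real functions. Mathlib's Fourier transform has the kernel
`exp(-2πi x·ξ)`, so that the symbol of `|D| = (-Δ)^{1/2}` is `2π|ξ|`. The symbol is real and even,
hence the result is real. -/
def absD (f : Plane → ℝ) (x : Plane) : ℝ :=
  (𝓕⁻ (fun ξ : Plane ↦ ((2 * Real.pi * ‖ξ‖ : ℝ) : ℂ) * 𝓕 (fun y : Plane ↦ (f y : ℂ)) ξ) x).re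

/-- The operator `|D|` acting on each component of a vector field. -/
def absDVec (f : Plane → Plane) (x : Plane) : Plane :=
  WithLp.toLp 2 fun i ↦ absD (fun y ↦ f y i) x

/-- The `i`-th component of an `L²` vector field, as a complex-valued `L²` function. -/
def component (u : L2Vector) (i : Fin 2) : Lp ℂ 2 (volume : Measure Plane) :=
  (Complex.ofRealCLM.comp (EuclideanSpace.proj i : Plane →L[ℝ] ℝ)).compLp u

/-- The square `‖u‖²_{Ḣ^{1/2}} = ∫ 2π|ξ| |û(ξ)|² dξ`, possibly infinite, of the homogeneous
Sobolev norm of an `L²` vector field; `û` is the Plancherel transform. -/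
def hdotHalfSq (u : L2Vector) : ℝ≥0∞ :=
  ∑ i : Fin 2, ∫⁻ ξ : Plane, ENNReal.ofReal (2 * Real.pi * ‖ξ‖) *
    ‖(𝓕 (component u i) : Lp ℂ 2 (volume : Measure Plane)) ξ‖ₑ ^ 2

/-- Global (Leray type) weak solutions, with initial data `(v₀, θ₀)`, of the system
`∂ₜv + v·∇v + |D|v + ∇p = θ e₂`, `∂ₜθ + v·∇θ = 0`, `div v = 0` on `ℝ₊ × ℝ²`, in the space
`(L^∞_loc(ℝ₊; L²) ∩ L²_loc(ℝ₊; Ḣ^{1/2})) × L^∞(ℝ₊; L²)`. The pressure is eliminated by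
divergence-free test fields. The test functions do not have to vanish at the time `0`, so that the
two equations contain the initial conditions. -/
structure IsGlobalWeakSolution (v₀ : L2Vector) (θ₀ : L2Scalar)
    (v : ℝ → L2Vector) (θ : ℝ → L2Scalar) : Prop where
  velocity_bounded : ∀ T : ℝ, MemLp v ⊤ (volume.restrict (Set.Ioc 0 T))
  velocity_hdotHalf : ∀ T : ℝ, ∫⁻ t in Set.Ioc 0 T, hdotHalfSq (v t) < ⊤
  temperature_bounded : MemLp θ ⊤ (volume.restrict (Set.Ioi (0 : ℝ)))
  div_free : ∀ᵐ t ∂(volume.restrict (Set.Ioi (0 : ℝ))), IsDivFree (v t)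
  momentum : ∀ φ : ℝ × Plane → Plane, IsTest φ →
    (∀ t : ℝ, 0 ≤ t → ∀ x : Plane, divergence (fun y ↦ φ (t, y)) x = 0) →
    (∫ t in Set.Ioi (0 : ℝ), ∫ x : Plane,
        (inner ℝ (v t x) (deriv (fun s ↦ φ (s, x)) t)
          + inner ℝ (v t x) (fderiv ℝ (fun y ↦ φ (t, y)) x (v t x))
          - inner ℝ (v t x) (absDVec (fun y ↦ φ (t, y)) x)
          + θ t x * φ (t, x) 1))
      + ∫ x : Plane, inner ℝ (v₀ x) (φ (0, x)) = 0
  temperature : ∀ ψ : ℝ × Plane → ℝ, IsTest ψ →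
    (∫ t in Set.Ioi (0 : ℝ), ∫ x : Plane,
        θ t x * (deriv (fun s ↦ ψ (s, x)) t + fderiv ℝ (fun y ↦ ψ (t, y)) x (v t x)))
      + ∫ x : Plane, θ₀ x * ψ (0, x) = 0

/-- The two estimates
`‖v(t)‖²_{L²} + ∫₀ᵗ ‖v(τ)‖²_{Ḣ^{1/2}} dτ ≤ C₀ (1 + t²)` and `‖θ(t)‖_{L²} ≤ ‖θ₀‖_{L²}`
for all `t ≥ 0`. -/
def EnergyBounds (C₀ : ℝ) (θ₀ : L2Scalar) (v : ℝ → L2Vector) (θ : ℝ → L2Scalar) : Prop :=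
  ∀ t : ℝ, 0 ≤ t →
    ENNReal.ofReal (‖v t‖ ^ 2) + ∫⁻ τ in Set.Ioc 0 t, hdotHalfSq (v τ)
        ≤ ENNReal.ofReal (C₀ * (1 + t ^ 2)) ∧
    ‖θ t‖ ≤ ‖θ₀‖

end Boussinesq

end

open MeasureTheory
open scoped ENNReal FourierTransform

noncomputable section

namespace Boussinesq

/-! The solution is a limit of a time-discrete scheme of step `η ^ 3`, built so that the a priori
estimates of the system hold at the discrete level. Each step transports velocity and temperature
explicitly along a regularized velocity, adds the buoyancy, and then solves w + h|D|w + ∇p = g, div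
w = 0, with h = η³.

Transport replaces a value at x by a convex combination of the values at the four neighbours at
distance ε = η², with weights 1/4 ± (η/2)·flux, the flux being a velocity component averaged at
scale δ. The fluxes of a divergence-free field through the sides of a square add up to zero
(`sum_flux_sub`), so the weights are doubly stochastic (`doublyStochastic_fluxWeight`) and the step
contracts every L^p with 1 ≤ p ≤ ∞ (`DoublyStochastic.eLpNorm_le`). Its adjoint moves a test
function by η³ times the regularized velocity on average, up to a second-order error η⁴; divided by
the time step, the error is of order η (`norm_l2_generator_sub_le`).

The implicit step is an orthogonal projection onto the graph of √(h|D|) over divergence-free fields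
(`exists_graph_projection`), which gives ‖w‖² + h‖w‖²_{Ḣ^{1/2}} ≤ ‖g‖². Iteration bounds the energy
at time t by (‖v₀‖ + t‖θ₀‖)² (`scheme_energy`).

The approximations are asymptotically equicontinuous in time against gradients and divergence-free
test fields. These are total in L² by Liouville's theorem (`eq_zero_of_orthogonal`), so a
subsequence converges weakly at every time (`exists_subseq_weak_limit`). Translations are Hölder of
order 1/2 in L² on Ḣ^{1/2}, which upgrades this to strong convergence of the velocities on bounded
sets of space-time (`IsLimit.tendsto_lintegral_localNorm`). The discrete generators applied to a
test function then converge strongly in L² at almost every time, and the nonlinear terms are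
pairings of a weakly convergent factor with a strongly convergent one. The bounds pass to the limit
because the norms involved have closed convex sublevel sets (`mem_of_weak_limit`), together with
Fatou's lemma in time. -/

open Filter Topology Set

/-! ### Weak convergence and weak compactness in Hilbert spaces. -/

section WeakConvergence

variable {H : Type*} [NormedAddCommGroup H] [InnerProductSpace ℝ H]

/-- A closed convex set contains the weak limits of sequences that are frequently in it. -/
theorem mem_of_weak_limit [CompleteSpace H] {ι : Type*} {l : Filter ι} {S : Set H}
    (hS : IsClosed S) (hc : Convex ℝ S) {u : ι → H} {a : H} (hu : ∃ᶠ n in l, u n ∈ S)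
    (hw : ∀ φ : H, Tendsto (fun n ↦ inner ℝ (u n) φ) l (𝓝 (inner ℝ a φ))) : a ∈ S := by
  obtain ⟨n₀, hn₀⟩ := hu.exists
  -- With p the nearest point of S to a, every s in S satisfies ⟨s - p, a - p⟩ ≤ 0. The weak limit
  -- inherits this inequality, so ‖a - p‖² ≤ 0.
  obtain ⟨p, hpS, hp⟩ := exists_norm_eq_iInf_of_complete_convex ⟨u n₀, hn₀⟩ hS.isComplete hc a
  have hip := (norm_eq_iInf_iff_real_inner_le_zero hc hpS).1 hp
  have hlim : Tendsto (fun n ↦ inner ℝ (u n) (a - p) - inner ℝ p (a - p)) l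
      (𝓝 (inner ℝ a (a - p) - inner ℝ p (a - p))) := (hw (a - p)).sub_const _
  have hle : inner ℝ a (a - p) - inner ℝ p (a - p) ≤ 0 := by
    refine le_of_tendsto_of_frequently hlim (hu.mono fun n hn ↦ ?_)
    rw [← inner_sub_left, real_inner_comm]
    exact hip _ hn
  rw [← inner_sub_left, real_inner_self_eq_norm_sq] at hle
  have : a - p = 0 := by
    rw [← norm_eq_zero]
    nlinarith [norm_nonneg (a - p)]
  rwa [sub_eq_zero.1 this]

/-- The pairing of a bounded weakly convergent family with a strongly convergent one. -/
theorem tendsto_inner_of_weak_of_strong {ι : Type*} {l : Filter ι} {u g : ι → H} {a b : H}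
    {M : ℝ} (hM : ∀ᶠ n in l, ‖u n‖ ≤ M)
    (hw : Tendsto (fun n ↦ inner ℝ (u n) b) l (𝓝 (inner ℝ a b))) (hg : Tendsto g l (𝓝 b)) :
    Tendsto (fun n ↦ inner ℝ (u n) (g n)) l (𝓝 (inner ℝ a b)) := by
  have h0 : Tendsto (fun n ↦ inner ℝ (u n) (g n - b)) l (𝓝 0) := by
    have hb : Tendsto (fun n ↦ M * ‖g n - b‖) l (𝓝 0) := by
      have := (tendsto_iff_norm_sub_tendsto_zero.1 hg).const_mul M
      simpa using this
    refine squeeze_zero_norm' (hM.mono fun n hn ↦ ?_) hb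
    exact (norm_inner_le_norm _ _).trans (mul_le_mul_of_nonneg_right hn (norm_nonneg _))
  have := hw.add h0
  simpa [inner_sub_right] using this

/-- The test vectors along which a bounded sequence converges weakly form a closed subspace. -/
theorem cauchySeq_inner_of_dense {u : ℕ → H} {M : ℝ} (hM : ∀ n, ‖u n‖ ≤ M) {D : Set H}
    (hD : (Submodule.span ℝ D).topologicalClosure = ⊤)
    (h : ∀ φ ∈ D, CauchySeq fun n ↦ (inner ℝ (u n) φ : ℝ)) (φ : H) :
    CauchySeq fun n ↦ (inner ℝ (u n) φ : ℝ) := by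
  have hspan : ∀ φ ∈ Submodule.span ℝ D, CauchySeq fun n ↦ (inner ℝ (u n) φ : ℝ) := by
    intro φ hφ
    induction hφ using Submodule.span_induction with
    | mem x hx => exact h x hx
    | zero => simpa using cauchySeq_const (0 : ℝ)
    | add x y _ _ hx hy => simpa only [inner_add_right] using! hx.add hy
    | smul c x _ hx =>
      obtain ⟨y, hy⟩ := cauchySeq_tendsto_of_complete hx
      simp only [inner_smul_right]
      exact (hy.const_mul c).cauchySeq
  have hM0 : 0 ≤ M := (norm_nonneg _).trans (hM 0)
  rw [Metric.cauchySeq_iff']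
  intro ε hε
  have hφ : φ ∈ (Submodule.span ℝ D).topologicalClosure := hD ▸ Submodule.mem_top
  obtain ⟨ψ, hψ, hdist⟩ := Metric.mem_closure_iff.1 hφ (ε / (4 * (M + 1))) (by positivity)
  obtain ⟨N, hN⟩ := Metric.cauchySeq_iff'.1 (hspan ψ hψ) (ε / 2) (by positivity)
  refine ⟨N, fun n hn ↦ ?_⟩
  have h1 := hN n hn
  rw [Real.dist_eq] at h1 ⊢
  have key : ∀ k, |inner ℝ (u k) (φ - ψ)| ≤ ε / 4 := by
    intro k
    refine (abs_real_inner_le_norm _ _).trans ?_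
    rw [dist_eq_norm] at hdist
    calc ‖u k‖ * ‖φ - ψ‖ ≤ (M + 1) * (ε / (4 * (M + 1))) := by
          gcongr
          linarith [hM k]
      _ = ε / 4 := by field_simp
  have h2 := key n
  have h3 := key N
  rw [inner_sub_right] at h2 h3
  rw [abs_le] at h2 h3
  rw [abs_lt] at h1 ⊢
  constructor <;> linarith [h2.1, h2.2, h3.1, h3.2, h1.1, h1.2]

/-- A bounded sequence that is weakly Cauchy has a weak limit. -/
theorem exists_weak_limit [CompleteSpace H] {u : ℕ → H} {M : ℝ} (hM : ∀ n, ‖u n‖ ≤ M)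
    (h : ∀ φ, CauchySeq fun n ↦ (inner ℝ (u n) φ : ℝ)) :
    ∃ a : H, ∀ φ, Tendsto (fun n ↦ inner ℝ (u n) φ) atTop (𝓝 (inner ℝ a φ)) := by
  choose L hL using fun φ ↦ cauchySeq_tendsto_of_complete (h φ)
  let ℓ : H →ₗ[ℝ] ℝ :=
    { toFun := L
      map_add' := fun x y ↦ tendsto_nhds_unique (hL (x + y)) (by
        simpa [inner_add_right] using (hL x).add (hL y))
      map_smul' := fun c x ↦ tendsto_nhds_unique (hL (c • x)) (by
        simpa [inner_smul_right] using (hL x).const_mul c) }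
  have hℓ : ∀ φ, ‖ℓ φ‖ ≤ M * ‖φ‖ := fun φ ↦
    le_of_tendsto (hL φ).norm (Eventually.of_forall fun n ↦
      (norm_inner_le_norm _ _).trans (mul_le_mul_of_nonneg_right (hM n) (norm_nonneg _)))
  refine ⟨(InnerProductSpace.toDual ℝ H).symm (ℓ.mkContinuous M hℓ), fun φ ↦ ?_⟩
  rw [InnerProductSpace.toDual_symm_apply]
  exact hL φ

/-- Weak compactness of sequences of curves that are asymptotically equicontinuous along a total
set of test vectors: a subsequence converges weakly at every time. -/
theorem exists_subseq_weak_limit [CompleteSpace H] [TopologicalSpace.SeparableSpace H]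
    {u : ℕ → ℝ → H} {M : ℝ → ℝ} (hM : ∀ n t, 0 ≤ t → ‖u n t‖ ≤ M t) {D : Set H}
    (hD : (Submodule.span ℝ D).topologicalClosure = ⊤)
    (heq : ∀ φ ∈ D, ∀ T : ℝ, ∃ (K : ℝ) (r : ℕ → ℝ), Tendsto r atTop (𝓝 0) ∧
      ∀ᶠ n in atTop, ∀ s t, 0 ≤ s → s ≤ t → t ≤ T →
        |inner ℝ (u n t) φ - inner ℝ (u n s) φ| ≤ K * (t - s + r n)) :
    ∃ (ψ : ℕ → ℕ) (v : ℝ → H), StrictMono ψ ∧ (∀ t < 0, v t = 0) ∧ ∀ t, 0 ≤ t → ∀ φ,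
      Tendsto (fun n ↦ inner ℝ (u (ψ n) t) φ) atTop (𝓝 (inner ℝ (v t) φ)) := by
  have : Nonempty H := ⟨0⟩
  let ι := {q : ℚ // 0 ≤ q} × ℕ
  let d : ℕ → H := TopologicalSpace.denseSeq H
  -- The diagonal extraction is sequential compactness of a countable product of intervals, indexed
  -- by rational times and a dense sequence of test vectors.
  let x : ℕ → ι → ℝ := fun n i ↦ inner ℝ (u n (i.1.1 : ℝ)) (d i.2)
  have hq : ∀ i : ι, (0 : ℝ) ≤ (i.1.1 : ℝ) := fun i ↦ by exact_mod_cast i.1.2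
  let K : Set (ι → ℝ) := Set.pi univ fun i ↦ Icc (-(M i.1.1 * ‖d i.2‖)) (M i.1.1 * ‖d i.2‖)
  have hK : IsCompact K := isCompact_univ_pi fun i ↦ isCompact_Icc
  have hx : ∀ n, x n ∈ K := by
    intro n i _
    refine abs_le.1 ?_
    exact (abs_real_inner_le_norm _ _).trans
      (mul_le_mul_of_nonneg_right (hM n _ (hq i)) (norm_nonneg _))
  obtain ⟨y, -, ψ, hψ, hy⟩ := hK.tendsto_subseq hx
  have hdense : (Submodule.span ℝ (range d)).topologicalClosure = ⊤ := by
    rw [Submodule.topologicalClosure_eq_top_iff, Submodule.eq_bot_iff]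
    · intro z hz
      rw [Submodule.mem_orthogonal] at hz
      have hz' : ∀ w : H, inner ℝ w z = 0 := by
        intro w
        have hcl : IsClosed {w : H | inner ℝ w z = (0 : ℝ)} :=
          isClosed_eq (by fun_prop) continuous_const
        have := (TopologicalSpace.denseRange_denseSeq H).closure_eq
        have hsub : closure (range d) ⊆ {w : H | inner ℝ w z = (0 : ℝ)} :=
          hcl.closure_subset_iff.2 (by
            rintro _ ⟨j, rfl⟩
            exact hz _ (Submodule.subset_span ⟨j, rfl⟩))
        rw [this] at hsub
        exact hsub (mem_univ w)
      exact inner_self_eq_zero.1 (hz' z)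
  have hrat : ∀ q : ℚ, 0 ≤ q → ∀ φ, CauchySeq fun n ↦ (inner ℝ (u (ψ n) q) φ : ℝ) := by
    intro q hq0
    refine cauchySeq_inner_of_dense (fun n ↦ hM (ψ n) q (by exact_mod_cast hq0)) hdense ?_
    rintro _ ⟨j, rfl⟩
    exact ((tendsto_pi_nhds.1 hy) (⟨q, hq0⟩, j)).cauchySeq
  have hall : ∀ t, 0 ≤ t → ∀ φ, CauchySeq fun n ↦ (inner ℝ (u (ψ n) t) φ : ℝ) := by
    intro t ht
    refine cauchySeq_inner_of_dense (fun n ↦ hM (ψ n) t ht) hD fun φ hφ ↦ ?_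
    obtain ⟨K, r, hr, hev⟩ := heq φ hφ (t + 1)
    rw [Metric.cauchySeq_iff]
    intro ε hε
    -- Convergence at t is borrowed from a rational time q just after t. The gap q - t and the
    -- remainder `r` each cost at most ε/8, so the two transfers between t and q cost ε/2 in all and
    -- the Cauchy estimate at q another ε/4.
    obtain ⟨q, hq1, hq2⟩ := exists_rat_btwn
      (show t < t + min 1 (ε / (8 * (|K| + 1))) by
        have : 0 < min 1 (ε / (8 * (|K| + 1))) := by positivity
        linarith)
    have hq0 : (0 : ℚ) ≤ q := by exact_mod_cast ht.trans hq1.le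
    obtain ⟨N₁, hN₁⟩ := Metric.cauchySeq_iff.1 (hrat q hq0 φ) (ε / 4) (by positivity)
    have hr' : ∀ᶠ n in atTop, |r (ψ n)| < ε / (8 * (|K| + 1)) := by
      have := (hr.comp hψ.tendsto_atTop).abs
      simp only [abs_zero] at this
      exact this.eventually_lt_const (by positivity)
    obtain ⟨N₂, hN₂⟩ := (hr'.and (hψ.tendsto_atTop.eventually hev)).exists_forall_of_atTop
    have key : ∀ n ≥ N₂, |(inner ℝ (u (ψ n) q) φ : ℝ) - inner ℝ (u (ψ n) t) φ| ≤ ε / 4 := by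
      intro n hn
      have h1 : (q : ℝ) - t ≤ ε / (8 * (|K| + 1)) := by
        have := min_le_right 1 (ε / (8 * (|K| + 1)))
        linarith
      have h2 : (q : ℝ) ≤ t + 1 := by
        have := min_le_left 1 (ε / (8 * (|K| + 1)))
        linarith
      refine ((hN₂ n hn).2 t q ht hq1.le h2).trans ?_
      have h3 := (hN₂ n hn).1
      calc K * (q - t + r (ψ n)) ≤ |K| * |q - t + r (ψ n)| := by
            rw [← abs_mul]; exact le_abs_self _
        _ ≤ (|K| + 1) * (ε / (8 * (|K| + 1)) + ε / (8 * (|K| + 1))) := by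
            gcongr
            · linarith
            · refine (abs_add_le _ _).trans (add_le_add ?_ h3.le)
              rw [abs_of_nonneg (by linarith)]; exact h1
        _ = ε / 4 := by field_simp; ring
    refine ⟨max N₁ N₂, fun m hm n hn ↦ ?_⟩
    have a1 := hN₁ m ((le_max_left _ _).trans hm) n ((le_max_left _ _).trans hn)
    have a2 := key m ((le_max_right _ _).trans hm)
    have a3 := key n ((le_max_right _ _).trans hn)
    rw [Real.dist_eq] at a1 ⊢
    rw [abs_le] at a2 a3
    rw [abs_lt] at a1 ⊢
    constructor <;> linarith [a1.1, a1.2, a2.1, a2.2, a3.1, a3.2]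
  choose v hv using fun (t : ℝ) (ht : 0 ≤ t) ↦
    exists_weak_limit (fun n ↦ hM (ψ n) t ht) (hall t ht)
  refine ⟨ψ, fun t ↦ if ht : 0 ≤ t then v t ht else 0, hψ, fun t ht ↦ ?_, fun t ht φ ↦ ?_⟩
  · simp [not_le.2 ht]
  · simpa [ht] using hv t ht φ

/-- The norm is sequentially lower semicontinuous for weak convergence. -/
theorem norm_le_of_weak_limit {ι : Type*} {l : Filter ι} [l.NeBot] {u : ι → H} {a : H} {M : ℝ}
    (hM : ∀ᶠ n in l, ‖u n‖ ≤ M)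
    (hw : Tendsto (fun n ↦ inner ℝ (u n) a) l (𝓝 (inner ℝ a a))) : ‖a‖ ≤ M := by
  have h : inner ℝ a a ≤ M * ‖a‖ := le_of_tendsto hw (hM.mono fun n hn ↦
    (real_inner_le_norm _ _).trans (mul_le_mul_of_nonneg_right hn (norm_nonneg _)))
  rw [real_inner_self_eq_norm_sq] at h
  obtain ⟨n, hn⟩ := hM.exists
  rcases (norm_nonneg a).eq_or_lt with h0 | h0
  · rw [← h0]; exact (norm_nonneg _).trans hn
  · nlinarith

/-- Weakly measurable functions with values in a separable Hilbert space are measurable. -/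
theorem stronglyMeasurable_of_inner [CompleteSpace H] [TopologicalSpace.SeparableSpace H]
    {X : Type*} [MeasurableSpace X] {v : X → H}
    (h : ∀ φ, Measurable fun x ↦ (inner ℝ (v x) φ : ℝ)) : StronglyMeasurable v := by
  borelize H
  have : SecondCountableTopology H := UniformSpace.secondCountable_of_separable H
  refine Measurable.stronglyMeasurable ?_
  have hnorm : ∀ w : H, Measurable fun x ↦ ‖v x - w‖ := by
    intro w
    let d : ℕ → H := TopologicalSpace.denseSeq H
    -- Pettis' argument: a norm bound is a countable family of bounds on pairings with a dense
    -- sequence. Open sets are then countable unions of balls with dense centres and rational radii.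
    have hset : ∀ c : ℝ, 0 ≤ c → {x | ‖v x - w‖ ≤ c} =
        ⋂ j, {x | (inner ℝ (v x) (d j) : ℝ) - inner ℝ w (d j) ≤ c * ‖d j‖} := by
      intro c hc
      ext x
      simp only [mem_ofPred_eq, mem_iInter, ← inner_sub_left]
      constructor
      · exact fun hx j ↦ (real_inner_le_norm _ _).trans
          (mul_le_mul_of_nonneg_right hx (norm_nonneg _))
      · intro hx
        have hcl : IsClosed {z : H | (inner ℝ (v x - w) z : ℝ) ≤ c * ‖z‖} :=
          isClosed_le (by fun_prop) (by fun_prop)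
        have hsub : closure (range d) ⊆ {z : H | (inner ℝ (v x - w) z : ℝ) ≤ c * ‖z‖} :=
          hcl.closure_subset_iff.2 (by rintro _ ⟨j, rfl⟩; exact hx j)
        rw [(TopologicalSpace.denseRange_denseSeq H).closure_eq] at hsub
        have h1 := hsub (mem_univ (v x - w))
        simp only [mem_ofPred_eq, real_inner_self_eq_norm_sq] at h1
        rcases (norm_nonneg (v x - w)).eq_or_lt with h0 | h0
        · rwa [← h0]
        · nlinarith
    refine measurable_of_Iic fun c ↦ ?_
    have : (fun x ↦ ‖v x - w‖) ⁻¹' Iic c = {x | ‖v x - w‖ ≤ c} := rfl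
    rw [this]
    rcases lt_or_ge c 0 with hc | hc
    · convert MeasurableSet.empty
      ext x
      simpa using hc.trans_le (norm_nonneg (v x - w))
    rw [hset c hc]
    exact MeasurableSet.iInter fun j ↦ measurableSet_le ((h _).sub_const _) measurable_const
  refine measurable_of_isOpen fun U hU ↦ ?_
  have hball : v ⁻¹' U = ⋃ p : {p : ℕ × ℚ // Metric.ball (TopologicalSpace.denseSeq H p.1) p.2 ⊆ U},
      {x | ‖v x - TopologicalSpace.denseSeq H p.1.1‖ < p.1.2} := by
    ext x
    simp only [mem_preimage, mem_iUnion, mem_ofPred_eq]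
    constructor
    · intro hx
      obtain ⟨ε, hε, hεU⟩ := Metric.isOpen_iff.1 hU _ hx
      obtain ⟨q, hq0, hq⟩ := exists_rat_btwn (half_pos hε)
      obtain ⟨j, hj⟩ := (TopologicalSpace.denseRange_denseSeq H).exists_dist_lt (v x) hq0
      refine ⟨⟨(j, q), fun z hz ↦ hεU ?_⟩, by rwa [dist_eq_norm] at hj⟩
      rw [Metric.mem_ball] at hz ⊢
      rw [dist_comm] at hj
      linarith [dist_triangle z (TopologicalSpace.denseSeq H j) (v x)]
    · rintro ⟨p, hp⟩
      exact p.2 (by rwa [Metric.mem_ball, dist_eq_norm])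
  rw [hball]
  exact MeasurableSet.iUnion fun p ↦ measurableSet_lt (hnorm _) measurable_const

end WeakConvergence

/-! ### From difference quotients in time to the weak time derivative. -/

section TimeLimit

variable {H : Type*} [NormedAddCommGroup H] [InnerProductSpace ℝ H]

theorem intervalIntegrable_of_norm_le {f : ℝ → ℝ} (hf : StronglyMeasurable f) {a b C : ℝ}
    (hab : a ≤ b) (h : ∀ t, a < t → t ≤ b → |f t| ≤ C) : IntervalIntegrable f volume a b := by
  rw [intervalIntegrable_iff_integrableOn_Ioc_of_le hab]
  refine Measure.integrableOn_of_bounded (M := C) (by simp) hf.aestronglyMeasurable ?_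
  exact (ae_restrict_iff' measurableSet_Ioc).2 (ae_of_all _ fun t ht ↦ h t ht.1 ht.2)

/-- Summation by parts in time, for step functions of step `h`. -/
theorem integral_increments_eq {w : ℝ → H} {w₀ : H} {φ : ℝ → H} {h T M : ℝ} (hh : 0 < h)
    (hh1 : h ≤ 1) (hT : 0 ≤ T) (hw : StronglyMeasurable w)
    (hM : ∀ t, 0 ≤ t → t ≤ T + 1 → ‖w t‖ ≤ M) (hinit : ∀ t, 0 ≤ t → t < h → w t = w₀)
    (hφ : Continuous φ) (hsupp : ∀ t, T ≤ t → φ t = 0) :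
    ∫ t in (0 : ℝ)..(T + 1), (h⁻¹ * inner ℝ (w (t + h) - w t) (φ t)
        - inner ℝ (w t) (h⁻¹ • (φ (t - h) - φ t)))
      = - (h⁻¹ * ∫ t in (0 : ℝ)..h, inner ℝ w₀ (φ (t - h))) := by
  have hM0 : 0 ≤ M := (norm_nonneg _).trans (hM 0 le_rfl (by linarith))
  obtain ⟨C, hC⟩ := (isCompact_Icc (a := (-1 : ℝ)) (b := T + 1)).exists_bound_of_continuousOn
    hφ.continuousOn
  have hC0 : 0 ≤ C := (norm_nonneg _).trans (hC 0 ⟨by linarith, by linarith⟩)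
  have hm : ∀ s r : ℝ, StronglyMeasurable fun t ↦ (inner ℝ (w (t + s)) (φ (t - r)) : ℝ) := by
    intro s r
    exact (hw.comp_measurable (measurable_id.add_const s)).inner
      ((hφ.comp (by fun_prop : Continuous fun t : ℝ ↦ t - r)).stronglyMeasurable)
  have hb : ∀ t s : ℝ, 0 ≤ t → t ≤ T + 1 → -1 ≤ s → s ≤ T + 1 →
      |(inner ℝ (w t) (φ s) : ℝ)| ≤ M * C := by
    intro t s h1 h2 h3 h4
    exact (abs_real_inner_le_norm _ _).trans
      (mul_le_mul (hM t h1 h2) (hC s ⟨h3, h4⟩) (norm_nonneg _) hM0)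
  have i1 : IntervalIntegrable (fun t ↦ (inner ℝ (w (t + h)) (φ t) : ℝ)) volume 0 (T + 1) := by
    refine intervalIntegrable_of_norm_le (C := M * C) (by simpa using hm h 0) (by linarith) ?_
    intro t h1 h2
    rcases le_or_gt T t with h3 | h3
    · rw [hsupp t h3]; simpa using mul_nonneg hM0 hC0
    · exact hb _ _ (by linarith) (by linarith) (by linarith) h2
  have i2 : IntervalIntegrable (fun t ↦ (inner ℝ (w t) (φ t) : ℝ)) volume 0 (T + 1) :=
    intervalIntegrable_of_norm_le (C := M * C) (by simpa using hm 0 0) (by linarith)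
      fun t h1 h2 ↦ hb _ _ h1.le h2 (by linarith) h2
  have i3 : IntervalIntegrable (fun t ↦ (inner ℝ (w t) (φ (t - h)) : ℝ)) volume 0 (T + 1) :=
    intervalIntegrable_of_norm_le (C := M * C) (by simpa using hm 0 h) (by linarith)
      fun t h1 h2 ↦ hb _ _ h1.le h2 (by linarith) (by linarith)
  -- The time shift falls on φ. The interval [T + 1, T + 1 + h] contributes nothing, since t - h ≥ T
  -- there because h ≤ 1; the missing interval [0, h] becomes the initial term.
  have e1 : ∫ t in (0 : ℝ)..(T + 1), (inner ℝ (w (t + h)) (φ t) : ℝ)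
      = ∫ t in h..(T + 1), inner ℝ (w t) (φ (t - h)) := by
    have := intervalIntegral.integral_comp_add_right (a := 0) (b := T + 1)
      (fun t ↦ (inner ℝ (w t) (φ (t - h)) : ℝ)) h
    simp only [add_sub_cancel_right, zero_add] at this
    rw [this]
    have hz : ∫ t in (T + 1)..(T + 1 + h), (inner ℝ (w t) (φ (t - h)) : ℝ) = 0 := by
      rw [intervalIntegral.integral_of_le (by linarith)]
      refine setIntegral_eq_zero_of_forall_eq_zero fun t ht ↦ ?_
      rw [hsupp _ (by linarith [ht.1]), inner_zero_right]
    have i4 : IntervalIntegrable (fun t ↦ (inner ℝ (w t) (φ (t - h)) : ℝ)) volume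
        (T + 1) (T + 1 + h) :=
      intervalIntegrable_of_norm_le (C := 0) (by simpa using hm 0 h) (by linarith)
        fun t h1 h2 ↦ by rw [hsupp _ (by linarith), inner_zero_right, abs_zero]
    have i5 : IntervalIntegrable (fun t ↦ (inner ℝ (w t) (φ (t - h)) : ℝ)) volume h (T + 1) :=
      i3.mono_set (by
        rw [uIcc_of_le (by linarith), uIcc_of_le (by linarith)]
        exact Icc_subset_Icc_left hh.le)
    rw [← intervalIntegral.integral_add_adjacent_intervals i5 i4, hz, add_zero]
  have e2 : ∫ t in h..(T + 1), (inner ℝ (w t) (φ (t - h)) : ℝ)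
      = (∫ t in (0 : ℝ)..(T + 1), inner ℝ (w t) (φ (t - h)))
        - ∫ t in (0 : ℝ)..h, inner ℝ w₀ (φ (t - h)) := by
    have : ∫ t in (0 : ℝ)..h, (inner ℝ w₀ (φ (t - h)) : ℝ)
        = ∫ t in (0 : ℝ)..h, inner ℝ (w t) (φ (t - h)) := by
      rw [intervalIntegral.integral_of_le hh.le, intervalIntegral.integral_of_le hh.le,
        integral_Ioc_eq_integral_Ioo, integral_Ioc_eq_integral_Ioo]
      refine setIntegral_congr_fun measurableSet_Ioo fun t ht ↦ ?_
      simp only [hinit t ht.1.le ht.2]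
    rw [this, intervalIntegral.integral_interval_sub_left]
    · exact i3
    · exact i3.mono_set (by
        rw [uIcc_of_le (by linarith), uIcc_of_le (by linarith)]
        exact Icc_subset_Icc_right (by linarith))
  have e3 : ∀ t, h⁻¹ * inner ℝ (w (t + h) - w t) (φ t)
        - inner ℝ (w t) (h⁻¹ • (φ (t - h) - φ t))
      = h⁻¹ * (inner ℝ (w (t + h)) (φ t) - inner ℝ (w t) (φ (t - h))) := by
    intro t
    rw [inner_sub_left, inner_smul_right, inner_sub_right]
    ring
  simp_rw [e3]
  rw [intervalIntegral.integral_const_mul, intervalIntegral.integral_sub i1 i3, e1, e2]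
  ring

/-- Passage to the limit in the time derivative of a sequence of step functions: the limit curve
satisfies the weak formulation whose right-hand side is the limit of the increments. -/
theorem weak_form_of_increments {w : ℕ → ℝ → H} {W : ℝ → H} {h : ℕ → ℝ} {w₀ : ℕ → H} {a : H}
    {φ φ' : ℝ → H} {B : ℝ → ℝ} {T M K : ℝ} (hT : 0 ≤ T) (hh : ∀ n, 0 < h n) (hh1 : ∀ n, h n ≤ 1)
    (hh0 : Tendsto h atTop (𝓝 0)) (hmeas : ∀ n, StronglyMeasurable (w n))
    (hM : ∀ n t, 0 ≤ t → t ≤ T + 1 → ‖w n t‖ ≤ M)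
    (hinit : ∀ n t, 0 ≤ t → t < h n → w n t = w₀ n)
    (hφ : ∀ t, HasDerivAt φ (φ' t) t) (hφ' : Continuous φ') (hsupp : ∀ t, T ≤ t → φ t = 0)
    (hw : ∀ t, 0 ≤ t → ∀ ψ, Tendsto (fun n ↦ inner ℝ (w n t) ψ) atTop (𝓝 (inner ℝ (W t) ψ)))
    (ha : Tendsto (fun n ↦ inner ℝ (w₀ n) (φ 0)) atTop (𝓝 (inner ℝ a (φ 0))))
    (hB : ∀ᵐ t ∂(volume.restrict (Ioo 0 T)), Tendsto
      (fun n ↦ (h n)⁻¹ * inner ℝ (w n (t + h n) - w n t) (φ t)) atTop (𝓝 (B t)))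
    (hK : ∀ n t, 0 < t → t < T → |(h n)⁻¹ * inner ℝ (w n (t + h n) - w n t) (φ t)| ≤ K)
    (hBT : ∀ t, T ≤ t → B t = 0) :
    (∫ t in Ioi (0 : ℝ), (inner ℝ (W t) (φ' t) + B t)) + inner ℝ a (φ 0) = 0 := by
  have hM0 : 0 ≤ M := (norm_nonneg _).trans (hM 0 0 le_rfl (by linarith))
  have hφc : Continuous φ := continuous_iff_continuousAt.2 fun t ↦ (hφ t).continuousAt
  obtain ⟨L, hL⟩ := (isCompact_Icc (a := (-1 : ℝ)) (b := T + 1)).exists_bound_of_continuousOn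
    hφ'.continuousOn
  have hL0 : 0 ≤ L := (norm_nonneg _).trans (hL 0 ⟨by linarith, by linarith⟩)
  have hlip : ∀ s t, -1 ≤ s → s ≤ T + 1 → -1 ≤ t → t ≤ T + 1 → ‖φ t - φ s‖ ≤ L * ‖t - s‖ := by
    intro s t h1 h2 h3 h4
    exact (convex_Icc (-1 : ℝ) (T + 1)).norm_image_sub_le_of_norm_hasDerivWithin_le
      (fun x _ ↦ (hφ x).hasDerivWithinAt) hL ⟨h1, h2⟩ ⟨h3, h4⟩
  let J : ℕ → ℝ → ℝ := fun n t ↦ (h n)⁻¹ * inner ℝ (w n (t + h n) - w n t) (φ t)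
        - inner ℝ (w n t) ((h n)⁻¹ • (φ (t - h n) - φ t))
  have hJ : ∀ n, ∫ t in (0 : ℝ)..(T + 1), J n t
      = - ((h n)⁻¹ * ∫ t in (0 : ℝ)..h n, inner ℝ (w₀ n) (φ (t - h n))) := fun n ↦
    integral_increments_eq (hh n) (hh1 n) hT (hmeas n) (hM n) (hinit n) hφc hsupp
  have hlim1 : Tendsto (fun n ↦ ∫ t in (0 : ℝ)..(T + 1), J n t) atTop (𝓝 (-inner ℝ a (φ 0))) := by
    simp_rw [hJ]
    refine Tendsto.neg ?_
    -- The initial term averages φ over [-h, 0], where φ is within L h of φ 0.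
    have hdiff : ∀ n, ‖(h n)⁻¹ * (∫ t in (0 : ℝ)..h n, inner ℝ (w₀ n) (φ (t - h n)))
        - inner ℝ (w₀ n) (φ 0)‖ ≤ M * L * h n := by
      intro n
      have hn := hh n
      have hw0 : ‖w₀ n‖ ≤ M := by
        rw [← hinit n 0 le_rfl hn]; exact hM n 0 le_rfl (by linarith)
      have e : (h n)⁻¹ * (∫ t in (0 : ℝ)..h n, inner ℝ (w₀ n) (φ (t - h n)))
          - inner ℝ (w₀ n) (φ 0)
          = (h n)⁻¹ * ∫ t in (0 : ℝ)..h n, (inner ℝ (w₀ n) (φ (t - h n) - φ 0) : ℝ) := by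
        simp_rw [inner_sub_right]
        rw [intervalIntegral.integral_sub, intervalIntegral.integral_const, sub_zero, mul_sub,
          smul_eq_mul, inv_mul_cancel_left₀ hn.ne']
        · exact (Continuous.inner continuous_const
            (hφc.comp (by fun_prop))).intervalIntegrable _ _
        · exact continuous_const.intervalIntegrable _ _
      rw [e, norm_mul, norm_inv, Real.norm_of_nonneg hn.le]
      have hI : ‖∫ t in (0 : ℝ)..h n, (inner ℝ (w₀ n) (φ (t - h n) - φ 0) : ℝ)‖
          ≤ M * (L * h n) * |h n - 0| := by
        refine intervalIntegral.norm_integral_le_of_norm_le_const fun t ht ↦ ?_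
        rw [uIoc_of_le hn.le] at ht
        refine (norm_inner_le_norm _ _).trans (mul_le_mul hw0 ?_ (norm_nonneg _) hM0)
        refine (hlip 0 (t - h n) (by linarith) (by linarith) (by linarith [ht.1, hh1 n])
          (by linarith [ht.2])).trans ?_
        refine mul_le_mul_of_nonneg_left ?_ hL0
        rw [sub_zero, Real.norm_eq_abs, abs_le]
        constructor <;> linarith [ht.1, ht.2]
      rw [sub_zero, abs_of_pos hn] at hI
      calc (h n)⁻¹ * _ ≤ (h n)⁻¹ * (M * (L * h n) * h n) := by gcongr
        _ = M * L * h n := by field_simp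
    have h0 : Tendsto (fun n ↦ (h n)⁻¹ * (∫ t in (0 : ℝ)..h n, inner ℝ (w₀ n) (φ (t - h n)))
        - inner ℝ (w₀ n) (φ 0)) atTop (𝓝 0) :=
      squeeze_zero_norm hdiff (by simpa using hh0.const_mul (M * L))
    simpa using h0.add ha
  have hlim2 : Tendsto (fun n ↦ ∫ t in (0 : ℝ)..(T + 1), J n t) atTop
      (𝓝 (∫ t in (0 : ℝ)..(T + 1), (inner ℝ (W t) (φ' t) + B t))) := by
    refine intervalIntegral.tendsto_integral_filter_of_dominated_convergence
      (fun _ ↦ |K| + M * L) (Eventually.of_forall fun n ↦ ?_) (Eventually.of_forall fun n ↦ ?_)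
      (by simp) ?_
    · refine StronglyMeasurable.aestronglyMeasurable ?_
      refine StronglyMeasurable.sub ?_ ?_
      · exact (((hmeas n).comp_measurable (measurable_id.add_const (h n))).sub
          (hmeas n)).inner hφc.stronglyMeasurable |>.const_mul _
      · exact (hmeas n).inner (Continuous.stronglyMeasurable (by fun_prop))
    · refine ae_of_all _ fun t ht ↦ ?_
      rw [uIoc_of_le (by linarith)] at ht
      have hn := hh n
      refine (norm_sub_le _ _).trans (add_le_add ?_ ?_)
      · rcases le_or_gt T t with h3 | h3
        · rw [hsupp t h3]; simp
        · exact (hK n t ht.1 h3).trans (le_abs_self K)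
      · refine (norm_inner_le_norm _ _).trans
          (mul_le_mul (hM n t ht.1.le ht.2) ?_ (norm_nonneg _) hM0)
        have := hlip t (t - h n) (by linarith [ht.1]) ht.2 (by linarith [ht.1, hh1 n])
          (by linarith [ht.2])
        rw [norm_smul, norm_inv, Real.norm_of_nonneg hn.le]
        rw [sub_sub_cancel_left, norm_neg, Real.norm_of_nonneg hn.le] at this
        calc (h n)⁻¹ * _ ≤ (h n)⁻¹ * (L * h n) := by gcongr
          _ = L := by field_simp
    · have hT' : ∀ᵐ t ∂(volume : Measure ℝ), t ≠ T := by simp [ae_iff, measure_singleton]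
      rw [ae_restrict_iff' measurableSet_Ioo] at hB
      filter_upwards [hB, hT'] with t htB htT ht
      rw [uIoc_of_le (by linarith)] at ht
      rw [add_comm]
      -- The backward quotient converges strongly, so its pairing with the weakly convergent `w n t`
      -- converges.
      have hder : Tendsto (fun n ↦ (h n)⁻¹ • (φ (t - h n) - φ t)) atTop (𝓝 (-φ' t)) := by
        have h1 := (hasDerivAt_iff_tendsto_slope.1 (hφ t))
        have h2 : Tendsto (fun n ↦ t - h n) atTop (𝓝[≠] t) := by
          refine tendsto_nhdsWithin_iff.2 ⟨by simpa using hh0.const_sub t, ?_⟩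
          exact Eventually.of_forall fun n ↦ by simpa using (hh n).ne'
        have h3 := (h1.comp h2).neg
        refine h3.congr fun n ↦ ?_
        simp only [Function.comp, slope_def_module]
        rw [sub_sub_cancel_left, inv_neg, neg_smul, neg_neg]
      have h2 := tendsto_inner_of_weak_of_strong (M := M)
        (Eventually.of_forall fun n ↦ hM n t ht.1.le ht.2) (hw t ht.1.le _) hder
      rw [inner_neg_right] at h2
      have h1 : Tendsto (fun n ↦ (h n)⁻¹ * inner ℝ (w n (t + h n) - w n t) (φ t)) atTop
          (𝓝 (B t)) := by
        rcases lt_or_gt_of_ne htT with h3 | h3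
        · exact htB ⟨ht.1, h3⟩
        · rw [hBT t h3.le, hsupp t h3.le]; simp
      simpa using h1.sub h2
  have hEq := tendsto_nhds_unique hlim2 hlim1
  have hIoi : ∫ t in Ioi (0 : ℝ), (inner ℝ (W t) (φ' t) + B t)
      = ∫ t in (0 : ℝ)..(T + 1), (inner ℝ (W t) (φ' t) + B t) := by
    rw [intervalIntegral.integral_of_le (by linarith)]
    refine setIntegral_eq_of_subset_of_forall_sdiff_eq_zero measurableSet_Ioi
      Ioc_subset_Ioi_self fun t ht ↦ ?_
    have h1 : T < t := by
      by_contra h2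
      exact ht.2 ⟨ht.1, by linarith⟩
    have h2 : φ' t = 0 := by
      have : φ =ᶠ[𝓝 t] fun _ ↦ 0 := by
        filter_upwards [lt_mem_nhds h1] with s hs using hsupp s hs.le
      exact (hφ t).unique ((hasDerivAt_const t (0 : H)).congr_of_eventuallyEq this)
    rw [h2, hBT t h1.le]; simp
  rw [hIoi, hEq]; ring

end TimeLimit

/-! ### Square integrable functions and their classes. -/

section SquareIntegrableFields

variable {E : Type*} [NormedAddCommGroup E]

open Classical in
/-- The class in `L²` of a square integrable function. -/
def l2 (f : Plane → E) : Lp E 2 (volume : Measure Plane) :=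
  if h : MemLp f 2 volume then h.toLp f else 0

theorem coeFn_l2 {f : Plane → E} (h : MemLp f 2 volume) : l2 f =ᵐ[volume] f := by
  rw [l2, dif_pos h]; exact h.coeFn_toLp

theorem l2_sub {f g : Plane → E} (hf : MemLp f 2 volume) (hg : MemLp g 2 volume) :
    l2 (fun x ↦ f x - g x) = l2 f - l2 g := by
  have : MemLp (fun x ↦ f x - g x) 2 volume := hf.sub hg
  rw [l2, l2, l2, dif_pos hf, dif_pos hg, dif_pos this]
  exact MemLp.toLp_sub hf hg

theorem l2_smul [NormedSpace ℝ E] {f : Plane → E} (hf : MemLp f 2 volume) (c : ℝ) :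
    l2 (fun x ↦ c • f x) = c • l2 f := by
  have : MemLp (fun x ↦ c • f x) 2 volume := hf.const_smul c
  rw [l2, l2, dif_pos hf, dif_pos this]
  exact MemLp.toLp_const_smul c hf

theorem l2_zero : l2 (fun _ ↦ (0 : E)) = 0 := by
  have : MemLp (fun _ : Plane ↦ (0 : E)) 2 volume := MemLp.zero'
  rw [l2, dif_pos this]
  exact MemLp.toLp_zero _

theorem inner_l2 [InnerProductSpace ℝ E] (u : Lp E 2 (volume : Measure Plane)) {f : Plane → E}
    (h : MemLp f 2 volume) : inner ℝ u (l2 f) = ∫ x, inner ℝ (u x) (f x) := by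
  rw [L2.inner_def]
  refine integral_congr_ae ?_
  filter_upwards [coeFn_l2 h] with x hx
  rw [hx]

theorem integrable_inner_l2 [InnerProductSpace ℝ E] (u : Lp E 2 (volume : Measure Plane))
    {f : Plane → E} (h : MemLp f 2 volume) : Integrable (fun x ↦ (inner ℝ (u x) (f x) : ℝ)) := by
  refine (L2.integrable_inner (𝕜 := ℝ) u (l2 f)).congr ?_
  filter_upwards [coeFn_l2 h] with x hx
  rw [hx]

theorem enorm_l2 {f : Plane → E} (h : MemLp f 2 volume) :
    ‖l2 f‖ₑ = eLpNorm f 2 volume := by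
  rw [l2, dif_pos h, Lp.enorm_toLp]

/-- The constant in the bound of the `L²` norm of a bounded function supported in a ball. -/
def ballConst (R : ℝ) : ℝ := ((volume : Measure Plane) (Metric.closedBall 0 R) ^ (1 / 2 : ℝ)).toReal

theorem ballConst_nonneg (R : ℝ) : 0 ≤ ballConst R := ENNReal.toReal_nonneg

theorem eLpNorm_le_of_support {f : Plane → E} {R c : ℝ} (hsupp : ∀ x, R < ‖x‖ → f x = 0)
    (hc : ∀ x, ‖f x‖ ≤ c) :
    eLpNorm f 2 volume ≤ ENNReal.ofReal (c * ballConst R) := by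
  have hc0 : 0 ≤ c := (norm_nonneg _).trans (hc 0)
  have h1 : eLpNorm f 2 volume ≤
      eLpNorm ((Metric.closedBall (0 : Plane) R).indicator fun _ ↦ c) 2 volume := by
    refine eLpNorm_mono fun x ↦ ?_
    by_cases hx : x ∈ Metric.closedBall (0 : Plane) R
    · rw [indicator_of_mem hx, Real.norm_of_nonneg hc0]; exact hc x
    · rw [mem_closedBall_zero_iff, not_le] at hx
      rw [hsupp x hx]; simp
  refine h1.trans ?_
  rw [eLpNorm_indicator_const Metric.isClosed_closedBall.measurableSet (by simp) (by simp),
    ENNReal.ofReal_mul hc0, ballConst, ENNReal.ofReal_toReal, Real.enorm_of_nonneg hc0]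
  · simp
  · exact ENNReal.rpow_ne_top_of_nonneg (by norm_num) (isCompact_closedBall _ _).measure_lt_top.ne

/-- No measurability is needed: outside L² the default value 0 of `l2` satisfies the bound. -/
theorem norm_l2_le {f : Plane → E} {R c : ℝ} (hsupp : ∀ x, R < ‖x‖ → f x = 0)
    (hc : ∀ x, ‖f x‖ ≤ c) : ‖l2 f‖ ≤ c * ballConst R := by
  have hc0 : 0 ≤ c := (norm_nonneg _).trans (hc 0)
  by_cases h : MemLp f 2 volume
  · rw [← toReal_enorm, enorm_l2 h]
    exact ENNReal.toReal_le_of_le_ofReal (mul_nonneg hc0 (ballConst_nonneg R))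
      (eLpNorm_le_of_support hsupp hc)
  · rw [l2, dif_neg h, norm_zero]
    exact mul_nonneg hc0 (ballConst_nonneg R)

end SquareIntegrableFields

/-! ### Test functions of space and time as smooth curves in L². -/

section TestFunctions

variable {E F : Type*} [NormedAddCommGroup E] [NormedSpace ℝ E] [NormedAddCommGroup F]
  [NormedSpace ℝ F]

theorem IsTest.memLp {f : Plane → F} (hf : IsTest f) (p : ℝ≥0∞) : MemLp f p volume :=
  hf.1.continuous.memLp_of_hasCompactSupport hf.2

theorem IsTest.continuous {f : E → F} (hf : IsTest f) : Continuous f := hf.1.continuous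

theorem IsTest.differentiable {f : E → F} (hf : IsTest f) : Differentiable ℝ f :=
  hf.1.differentiable (by simp)

theorem IsTest.toFDeriv {f : E → F} (hf : IsTest f) : IsTest (fderiv ℝ f) :=
  ⟨hf.1.fderiv_right (by simp), hf.2.fderiv ℝ⟩

theorem IsTest.fderiv_apply {f : E → F} (hf : IsTest f) (e : E) :
    IsTest fun x ↦ fderiv ℝ f x e :=
  ⟨hf.toFDeriv.1.clm_apply contDiff_const, hf.2.fderiv_apply ℝ e⟩

theorem IsTest.clm_comp {G : Type*} [NormedAddCommGroup G] [NormedSpace ℝ G] {f : E → F}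
    (hf : IsTest f) (L : F →L[ℝ] G) : IsTest fun x ↦ L (f x) :=
  ⟨L.contDiff.comp hf.1, hf.2.comp_left (g := L) (map_zero L)⟩

theorem IsTest.exists_bound {f : E → F} (hf : IsTest f) : ∃ C, 0 ≤ C ∧ ∀ x, ‖f x‖ ≤ C := by
  obtain ⟨C, hC⟩ := hf.continuous.bounded_above_of_compact_support hf.2
  exact ⟨max C 0, le_max_right _ _, fun x ↦ (hC x).trans (le_max_left _ _)⟩

theorem IsTest.exists_lipschitz {f : E → F} (hf : IsTest f) :
    ∃ C, 0 ≤ C ∧ ∀ x y, ‖f x - f y‖ ≤ C * ‖x - y‖ := by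
  obtain ⟨C, hC0, hC⟩ := hf.toFDeriv.exists_bound
  exact ⟨C, hC0, fun x y ↦ convex_univ.norm_image_sub_le_of_norm_fderiv_le
    (fun z _ ↦ hf.differentiable z) (fun z _ ↦ hC z) (mem_univ y) (mem_univ x)⟩

/-- A test function whose derivatives of order at most two are bounded by `C`, and whose support
is in the ball of radius `R`. -/
structure ControlledTest (f : Plane → F) (C R : ℝ) : Prop where
  isTest : IsTest f
  bound : ∀ x, ‖f x‖ ≤ C
  bound_fderiv : ∀ x, ‖fderiv ℝ f x‖ ≤ C
  lipschitz_fderiv : ∀ x y, ‖fderiv ℝ f x - fderiv ℝ f y‖ ≤ C * ‖x - y‖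
  support : ∀ x, R < ‖x‖ → f x = 0

theorem ControlledTest.nonneg {f : Plane → F} {C R : ℝ} (h : ControlledTest f C R) : 0 ≤ C :=
  (norm_nonneg _).trans (h.bound 0)

theorem hasFDerivAt_slice {φ : ℝ × Plane → F} (hφ : IsTest φ) (t : ℝ) (x : Plane) :
    HasFDerivAt (fun y ↦ φ (t, y))
      ((fderiv ℝ φ (t, x)).comp (ContinuousLinearMap.inr ℝ ℝ Plane)) x :=
  (hφ.differentiable (t, x)).hasFDerivAt.comp x (hasFDerivAt_prodMk_right t x)

theorem hasDerivAt_slice {φ : ℝ × Plane → F} (hφ : IsTest φ) (t : ℝ) (x : Plane) :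
    HasDerivAt (fun s ↦ φ (s, x)) (fderiv ℝ φ (t, x) (1, 0)) t := by
  have := ((hφ.differentiable (t, x)).hasFDerivAt.comp t (hasFDerivAt_prodMk_left t x)).hasDerivAt
  simpa [Function.comp_def] using this

theorem IsTest.slice {φ : ℝ × Plane → F} (hφ : IsTest φ) (t : ℝ) :
    IsTest fun y ↦ φ (t, y) := by
  refine ⟨hφ.1.comp (contDiff_const.prodMk contDiff_id), ?_⟩
  refine HasCompactSupport.intro (hφ.2.isCompact.image continuous_snd) fun x hx ↦ ?_
  by_contra h
  exact hx ⟨(t, x), subset_tsupport _ h, rfl⟩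

theorem IsTest.exists_support {φ : ℝ × Plane → F} (hφ : IsTest φ) :
    ∃ R, 0 ≤ R ∧ ∀ t x, R < |t| ∨ R < ‖x‖ → φ (t, x) = 0 := by
  obtain ⟨R, hR⟩ := hφ.2.isCompact.isBounded.exists_norm_le
  refine ⟨max R 0, le_max_right _ _, fun t x h ↦ ?_⟩
  by_contra h0
  have h1 : ‖((t, x) : ℝ × Plane)‖ ≤ max R 0 :=
    (hR _ (subset_tsupport _ h0)).trans (le_max_left _ _)
  rw [Prod.norm_def] at h1
  have h2 := (le_max_left _ _).trans h1
  have h3 := (le_max_right _ _).trans h1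
  simp only [Real.norm_eq_abs] at h2 h3
  rcases h with h | h <;> linarith

/-- The constants are independent of t, so that estimates for a fixed test function become uniform
in time. -/
theorem IsTest.exists_controlled_slice {φ : ℝ × Plane → F} (hφ : IsTest φ) :
    ∃ C R, 0 ≤ R ∧ (∀ t, ControlledTest (fun y ↦ φ (t, y)) C R) ∧
      ∀ t x, R < |t| ∨ R < ‖x‖ → φ (t, x) = 0 := by
  obtain ⟨R, hR0, hR⟩ := hφ.exists_support
  obtain ⟨C₀, h00, h0⟩ := hφ.exists_bound
  obtain ⟨C₁, h10, h1⟩ := hφ.toFDeriv.exists_bound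
  obtain ⟨C₂, h20, h2⟩ := hφ.toFDeriv.exists_lipschitz
  have hinr : ‖ContinuousLinearMap.inr ℝ ℝ Plane‖ ≤ 1 :=
    ContinuousLinearMap.opNorm_le_bound _ zero_le_one fun x ↦ by simp [Prod.norm_def]
  refine ⟨C₀ + C₁ + C₂, R, hR0, fun t ↦ ⟨hφ.slice t, fun x ↦ ?_, fun x ↦ ?_, fun x y ↦ ?_,
    fun x hx ↦ hR t x (Or.inr hx)⟩, hR⟩
  · linarith [h0 (t, x)]
  · rw [(hasFDerivAt_slice hφ t x).fderiv]
    refine (ContinuousLinearMap.opNorm_comp_le _ _).trans ?_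
    have := mul_le_mul (h1 (t, x)) hinr (norm_nonneg _) h10
    linarith
  · rw [(hasFDerivAt_slice hφ t x).fderiv, (hasFDerivAt_slice hφ t y).fderiv,
      ← ContinuousLinearMap.sub_comp]
    refine (ContinuousLinearMap.opNorm_comp_le _ _).trans ?_
    have h3 := h2 (t, x) (t, y)
    have h4 : ‖((t, x) : ℝ × Plane) - (t, y)‖ = ‖x - y‖ := by
      simp [Prod.norm_def]
    rw [h4] at h3
    have := mul_le_mul h3 hinr (norm_nonneg _) (by positivity)
    nlinarith [norm_nonneg (x - y)]

theorem IsTest.exists_controlled {f : Plane → F} (hf : IsTest f) :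
    ∃ C R, 0 ≤ R ∧ ControlledTest f C R := by
  obtain ⟨R, hR⟩ := hf.2.isCompact.isBounded.exists_norm_le
  obtain ⟨C₀, h00, h0⟩ := hf.exists_bound
  obtain ⟨C₁, h10, h1⟩ := hf.toFDeriv.exists_bound
  obtain ⟨C₂, h20, h2⟩ := hf.toFDeriv.exists_lipschitz
  refine ⟨C₀ + C₁ + C₂, max R 0, le_max_right _ _, hf, fun x ↦ ?_, fun x ↦ ?_, fun x y ↦ ?_,
    fun x hx ↦ ?_⟩
  · linarith [h0 x]
  · linarith [h1 x]
  · nlinarith [h2 x y, norm_nonneg (x - y)]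
  · by_contra h
    have := hR _ (subset_tsupport _ h)
    linarith [le_max_left R 0]

/-- The curve in `L²` of a test function of time and space is continuous. -/
theorem IsTest.continuous_l2 {φ : ℝ × Plane → F} (hφ : IsTest φ) :
    Continuous fun t ↦ l2 fun x ↦ φ (t, x) := by
  obtain ⟨C, hC0, hC⟩ := hφ.exists_lipschitz
  obtain ⟨R, hR0, hR⟩ := hφ.exists_support
  refine (LipschitzWith.of_dist_le_mul (K := ⟨C * ballConst R,
    mul_nonneg hC0 (ballConst_nonneg R)⟩) fun s t ↦ ?_).continuous
  rw [dist_eq_norm, ← l2_sub ((hφ.slice s).memLp 2) ((hφ.slice t).memLp 2)]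
  have : ‖l2 fun x ↦ φ (s, x) - φ (t, x)‖ ≤ (C * dist s t) * ballConst R := by
    refine norm_l2_le (fun x hx ↦ ?_) fun x ↦ ?_
    · rw [hR s x (Or.inr hx), hR t x (Or.inr hx), sub_zero]
    · refine (hC _ _).trans (le_of_eq ?_)
      simp [Prod.norm_def, dist_eq_norm]
  refine this.trans (le_of_eq ?_)
  change C * dist s t * ballConst R = C * ballConst R * dist s t
  ring

/-- The curve in `L²` of a test function of time and space is differentiable. -/
theorem IsTest.hasDerivAt_l2 {φ : ℝ × Plane → F} (hφ : IsTest φ) (t : ℝ) :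
    HasDerivAt (fun t ↦ l2 fun x ↦ φ (t, x)) (l2 fun x ↦ fderiv ℝ φ (t, x) (1, 0)) t := by
  have hψ : IsTest fun p ↦ fderiv ℝ φ p (1, 0) := hφ.fderiv_apply (1, 0)
  obtain ⟨C, hC0, hC⟩ := hψ.exists_lipschitz
  obtain ⟨R, hR0, hR⟩ := hφ.exists_support
  have hR' : ∀ s x, R < ‖x‖ → fderiv ℝ φ (s, x) (1, 0) = 0 := by
    intro s x hx
    have h1 := hasDerivAt_slice hφ s x
    have h2 : (fun r ↦ φ (r, x)) = fun _ ↦ 0 := funext fun r ↦ hR r x (Or.inr hx)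
    rw [h2] at h1
    exact h1.unique (hasDerivAt_const s 0)
  rw [hasDerivAt_iff_isLittleO, Asymptotics.isLittleO_iff]
  intro c hc
  have hpos : 0 < c / (C * ballConst R + 1) :=
    div_pos hc (by have := mul_nonneg hC0 (ballConst_nonneg R); linarith)
  filter_upwards [Metric.ball_mem_nhds t hpos] with s hs
  have m1 := (hφ.slice s).memLp 2
  have m2 := (hφ.slice t).memLp 2
  have m3 := (hψ.slice t).memLp 2
  rw [← l2_sub m1 m2, ← l2_smul m3,
    ← l2_sub (f := fun x ↦ φ (s, x) - φ (t, x))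
      (g := fun x ↦ (s - t) • fderiv ℝ φ (t, x) (1, 0)) (m1.sub m2) (m3.const_smul _)]
  have : ‖l2 fun x ↦ φ (s, x) - φ (t, x) - (s - t) • fderiv ℝ φ (t, x) (1, 0)‖
      ≤ (C * |s - t| * |s - t|) * ballConst R := by
    refine norm_l2_le (fun x hx ↦ ?_) fun x ↦ ?_
    · rw [hR s x (Or.inr hx), hR t x (Or.inr hx), hR' t x hx, smul_zero, sub_zero, sub_zero]
    -- The mean value inequality for φ(r, x) - r ∂ₜφ(t, x) gives an error C|s - t|² pointwise, and a
    -- fixed support turns it into an L² bound.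
    · have key := (convex_uIcc t s).norm_image_sub_le_of_norm_hasDerivWithin_le
        (f := fun r ↦ φ (r, x) - r • fderiv ℝ φ (t, x) (1, 0))
        (f' := fun r ↦ fderiv ℝ φ (r, x) (1, 0) - (1 : ℝ) • fderiv ℝ φ (t, x) (1, 0))
        (C := C * |s - t|)
        (fun r _ ↦ ((hasDerivAt_slice hφ r x).sub
          ((hasDerivAt_id r).smul_const _)).hasDerivWithinAt)
        (fun r hr ↦ by
          rw [one_smul]
          refine (hC (r, x) (t, x)).trans (mul_le_mul_of_nonneg_left ?_ hC0)
          simpa [Prod.norm_def] using abs_sub_left_of_mem_uIcc hr)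
        left_mem_uIcc right_mem_uIcc
      refine le_trans (le_of_eq ?_) key
      congr 1
      rw [sub_smul]; abel
  refine this.trans ?_
  rw [Metric.mem_ball, Real.dist_eq, lt_div_iff₀ (by
    have := mul_nonneg hC0 (ballConst_nonneg R); linarith)] at hs
  rw [Real.norm_eq_abs]
  have := mul_nonneg hC0 (ballConst_nonneg R)
  nlinarith [abs_nonneg (s - t)]

end TestFunctions

/-! ### Divergence-free fields as an orthogonal complement. -/

section DivergenceFree

theorem plane_eq_sum (a : Plane) : a = ∑ i : Fin 2, a i • EuclideanSpace.single i (1 : ℝ) := by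
  ext j
  fin_cases j <;> simp [Fin.sum_univ_two]

/-- The gradient, as a vector field. -/
def grad (ψ : Plane → ℝ) (x : Plane) : Plane :=
  ∑ i : Fin 2, fderiv ℝ ψ x (EuclideanSpace.single i 1) • EuclideanSpace.single i (1 : ℝ)

theorem fderiv_eq_sum (L : Plane →L[ℝ] ℝ) (a : Plane) :
    L a = ∑ i : Fin 2, a i * L (EuclideanSpace.single i 1) := by
  conv_lhs => rw [plane_eq_sum a]
  simp

theorem inner_grad (ψ : Plane → ℝ) (x a : Plane) : inner ℝ a (grad ψ x) = fderiv ℝ ψ x a := by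
  rw [grad, inner_sum, fderiv_eq_sum]
  refine Finset.sum_congr rfl fun i _ ↦ ?_
  rw [inner_smul_right, EuclideanSpace.inner_single_right]
  simp [mul_comm]

theorem IsTest.toGrad {ψ : Plane → ℝ} (hψ : IsTest ψ) : IsTest (grad ψ) := by
  have := hψ.toFDeriv.clm_comp
    (∑ i : Fin 2, (ContinuousLinearMap.apply ℝ ℝ
      (EuclideanSpace.single i (1 : ℝ) : Plane)).smulRight (EuclideanSpace.single i (1 : ℝ)))
  have h : grad ψ = fun x ↦ (∑ i : Fin 2, (ContinuousLinearMap.apply ℝ ℝ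
      (EuclideanSpace.single i (1 : ℝ) : Plane)).smulRight
        (EuclideanSpace.single i (1 : ℝ) : Plane)) (fderiv ℝ ψ x) := by
    ext1 x
    simp [grad]
  rw [h]
  exact this

/-- The closed subspace of divergence-free fields in `L²`. -/
def divFree : Submodule ℝ L2Vector :=
  (Submodule.span ℝ {g | ∃ ψ : Plane → ℝ, IsTest ψ ∧ g = l2 (grad ψ)})ᗮ

theorem inner_l2_grad (u : L2Vector) {ψ : Plane → ℝ} (hψ : IsTest ψ) :
    inner ℝ u (l2 (grad ψ)) = ∫ x, fderiv ℝ ψ x (u x) := by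
  rw [inner_l2 u (hψ.toGrad.memLp 2)]
  simp_rw [inner_grad]

theorem mem_divFree {u : L2Vector} : u ∈ divFree ↔ IsDivFree u := by
  rw [divFree, Submodule.mem_orthogonal']
  constructor
  · intro h ψ hψ
    rw [← inner_l2_grad u hψ]
    exact h _ (Submodule.subset_span ⟨ψ, hψ, rfl⟩)
  · intro h g hg
    induction hg using Submodule.span_induction with
    | mem x hx =>
      obtain ⟨ψ, hψ, rfl⟩ := hx
      rw [inner_l2_grad u hψ]
      exact h ψ hψ
    | zero => simp
    | add x y _ _ hx hy => rw [inner_add_right, hx, hy, add_zero]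
    | smul c x _ hx => rw [inner_smul_right, hx, mul_zero]

/-- Smooth divergence-free fields are divergence-free in the sense of distributions. -/
theorem l2_mem_divFree {f : Plane → Plane} (hf : IsTest f) (hdiv : ∀ x, divergence f x = 0) :
    l2 f ∈ divFree := by
  rw [mem_divFree]
  intro ψ hψ
  have h1 : ∫ x, fderiv ℝ ψ x (l2 f x) = ∫ x, fderiv ℝ ψ x (f x) := by
    refine integral_congr_ae ?_
    filter_upwards [coeFn_l2 (hf.memLp 2)] with x hx
    rw [hx]
  have hfi : ∀ i : Fin 2, IsTest fun x ↦ f x i := fun i ↦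
    hf.clm_comp (EuclideanSpace.proj i : Plane →L[ℝ] ℝ)
  have hint : ∀ {g k : Plane → ℝ}, IsTest g → IsTest k → Integrable fun x ↦ g x * k x := by
    intro g k hg hk
    exact (hg.continuous.mul hk.continuous).integrable_of_hasCompactSupport hg.2.mul_right
  have hfd : ∀ (i : Fin 2) x, fderiv ℝ (fun y ↦ f y i) x (EuclideanSpace.single i 1)
      = (fderiv ℝ f x (EuclideanSpace.single i 1)) i := by
    intro i x
    have := ((EuclideanSpace.proj i : Plane →L[ℝ] ℝ).hasFDerivAt.comp x
      (hf.differentiable x).hasFDerivAt).fderiv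
    change fderiv ℝ ((EuclideanSpace.proj i : Plane →L[ℝ] ℝ) ∘ f) x _ = _
    rw [this]; rfl
  rw [h1]
  have h2 : ∀ x, fderiv ℝ ψ x (f x)
        = ∑ i : Fin 2, f x i * fderiv ℝ ψ x (EuclideanSpace.single i 1) := by
    intro x
    conv_lhs => rw [plane_eq_sum (f x)]
    simp
  simp_rw [h2]
  rw [integral_finsetSum]
  · have h3 : ∀ i : Fin 2, ∫ x, f x i * fderiv ℝ ψ x (EuclideanSpace.single i 1)
        = -∫ x, fderiv ℝ (fun y ↦ f y i) x (EuclideanSpace.single i 1) * ψ x := fun i ↦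
      integral_mul_fderiv_eq_neg_fderiv_mul_of_integrable
        (hint ((hfi i).fderiv_apply _) hψ) (hint (hfi i) (hψ.fderiv_apply _))
        (hint (hfi i) hψ) (fun x _ ↦ (hfi i).differentiable x) (fun x _ ↦ hψ.differentiable x)
    simp_rw [h3]
    rw [Finset.sum_neg_distrib, ← integral_finsetSum]
    · have h4 : ∀ x, ∑ i : Fin 2, fderiv ℝ (fun y ↦ f y i) x (EuclideanSpace.single i 1) * ψ x
          = 0 := by
        intro x
        rw [← Finset.sum_mul]
        simp_rw [hfd]
        have := hdiv x
        rw [divergence] at this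
        rw [this, zero_mul]
      simp_rw [h4]; simp
    · exact fun i _ ↦ hint ((hfi i).fderiv_apply _) hψ
  · exact fun i _ ↦ hint (hfi i) (hψ.fderiv_apply _)

end DivergenceFree

/-! ### Totality of gradients and divergence-free test fields. -/

section Density

/-- The rotated gradient `(∂₂χ, -∂₁χ)`. -/
def perpGrad (χ : Plane → ℝ) (x : Plane) : Plane :=
  fderiv ℝ χ x (EuclideanSpace.single 1 1) • EuclideanSpace.single 0 (1 : ℝ)
    - fderiv ℝ χ x (EuclideanSpace.single 0 1) • EuclideanSpace.single 1 (1 : ℝ)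

theorem IsTest.smul_const {F : Type*} [NormedAddCommGroup F] [NormedSpace ℝ F] {χ : Plane → ℝ}
    (hχ : IsTest χ) (a : F) : IsTest fun x ↦ χ x • a := by
  simpa using hχ.clm_comp (ContinuousLinearMap.toSpanSingleton ℝ a)

theorem IsTest.sub {F : Type*} [NormedAddCommGroup F] [NormedSpace ℝ F] {f g : Plane → F}
    (hf : IsTest f) (hg : IsTest g) : IsTest fun x ↦ f x - g x := by
  refine ⟨hf.1.sub hg.1, ?_⟩
  have := hf.2.add (hg.2.comp_left (g := fun a : F ↦ -a) neg_zero)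
  simpa only [sub_eq_add_neg] using! this

theorem IsTest.toPerpGrad {χ : Plane → ℝ} (hχ : IsTest χ) : IsTest (perpGrad χ) :=
  ((hχ.fderiv_apply _).smul_const _).sub ((hχ.fderiv_apply _).smul_const _)

theorem perpGrad_apply_zero (χ : Plane → ℝ) (x : Plane) :
    perpGrad χ x 0 = fderiv ℝ χ x (EuclideanSpace.single 1 1) := by
  simp [perpGrad]

theorem perpGrad_apply_one (χ : Plane → ℝ) (x : Plane) :
    perpGrad χ x 1 = -fderiv ℝ χ x (EuclideanSpace.single 0 1) := by
  simp [perpGrad]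

theorem fderiv_component {f : Plane → Plane} (hf : IsTest f) (i : Fin 2) (x e : Plane) :
    fderiv ℝ (fun y ↦ f y i) x e = (fderiv ℝ f x e) i := by
  have := ((EuclideanSpace.proj i : Plane →L[ℝ] ℝ).hasFDerivAt.comp x
    (hf.differentiable x).hasFDerivAt).fderiv
  change fderiv ℝ ((EuclideanSpace.proj i : Plane →L[ℝ] ℝ) ∘ f) x _ = _
  rw [this]; rfl

theorem divergence_perpGrad {χ : Plane → ℝ} (hχ : IsTest χ) (x : Plane) :
    divergence (perpGrad χ) x = 0 := by
  have hsymm : ∀ a b : Plane, fderiv ℝ (fun y ↦ fderiv ℝ χ y a) x b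
      = fderiv ℝ (fun y ↦ fderiv ℝ χ y b) x a := by
    intro a b
    have h1 : ∀ a b : Plane, fderiv ℝ (fun y ↦ fderiv ℝ χ y a) x b
        = fderiv ℝ (fderiv ℝ χ) x b a := by
      intro a b
      have := ((hχ.toFDeriv.differentiable x).hasFDerivAt.clm_apply
        (hasFDerivAt_const a x)).fderiv
      rw [this]; simp
    rw [h1, h1]
    have hs := (hχ.1.contDiffAt (x := x)).isSymmSndFDerivAt (by
      simp only [minSmoothness_of_isRCLikeNormedField]
      exact WithTop.coe_le_coe.2 (le_top : (2 : ℕ∞) ≤ ⊤))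
    exact hs b a
  rw [divergence, Fin.sum_univ_two, ← fderiv_component hχ.toPerpGrad,
    ← fderiv_component hχ.toPerpGrad]
  simp_rw [perpGrad_apply_zero, perpGrad_apply_one]
  rw [fderiv_fun_neg, neg_apply, hsymm, add_neg_cancel]

theorem IsTest.comp_sub_left {F : Type*} [NormedAddCommGroup F] [NormedSpace ℝ F]
    {σ : Plane → F} (hσ : IsTest σ) (x : Plane) : IsTest fun t ↦ σ (x - t) :=
  ⟨hσ.1.comp (contDiff_const.sub contDiff_id), hσ.2.comp_homeomorph (Homeomorph.subLeft x)⟩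

theorem fderiv_comp_sub_left {σ : Plane → ℝ} (hσ : IsTest σ) (x t e : Plane) :
    fderiv ℝ (fun t ↦ σ (x - t)) t e = -fderiv ℝ σ (x - t) e := by
  have h : HasFDerivAt (fun t ↦ σ (x - t))
      ((fderiv ℝ σ (x - t)).comp (-ContinuousLinearMap.id ℝ Plane)) t :=
    (hσ.differentiable (x - t)).hasFDerivAt.comp t ((hasFDerivAt_id t).const_sub x)
  rw [h.fderiv]
  simp

theorem inner_l2_smul_single (u : L2Vector) {χ : Plane → ℝ} (hχ : IsTest χ) (j : Fin 2) :
    inner ℝ u (l2 fun x ↦ χ x • (EuclideanSpace.single j (1 : ℝ) : Plane))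
      = ∫ x, u x j * χ x := by
  rw [inner_l2 u ((hχ.smul_const _).memLp 2)]
  refine integral_congr_ae (ae_of_all _ fun x ↦ ?_)
  simp only [inner_smul_right, EuclideanSpace.inner_single_right]
  simp [mul_comm]

theorem integrable_component_mul (u : L2Vector) {χ : Plane → ℝ} (hχ : IsTest χ) (j : Fin 2) :
    Integrable fun x ↦ u x j * χ x := by
  refine (integrable_inner_l2 u ((hχ.smul_const
    (EuclideanSpace.single j (1 : ℝ) : Plane)).memLp 2)).congr (ae_of_all _ fun x ↦ ?_)
  simp only [inner_smul_right, EuclideanSpace.inner_single_right]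
  simp [mul_comm]

theorem locallyIntegrable_component (u : L2Vector) (j : Fin 2) :
    LocallyIntegrable (fun x ↦ u x j) (volume : Measure Plane) := by
  have : MemLp (fun x ↦ u x j) 2 (volume : Measure Plane) :=
    (EuclideanSpace.proj j : Plane →L[ℝ] ℝ).comp_memLp u
  exact this.locallyIntegrable (by norm_num)

/-- The mollification of a component of a square integrable field. -/
def mollify (σ : Plane → ℝ) (u : L2Vector) (j : Fin 2) (x : Plane) : ℝ := ∫ t, u t j * σ (x - t)

theorem hasFDerivAt_mollify {σ : Plane → ℝ} (hσ : IsTest σ) (u : L2Vector) (j : Fin 2)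
    (x : Plane) : ∃ L : Plane →L[ℝ] ℝ, HasFDerivAt (mollify σ u j) L x ∧
      ∀ e, L e = ∫ t, u t j * fderiv ℝ σ (x - t) e := by
  have h := HasCompactSupport.hasFDerivAt_convolution_right (μ := volume)
    (ContinuousLinearMap.mul ℝ ℝ) hσ.2 (locallyIntegrable_component u j)
    (hσ.1.of_le (by exact_mod_cast le_top)) x
  refine ⟨_, h, fun e ↦ ?_⟩
  rw [convolution_precompR_apply _ (locallyIntegrable_component u j) hσ.toFDeriv.2
    hσ.toFDeriv.continuous]
  simp [convolution]

theorem norm_l2_comp_sub_left {σ : Plane → ℝ} (hσ : IsTest σ) (j : Fin 2) (x : Plane) :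
    ‖l2 fun t ↦ σ (x - t) • (EuclideanSpace.single j (1 : ℝ) : Plane)‖
      = ‖l2 fun t ↦ σ t • (EuclideanSpace.single j (1 : ℝ) : Plane)‖ := by
  rw [← toReal_enorm, ← toReal_enorm, enorm_l2 ((hσ.smul_const _).memLp 2),
    enorm_l2 (((hσ.comp_sub_left x).smul_const _).memLp 2)]
  congr 1
  exact eLpNorm_comp_measurePreserving (f := fun t ↦ x - t) (p := 2)
    (g := fun t ↦ σ t • (EuclideanSpace.single j (1 : ℝ) : Plane)) ((hσ.smul_const _).continuous.aestronglyMeasurable) (Measure.measurePreserving_sub_left volume x)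

theorem mollify_eq_inner {σ : Plane → ℝ} (hσ : IsTest σ) (u : L2Vector) (j : Fin 2) (x : Plane) :
    mollify σ u j x
      = inner ℝ u (l2 fun t ↦ σ (x - t) • (EuclideanSpace.single j (1 : ℝ) : Plane)) := by
  rw [inner_l2_smul_single u (hσ.comp_sub_left x) j, mollify]

/-- Mollifications of square integrable fields take arbitrarily small values. -/
theorem exists_mollify_lt {σ : Plane → ℝ} (hσ : IsTest σ) (u : L2Vector) (j : Fin 2) {ε : ℝ}
    (hε : 0 < ε) : ∃ x, |mollify σ u j x| ≤ ε := by
  set N := ‖l2 fun t ↦ σ t • (EuclideanSpace.single j (1 : ℝ) : Plane)‖ with hN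
  have hpos : 0 < ε / (N + 1) := by positivity
  obtain ⟨g, hgc, hg, -, hgm⟩ := (Lp.memLp u).exists_hasCompactSupport_eLpNorm_sub_le
    (by norm_num) (ε := ENNReal.ofReal (ε / (N + 1))) (by simpa using hpos)
  have hdist : ‖u - l2 g‖ ≤ ε / (N + 1) := by
    rw [← toReal_enorm]
    refine ENNReal.toReal_le_of_le_ofReal hpos.le ?_
    rw [Lp.enorm_def]
    refine le_trans (le_of_eq (eLpNorm_congr_ae ?_)) hg
    filter_upwards [Lp.coeFn_sub u (l2 g), coeFn_l2 hgm] with x h1 h2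
    rw [h1, Pi.sub_apply, Pi.sub_apply, h2]
  obtain ⟨R₁, h1⟩ := hgc.isCompact.isBounded.exists_norm_le
  obtain ⟨R₂, h2⟩ := hσ.2.isCompact.isBounded.exists_norm_le
  -- At a point this far away, σ(x - ·) and the compactly supported approximation g of u have
  -- disjoint supports, and only ‖u - g‖ contributes.
  refine ⟨EuclideanSpace.single 0 (|R₁| + |R₂| + 1), ?_⟩
  set x : Plane := EuclideanSpace.single 0 (|R₁| + |R₂| + 1) with hx
  have hxn : ‖x‖ = |R₁| + |R₂| + 1 := by
    rw [hx, PiLp.norm_single, Real.norm_of_nonneg (by positivity)]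
  have hzero : inner ℝ (l2 g)
      (l2 fun t ↦ σ (x - t) • (EuclideanSpace.single j (1 : ℝ) : Plane)) = (0 : ℝ) := by
    rw [inner_l2_smul_single _ (hσ.comp_sub_left x) j]
    refine integral_eq_zero_of_ae ?_
    filter_upwards [coeFn_l2 hgm] with t ht
    rw [ht, Pi.zero_apply]
    by_cases hgt : g t = 0
    · simp [hgt]
    · have a1 := h1 t (subset_tsupport _ hgt)
      have : σ (x - t) = 0 := by
        by_contra h
        have a2 := h2 _ (subset_tsupport _ h)
        have a3 := norm_sub_norm_le x t
        linarith [le_abs_self R₁, le_abs_self R₂]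
      rw [this, mul_zero]
  rw [mollify_eq_inner hσ, ← sub_add_cancel u (l2 g), inner_add_left, hzero, add_zero]
  refine (abs_real_inner_le_norm _ _).trans ?_
  rw [norm_l2_comp_sub_left hσ, ← hN]
  calc ‖u - l2 g‖ * N ≤ ε / (N + 1) * (N + 1) := by gcongr; linarith
    _ = ε := div_mul_cancel₀ _ (by positivity)

/-- A square integrable field that is orthogonal to the gradients and to the rotated gradients
of all test functions vanishes: its mollifications are bounded entire functions. -/
theorem eq_zero_of_orthogonal {u : L2Vector}
    (hgrad : ∀ ψ : Plane → ℝ, IsTest ψ → inner ℝ u (l2 (grad ψ)) = 0)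
    (hperp : ∀ ψ : Plane → ℝ, IsTest ψ → inner ℝ u (l2 (perpGrad ψ)) = 0) : u = 0 := by
  have hmol : ∀ σ : Plane → ℝ, IsTest σ → ∀ j, mollify σ u j 0 = 0 := by
    intro σ hσ
    choose L hL hLe using fun j ↦ hasFDerivAt_mollify hσ u j
    -- Testing with the translates σ(x - ·) says that the mollified field is divergence-free; their
    -- rotated gradients say that it is curl-free.
    have hdiv : ∀ x, L 0 x (EuclideanSpace.single 0 1) + L 1 x (EuclideanSpace.single 1 1) = 0 := by
      intro x
      have h := hgrad _ (hσ.comp_sub_left x)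
      rw [inner_l2_grad u (hσ.comp_sub_left x)] at h
      have he : ∀ t, fderiv ℝ (fun t ↦ σ (x - t)) t (u t)
          = -(u t 0 * fderiv ℝ σ (x - t) (EuclideanSpace.single 0 1)
            + u t 1 * fderiv ℝ σ (x - t) (EuclideanSpace.single 1 1)) := by
        intro t
        rw [fderiv_eq_sum, Fin.sum_univ_two, fderiv_comp_sub_left hσ, fderiv_comp_sub_left hσ]
        ring
      simp_rw [he] at h
      rw [hLe, hLe, ← integral_add, ← neg_eq_zero, ← integral_neg, ← h]
      · exact integrable_component_mul u ((hσ.fderiv_apply _).comp_sub_left x) 0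
      · exact integrable_component_mul u ((hσ.fderiv_apply _).comp_sub_left x) 1
    have hcurl : ∀ x, L 0 x (EuclideanSpace.single 1 1) = L 1 x (EuclideanSpace.single 0 1) := by
      intro x
      have h := hperp _ (hσ.comp_sub_left x)
      rw [inner_l2 u ((hσ.comp_sub_left x).toPerpGrad.memLp 2)] at h
      rw [← sub_eq_zero, hLe, hLe, ← integral_sub, ← neg_eq_zero, ← integral_neg, ← h]
      · refine integral_congr_ae (ae_of_all _ fun t ↦ ?_)
        simp only [PiLp.inner_apply, Fin.sum_univ_two, perpGrad_apply_zero, perpGrad_apply_one,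
          fderiv_comp_sub_left hσ]
        simp
        ring
      · exact integrable_component_mul u ((hσ.fderiv_apply _).comp_sub_left x) 0
      · exact integrable_component_mul u ((hσ.fderiv_apply _).comp_sub_left x) 1
    let P : ℂ →L[ℝ] Plane :=
      Complex.reCLM.smulRight (EuclideanSpace.single 0 1)
        + Complex.imCLM.smulRight (EuclideanSpace.single 1 1)
    have hP1 : P 1 = EuclideanSpace.single 0 1 := by simp [P]
    have hPI : P Complex.I = EuclideanSpace.single 1 1 := by simp [P]
    -- For m₀ - i m₁ the Cauchy–Riemann equations are exactly the vanishing of the divergence and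
    -- the curl of (m₀, m₁).
    let f : ℂ → ℂ := fun z ↦ (mollify σ u 0 (P z) : ℂ) - Complex.I * (mollify σ u 1 (P z) : ℂ)
    have hf : ∀ z, HasFDerivAt f (Complex.ofRealCLM.comp ((L 0 (P z)).comp P)
        - Complex.I • Complex.ofRealCLM.comp ((L 1 (P z)).comp P)) z := by
      intro z
      have h : ∀ j, HasFDerivAt (fun z ↦ (mollify σ u j (P z) : ℂ))
          (Complex.ofRealCLM.comp ((L j (P z)).comp P)) z := fun j ↦
        Complex.ofRealCLM.hasFDerivAt.comp z ((hL j (P z)).comp z P.hasFDerivAt)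
      exact (h 0).sub ((h 1).const_mul Complex.I)
    have hd : Differentiable ℂ f := by
      intro z
      rw [differentiableAt_complex_iff_differentiableAt_real]
      refine ⟨(hf z).differentiableAt, ?_⟩
      rw [(hf z).fderiv]
      simp only [sub_apply, ContinuousLinearMap.comp_apply,
        smul_apply, hP1, hPI, Complex.ofRealCLM_apply, smul_eq_mul]
      rw [hcurl, eq_neg_of_add_eq_zero_left (hdiv (P z))]
      push_cast
      linear_combination (L 1 (P z) (EuclideanSpace.single 0 1) : ℂ) * Complex.I_mul_I
    have hb : ∀ j x, |mollify σ u j x|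
        ≤ ‖u‖ * ‖l2 fun t ↦ σ t • (EuclideanSpace.single j (1 : ℝ) : Plane)‖ := by
      intro j x
      rw [mollify_eq_inner hσ, ← norm_l2_comp_sub_left hσ j x]
      exact abs_real_inner_le_norm _ _
    have hbdd : Bornology.IsBounded (range f) := by
      rw [isBounded_iff_forall_norm_le]
      refine ⟨‖u‖ * ‖l2 fun t ↦ σ t • (EuclideanSpace.single 0 (1 : ℝ) : Plane)‖
        + ‖u‖ * ‖l2 fun t ↦ σ t • (EuclideanSpace.single 1 (1 : ℝ) : Plane)‖, ?_⟩
      rintro _ ⟨z, rfl⟩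
      refine (norm_sub_le _ _).trans (add_le_add ?_ ?_)
      · rw [Complex.norm_real]; exact hb 0 _
      · rw [norm_mul, Complex.norm_I, one_mul, Complex.norm_real]; exact hb 1 _
    have hconst := hd.apply_eq_apply_of_bounded hbdd
    have hPsurj : ∀ x : Plane, P ⟨x 0, x 1⟩ = x := by
      intro x
      rw [plane_eq_sum x, Fin.sum_univ_two]
      simp [P]
    have hre : ∀ z, (f z).re = mollify σ u 0 (P z) := fun z ↦ by simp [f]
    have him : ∀ z, (f z).im = -mollify σ u 1 (P z) := fun z ↦ by simp [f]
    intro j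
    -- By Liouville both mollified components are constant, and a nonzero constant contradicts
    -- `exists_mollify_lt`.
    by_contra hne
    obtain ⟨x, hx⟩ := exists_mollify_lt hσ u j (half_pos (abs_pos.2 hne))
    have heq : mollify σ u j x = mollify σ u j 0 := by
      have h1 := hconst ⟨x 0, x 1⟩ 0
      fin_cases j
      · have := congrArg Complex.re h1
        simpa [hre, hPsurj] using this
      · have := congrArg Complex.im h1
        simpa [him, hPsurj] using this
    rw [heq] at hx
    linarith [abs_pos.2 hne]
  have hcomp : ∀ j, ∀ᵐ x ∂(volume : Measure Plane), u x j = 0 := by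
    intro j
    refine ae_eq_zero_of_integral_contDiff_smul_eq_zero (locallyIntegrable_component u j)
      fun g hg hgc ↦ ?_
    have hgt : IsTest g := ⟨hg, hgc⟩
    have := hmol _ (hgt.comp_sub_left 0) j
    rw [mollify] at this
    simpa [mul_comm] using this
  rw [Lp.eq_zero_iff_ae_eq_zero]
  filter_upwards [hcomp 0, hcomp 1] with x h0 h1
  rw [plane_eq_sum (u x), Fin.sum_univ_two, h0, h1]
  simp

/-- The smooth fields that are used to test weak convergence: gradients of test functions, and
divergence-free test fields. -/
def testFields : Set L2Vector :=
  {g | ∃ ψ : Plane → ℝ, IsTest ψ ∧ g = l2 (grad ψ)} ∪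
    {g | ∃ φ : Plane → Plane, IsTest φ ∧ (∀ x, divergence φ x = 0) ∧ g = l2 φ}

/-- Rotated gradients of test functions are divergence-free test fields, so an orthogonal field
falls under `eq_zero_of_orthogonal`. -/
theorem span_testFields_dense : (Submodule.span ℝ testFields).topologicalClosure = ⊤ := by
  rw [Submodule.topologicalClosure_eq_top_iff, Submodule.eq_bot_iff]
  intro u hu
  rw [Submodule.mem_orthogonal'] at hu
  refine eq_zero_of_orthogonal (fun ψ hψ ↦ hu _ (Submodule.subset_span (Or.inl ⟨ψ, hψ, rfl⟩)))
    fun ψ hψ ↦ hu _ (Submodule.subset_span (Or.inr ⟨_, hψ.toPerpGrad,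
      divergence_perpGrad hψ, rfl⟩))

theorem span_scalar_tests_dense :
    (Submodule.span ℝ {g : L2Scalar | ∃ ψ : Plane → ℝ, IsTest ψ ∧ g = l2 ψ}).topologicalClosure
      = ⊤ := by
  rw [Submodule.topologicalClosure_eq_top_iff, Submodule.eq_bot_iff]
  intro u hu
  rw [Submodule.mem_orthogonal'] at hu
  rw [Lp.eq_zero_iff_ae_eq_zero]
  refine ae_eq_zero_of_integral_contDiff_smul_eq_zero
    ((Lp.memLp u).locallyIntegrable (by norm_num)) fun g hg hgc ↦ ?_
  have h := hu _ (Submodule.subset_span ⟨g, ⟨hg, hgc⟩, rfl⟩)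
  have hgt : IsTest g := ⟨hg, hgc⟩
  rw [inner_l2 u (hgt.memLp 2)] at h
  simpa using h

end Density

/-- Complex scalar fields in `L²(ℝ²)`. -/
abbrev L2Complex : Type := Lp ℂ 2 (volume : Measure Plane)

/-! ### Norm identities and almost everywhere convergent subsequences in L². -/

section General

theorem enorm_sq_eq_lintegral {E : Type*} [NormedAddCommGroup E]
    (f : Lp E 2 (volume : Measure Plane)) : ‖f‖ₑ ^ 2 = ∫⁻ x, ‖f x‖ₑ ^ 2 := by
  rw [Lp.enorm_def]
  have := eLpNorm_nnreal_pow_eq_lintegral (f := f) (μ := (volume : Measure Plane)) (p := 2)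
    (by norm_num)
  simpa only [NNReal.coe_ofNat, ENNReal.coe_ofNat, ENNReal.rpow_two] using this

theorem ofReal_norm_sq {E : Type*} [NormedAddCommGroup E] (f : E) :
    ENNReal.ofReal (‖f‖ ^ 2) = ‖f‖ₑ ^ 2 := by
  rw [ENNReal.ofReal_pow (norm_nonneg _), ofReal_norm]

theorem eLpNorm_two_sq {E : Type*} [NormedAddCommGroup E] (f : Plane → E) :
    eLpNorm f 2 volume ^ 2 = ∫⁻ x, ‖f x‖ₑ ^ 2 := by
  have := eLpNorm_nnreal_pow_eq_lintegral (f := f) (μ := (volume : Measure Plane)) (p := 2)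
    (by norm_num)
  simpa only [NNReal.coe_ofNat, ENNReal.coe_ofNat, ENNReal.rpow_two] using this

/-- Two convergent sequences in `L²` converge almost everywhere along a common subsequence. -/
theorem exists_subseq_ae_tendsto {E : Type*} [NormedAddCommGroup E]
    {f g : ℕ → Lp E 2 (volume : Measure Plane)} {a b : Lp E 2 (volume : Measure Plane)}
    (hf : Tendsto f atTop (𝓝 a)) (hg : Tendsto g atTop (𝓝 b)) :
    ∃ ns : ℕ → ℕ, StrictMono ns ∧ ∀ᵐ x, Tendsto (fun k ↦ f (ns k) x) atTop (𝓝 (a x)) ∧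
      Tendsto (fun k ↦ g (ns k) x) atTop (𝓝 (b x)) := by
  obtain ⟨n₁, h₁, hn₁⟩ := (tendstoInMeasure_of_tendsto_Lp hf).exists_seq_tendsto_ae
  obtain ⟨n₂, h₂, hn₂⟩ := (tendstoInMeasure_of_tendsto_Lp
    (hg.comp h₁.tendsto_atTop)).exists_seq_tendsto_ae
  refine ⟨n₁ ∘ n₂, h₁.comp h₂, ?_⟩
  filter_upwards [hn₁, hn₂] with x h3 h4
  exact ⟨h3.comp h₂.tendsto_atTop, h4⟩

/-- Polarization. It transfers Plancherel's theorem to the real inner product of complex-valued L².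
-/
theorem inner_eq_of_norm_preserving {H : Type*} [NormedAddCommGroup H] [InnerProductSpace ℝ H]
    {T : H → H} (hsub : ∀ a b, T (a - b) = T a - T b)
    (hT : ∀ a, ‖T a‖ = ‖a‖) (a b : H) : (inner ℝ (T a) (T b) : ℝ) = inner ℝ a b := by
  rw [real_inner_eq_norm_mul_self_add_norm_mul_self_sub_norm_sub_mul_self_div_two,
    real_inner_eq_norm_mul_self_add_norm_mul_self_sub_norm_sub_mul_self_div_two, ← hsub, hT, hT,
    hT]

end General

/-! ### The Plancherel transform, translations and half a derivative. -/

section FourierOnL2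

theorem real_inner_fourier (f g : L2Complex) : (inner ℝ (𝓕 f) (𝓕 g) : ℝ) = inner ℝ f g :=
  inner_eq_of_norm_preserving (T := fun f : L2Complex ↦ 𝓕 f)
    (fun a b ↦ (Lp.fourierTransformₗᵢ Plane ℂ).map_sub a b)
    (fun a ↦ Lp.norm_fourier_eq a) f g

/-- On integrable square integrable functions the Plancherel transform is given by the Fourier
integral. -/
theorem fourierInv_l2 {G : Plane → ℂ} (h1 : Integrable G) (h2 : MemLp G 2 volume) :
    (𝓕⁻ (l2 G : L2Complex) : L2Complex) =ᵐ[volume] 𝓕⁻ G := by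
  have hcont : Continuous (𝓕⁻ G) := by
    have : 𝓕⁻ G = fun x ↦ 𝓕 G (-x) := funext fun x ↦ Real.fourierInv_eq_fourier_neg G x
    rw [this]
    exact (VectorFourier.fourierIntegral_continuous Real.continuous_fourierChar
      (L := innerₗ Plane) (by simp only [innerₗ_apply_apply]; fun_prop) h1).comp continuous_neg
  refine ae_eq_of_integral_contDiff_smul_eq
    ((Lp.memLp (𝓕⁻ (l2 G : L2Complex))).locallyIntegrable (by norm_num))
    hcont.locallyIntegrable fun g hg hgc ↦ ?_
  have hg₁ : HasCompactSupport (Complex.ofRealCLM ∘ g) := hgc.comp_left rfl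
  have hg₂ : ContDiff ℝ ((⊤ : ℕ∞) : WithTop ℕ∞) (Complex.ofRealCLM ∘ g) := by fun_prop
  let s := hg₁.toSchwartzMap hg₂
  have e1 : ∫ x, g x • (𝓕⁻ (l2 G : L2Complex) : L2Complex) x
      = (((𝓕⁻ (l2 G : L2Complex) : L2Complex) : TemperedDistribution Plane ℂ)) s := by
    rw [Lp.toTemperedDistribution_apply]
    simp [s]
  have e2 : ∫ x, g x • 𝓕⁻ G x = ∫ x, s x • 𝓕⁻ G x := by simp [s]
  rw [e1, e2, ← Lp.fourierInv_toTemperedDistribution_eq,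
    TemperedDistribution.fourierInv_apply, Lp.toTemperedDistribution_apply]
  have e3 : ∫ x, (𝓕⁻ s) x • (l2 G : L2Complex) x = ∫ x, (𝓕⁻ s) x • G x := by
    refine integral_congr_ae ?_
    filter_upwards [coeFn_l2 h2] with x hx
    rw [hx]
  rw [e3]
  -- With the pairing `-innerₗ` the Fourier integral is the inverse one; its symmetry under the
  -- integral moves it from the test function to G.
  have e4 := VectorFourier.integral_fourierIntegral_smul_eq_flip (e := Real.fourierChar)
    (L := -innerₗ Plane) (μ := volume) (ν := volume) (f := s) (g := G)
    Real.continuous_fourierChar (by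
      simp only [LinearMap.neg_apply, innerₗ_apply_apply]
      fun_prop) s.integrable h1
  refine Eq.trans ?_ (e4.trans ?_)
  · refine integral_congr_ae (ae_of_all _ fun x ↦ ?_)
    simp only [SchwartzMap.fourierInv_coe, Real.fourierInv_eq, VectorFourier.fourierIntegral]
    simp
  · refine integral_congr_ae (ae_of_all _ fun x ↦ ?_)
    simp only [Real.fourierInv_eq, VectorFourier.fourierIntegral]
    simp [real_inner_comm]

/-- Translation of a square integrable function. -/
def translate {E : Type*} [NormedAddCommGroup E] (z : Plane)
    (f : Lp E 2 (volume : Measure Plane)) : Lp E 2 (volume : Measure Plane) :=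
  Lp.compMeasurePreserving (· + z) (measurePreserving_add_right volume z) f

theorem coeFn_translate {E : Type*} [NormedAddCommGroup E] (z : Plane)
    (f : Lp E 2 (volume : Measure Plane)) : translate z f =ᵐ[volume] fun x ↦ f (x + z) :=
  Lp.coeFn_compMeasurePreserving f (measurePreserving_add_right volume z)

theorem fourier_translate_schwartz (z : Plane) (f : SchwartzMap Plane ℂ) (ξ : Plane) :
    𝓕 (fun x ↦ f (x + z)) ξ = ((Real.fourierChar (inner ℝ z ξ) : Circle) : ℂ) * 𝓕 f ξ := by
  have := congrFun (VectorFourier.fourierIntegral_comp_add_right Real.fourierChar volume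
    (innerₗ Plane) f z) ξ
  exact this

theorem continuous_translate (z : Plane) : Continuous (translate z : L2Complex → L2Complex) :=
  (Lp.isometry_compMeasurePreserving (measurePreserving_add_right volume z)).continuous

theorem memLp_char (z : Plane) :
    MemLp (fun ξ : Plane ↦ ((Real.fourierChar (inner ℝ z ξ) : Circle) : ℂ)) ⊤ volume := by
  refine memLp_top_of_bound (C := 1) ?_ (ae_of_all _ fun ξ ↦ (Circle.norm_coe _).le)
  exact Continuous.aestronglyMeasurable (by fun_prop)

/-- The Plancherel transform of a translate. -/
theorem fourier_translate (z : Plane) (f : L2Complex) :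
    (𝓕 (translate z f) : L2Complex) =ᵐ[volume]
      fun ξ ↦ ((Real.fourierChar (inner ℝ z ξ) : Circle) : ℂ) * (𝓕 f : L2Complex) ξ := by
  -- Multiplication by the character is bounded on L², so both sides depend continuously on f and
  -- Schwartz functions suffice.
  let M : L2Complex →L[ℂ] L2Complex :=
    (ContinuousLinearMap.mul ℂ ℂ).holderL volume ⊤ 2 2 ((memLp_char z).toLp _)
  have hM : ∀ g : L2Complex, M g =ᵐ[volume]
      fun ξ ↦ ((Real.fourierChar (inner ℝ z ξ) : Circle) : ℂ) * g ξ := by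
    intro g
    have h1 := (ContinuousLinearMap.mul ℂ ℂ).coeFn_holder (r := 2) ((memLp_char z).toLp _) g
    filter_upwards [h1, (memLp_char z).coeFn_toLp] with ξ h2 h3
    change ((ContinuousLinearMap.mul ℂ ℂ).holder 2 ((memLp_char z).toLp _) g) ξ = _
    rw [h2, h3]; rfl
  suffices h : (𝓕 (translate z f) : L2Complex) = M (𝓕 f) by rw [h]; exact hM _
  refine DenseRange.induction_on (p := fun f : L2Complex ↦ 𝓕 (translate z f) = M (𝓕 f))
    (SchwartzMap.denseRange_toLpCLM (p := 2) (μ := (volume : Measure Plane))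
      ENNReal.ofNat_ne_top) f ?_ ?_
  · exact isClosed_eq ((Lp.fourierTransformₗᵢ Plane ℂ).continuous.comp (continuous_translate z))
      (M.continuous.comp (Lp.fourierTransformₗᵢ Plane ℂ).continuous)
  · intro s
    let s' := s.compSubConstCLM ℂ (-z)
    have h1 : translate z (s.toLp 2) = s'.toLp 2 := by
      refine Lp.ext ?_
      have h2 := (measurePreserving_add_right volume z).quasiMeasurePreserving.ae
        (s.coeFn_toLp 2 volume)
      filter_upwards [coeFn_translate z (s.toLp 2), h2, s'.coeFn_toLp 2 volume] with x h3 h4 h5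
      rw [h3, h4, h5]
      simp [s']
    change 𝓕 (translate z (s.toLp 2)) = M (𝓕 (s.toLp 2))
    rw [h1, SchwartzMap.toLp_fourier_eq, SchwartzMap.toLp_fourier_eq]
    refine Lp.ext ?_
    filter_upwards [hM ((𝓕 s).toLp 2), (𝓕 s).coeFn_toLp 2 volume,
      (𝓕 s').coeFn_toLp 2 volume] with ξ h3 h4 h5
    rw [h3, h4, h5, ← fourier_translate_schwartz]
    have : (s' : Plane → ℂ) = fun x ↦ s (x + z) := by ext x; simp [s']
    rw [SchwartzMap.fourier_coe, this]

/-- The product of the trivial bound 2 and the Lipschitz bound 2π|θ|. Being linear in |θ|, it costs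
only half a derivative after taking square roots. -/
theorem normSq_char_sub_one_le (θ : ℝ) :
    ‖((Real.fourierChar θ : Circle) : ℂ) - 1‖ ^ 2 ≤ 2 * (2 * Real.pi * |θ|) := by
  have h1 : ‖((Real.fourierChar θ : Circle) : ℂ) - 1‖ ≤ 2 := by
    refine (norm_sub_le _ _).trans ?_
    rw [Circle.norm_coe, norm_one]; norm_num
  have h2 : ‖((Real.fourierChar θ : Circle) : ℂ) - 1‖ ≤ 2 * Real.pi * |θ| := by
    rw [Real.fourierChar_apply, mul_comm (_ : ℂ) Complex.I]
    refine (Real.norm_exp_I_mul_ofReal_sub_one_le (x := 2 * Real.pi * θ)).trans ?_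
    rw [Real.norm_eq_abs, abs_mul, abs_of_pos (by positivity)]
  nlinarith [norm_nonneg (((Real.fourierChar θ : Circle) : ℂ) - 1)]

/-- Translations are Hölder continuous of order `1/2` in `L²` on `Ḣ^{1/2}`. -/
theorem lintegral_translate_sub_le (z : Plane) (f : L2Complex) :
    ∫⁻ x, ‖f (x + z) - f x‖ₑ ^ 2 ≤ ENNReal.ofReal (2 * ‖z‖)
      * ∫⁻ ξ, ENNReal.ofReal (2 * Real.pi * ‖ξ‖) * ‖(𝓕 f : L2Complex) ξ‖ₑ ^ 2 := by
  have e1 : ∫⁻ x, ‖f (x + z) - f x‖ₑ ^ 2 = ‖translate z f - f‖ₑ ^ 2 := by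
    rw [enorm_sq_eq_lintegral]
    refine lintegral_congr_ae ?_
    filter_upwards [Lp.coeFn_sub (translate z f) f, coeFn_translate z f] with x h1 h2
    rw [h1, Pi.sub_apply, h2]
  have e2 : ‖translate z f - f‖ₑ = ‖(𝓕 (translate z f) : L2Complex) - 𝓕 f‖ₑ := by
    have h : ‖translate z f - f‖ = ‖(𝓕 (translate z f) : L2Complex) - 𝓕 f‖ := by
      rw [← Lp.norm_fourier_eq (translate z f - f)]
      congr 1
      exact (Lp.fourierTransformₗᵢ Plane ℂ).map_sub _ _
    rw [← ofReal_norm, h, ofReal_norm]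
  rw [e1, e2, enorm_sq_eq_lintegral, ← lintegral_const_mul' _ _ ENNReal.ofReal_ne_top]
  refine lintegral_mono_ae ?_
  filter_upwards [Lp.coeFn_sub (𝓕 (translate z f) : L2Complex) (𝓕 f), fourier_translate z f]
    with ξ h1 h2
  rw [h1, Pi.sub_apply, h2, ← sub_one_mul, enorm_mul, mul_pow, ← mul_assoc]
  gcongr
  rw [← ofReal_norm_sq, ← ENNReal.ofReal_mul (by positivity)]
  refine ENNReal.ofReal_le_ofReal ((normSq_char_sub_one_le _).trans ?_)
  have := abs_real_inner_le_norm z ξ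
  have hpi := Real.pi_pos
  nlinarith [mul_le_mul_of_nonneg_left this hpi.le]

end FourierOnL2

/-! ### Convexity and lower semicontinuity of the homogeneous Sobolev norm. -/

section Components

/-- The components of a field, as a continuous linear map. -/
def componentL (i : Fin 2) : L2Vector →L[ℝ] L2Complex :=
  (Complex.ofRealCLM.comp (EuclideanSpace.proj i : Plane →L[ℝ] ℝ)).compLpL 2 volume

theorem coeFn_component (u : L2Vector) (i : Fin 2) :
    component u i =ᵐ[volume] fun x ↦ ((u x i : ℝ) : ℂ) :=
  (Complex.ofRealCLM.comp (EuclideanSpace.proj i : Plane →L[ℝ] ℝ)).coeFn_compLp u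

theorem component_eq (u : L2Vector) (i : Fin 2) : component u i = componentL i u := rfl

/-- The component of the Plancherel transform of a field. -/
def fourierComp (i : Fin 2) (u : L2Vector) : L2Complex := 𝓕 (component u i)

theorem fourierComp_add (i : Fin 2) (u v : L2Vector) :
    fourierComp i (u + v) = fourierComp i u + fourierComp i v := by
  simp only [fourierComp, component_eq, map_add]
  exact (Lp.fourierTransformₗᵢ Plane ℂ).map_add _ _

theorem fourierComp_smul (i : Fin 2) (c : ℝ) (u : L2Vector) :
    fourierComp i (c • u) = c • fourierComp i u := by
  simp only [fourierComp, component_eq, map_smul]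
  exact ((Lp.fourierTransformₗᵢ Plane ℂ).toLinearEquiv.toLinearMap.restrictScalars ℝ).map_smul c _

theorem continuous_fourierComp (i : Fin 2) : Continuous (fourierComp i) :=
  (Lp.fourierTransformₗᵢ Plane ℂ).continuous.comp (componentL i).continuous

/-- The contribution of a component to the homogeneous Sobolev norm. -/
def hdotComp (i : Fin 2) (u : L2Vector) : ℝ≥0∞ :=
  ∫⁻ ξ : Plane, ENNReal.ofReal (2 * Real.pi * ‖ξ‖) * ‖fourierComp i u ξ‖ₑ ^ 2

theorem hdotHalfSq_eq (u : L2Vector) : hdotHalfSq u = ∑ i : Fin 2, hdotComp i u := rfl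

theorem hdotComp_le (i : Fin 2) (u : L2Vector) : hdotComp i u ≤ hdotHalfSq u :=
  Finset.single_le_sum (f := fun i ↦ hdotComp i u) (fun _ _ ↦ zero_le) (Finset.mem_univ i)

theorem lintegral_component_translate_sub_le (z : Plane) (u : L2Vector) (i : Fin 2) :
    ∫⁻ x, ‖u (x + z) i - u x i‖ₑ ^ 2 ≤ ENNReal.ofReal (2 * ‖z‖) * hdotHalfSq u := by
  have h := lintegral_translate_sub_le z (component u i)
  refine le_trans (le_of_eq ?_) (h.trans (mul_le_mul_right (hdotComp_le i u) _))
  refine lintegral_congr_ae ?_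
  filter_upwards [coeFn_component u i,
    (measurePreserving_add_right volume z).quasiMeasurePreserving.ae (coeFn_component u i)]
    with x h1 h2
  rw [h1, h2, ← Complex.ofReal_sub]
  congr 1
  rw [← ofReal_norm, ← ofReal_norm, Complex.norm_real]

theorem enorm_add_sq_le (a b : ℂ) {s t : ℝ} (hs : 0 ≤ s) (ht : 0 ≤ t) (hst : s + t = 1) :
    ‖s • a + t • b‖ₑ ^ 2 ≤ ENNReal.ofReal s * ‖a‖ₑ ^ 2 + ENNReal.ofReal t * ‖b‖ₑ ^ 2 := by
  rw [← ofReal_norm_sq, ← ofReal_norm_sq, ← ofReal_norm_sq, ← ENNReal.ofReal_mul hs,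
    ← ENNReal.ofReal_mul ht, ← ENNReal.ofReal_add (by positivity) (by positivity)]
  refine ENNReal.ofReal_le_ofReal ?_
  have h1 : ‖s • a + t • b‖ ≤ s * ‖a‖ + t * ‖b‖ := by
    refine (norm_add_le _ _).trans (le_of_eq ?_)
    rw [norm_smul, norm_smul, Real.norm_of_nonneg hs, Real.norm_of_nonneg ht]
  have h2 : ‖s • a + t • b‖ ^ 2 ≤ (s * ‖a‖ + t * ‖b‖) ^ 2 :=
    pow_le_pow_left₀ (norm_nonneg _) h1 2
  have h3 : s * ‖a‖ ^ 2 + t * ‖b‖ ^ 2 - (s * ‖a‖ + t * ‖b‖) ^ 2 = s * t * (‖a‖ - ‖b‖) ^ 2 := by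
    obtain rfl : t = 1 - s := by linarith
    ring
  have h4 : 0 ≤ s * t * (‖a‖ - ‖b‖) ^ 2 := by positivity
  linarith

/-- Convexity makes the sublevel sets weakly closed once they are strongly closed. -/
theorem hdotComp_convex (i : Fin 2) (u v : L2Vector) {s t : ℝ} (hs : 0 ≤ s) (ht : 0 ≤ t)
    (hst : s + t = 1) : hdotComp i (s • u + t • v)
      ≤ ENNReal.ofReal s * hdotComp i u + ENNReal.ofReal t * hdotComp i v := by
  rw [hdotComp, hdotComp, hdotComp, ← lintegral_const_mul' _ _ ENNReal.ofReal_ne_top,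
    ← lintegral_const_mul' _ _ ENNReal.ofReal_ne_top, ← lintegral_add_left']
  · refine lintegral_mono_ae ?_
    rw [fourierComp_add, fourierComp_smul, fourierComp_smul]
    filter_upwards [Lp.coeFn_add (s • fourierComp i u) (t • fourierComp i v),
      Lp.coeFn_smul s (fourierComp i u), Lp.coeFn_smul t (fourierComp i v)] with ξ h1 h2 h3
    rw [h1, Pi.add_apply, h2, h3, Pi.smul_apply, Pi.smul_apply]
    refine (mul_le_mul_right (enorm_add_sq_le _ _ hs ht hst) _).trans (le_of_eq ?_)
    ring
  · exact AEMeasurable.const_mul (AEMeasurable.mul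
      (Measurable.ennreal_ofReal (f := fun ξ : Plane ↦ 2 * Real.pi * ‖ξ‖) (by fun_prop)).aemeasurable
      ((Lp.aestronglyMeasurable (fourierComp i u)).enorm.pow_const 2)) _

/-- Fatou's lemma along a subsequence on which the transforms of both components converge almost
everywhere. -/
theorem hdotHalfSq_le_of_tendsto {u : ℕ → L2Vector} {a : L2Vector} {M : ℝ≥0∞}
    (hu : Tendsto u atTop (𝓝 a)) (hM : ∀ n, hdotHalfSq (u n) ≤ M) : hdotHalfSq a ≤ M := by
  obtain ⟨ns, hns, hae⟩ := exists_subseq_ae_tendsto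
    (((continuous_fourierComp 0).tendsto a).comp hu)
    (((continuous_fourierComp 1).tendsto a).comp hu)
  have hmeas : ∀ i (v : L2Vector), AEMeasurable
      (fun ξ ↦ ENNReal.ofReal (2 * Real.pi * ‖ξ‖) * ‖fourierComp i v ξ‖ₑ ^ 2)
      (volume : Measure Plane) := fun i v ↦
    AEMeasurable.mul (Measurable.ennreal_ofReal (by fun_prop)).aemeasurable
      ((Lp.aestronglyMeasurable _).enorm.pow_const 2)
  have hsum : ∀ v : L2Vector, hdotHalfSq v
      = ∫⁻ ξ, ∑ i : Fin 2, ENNReal.ofReal (2 * Real.pi * ‖ξ‖) * ‖fourierComp i v ξ‖ₑ ^ 2 := by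
    intro v
    rw [hdotHalfSq_eq, lintegral_finsetSum' _ fun i _ ↦ hmeas i v]
    rfl
  have hlim : hdotHalfSq a ≤ liminf (fun k ↦ hdotHalfSq (u (ns k))) atTop := by
    simp_rw [hsum]
    refine le_trans (lintegral_mono_ae ?_) (lintegral_liminf_le' fun k ↦
      Finset.aemeasurable_fun_sum _ fun i _ ↦ hmeas i _)
    filter_upwards [hae] with ξ hξ
    refine le_of_eq (Tendsto.liminf_eq ?_).symm
    refine tendsto_finsetSum _ fun i _ ↦ ?_
    refine ENNReal.Tendsto.const_mul ?_ (Or.inr ENNReal.ofReal_ne_top)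
    refine ENNReal.Tendsto.pow ?_
    fin_cases i
    · exact hξ.1.enorm
    · exact hξ.2.enorm
  exact hlim.trans (liminf_le_of_le (by isBoundedDefault) fun b hb ↦ by
    obtain ⟨k, hk⟩ := hb.exists
    exact hk.trans (hM _))

/-- The homogeneous Sobolev norm is lower semicontinuous for weak convergence. -/
theorem hdotHalfSq_le_of_weak_limit {ι : Type*} {l : Filter ι} {u : ι → L2Vector} {a : L2Vector}
    {M : ℝ≥0∞} (hM : ∃ᶠ n in l, hdotHalfSq (u n) ≤ M)
    (hw : ∀ φ : L2Vector, Tendsto (fun n ↦ inner ℝ (u n) φ) l (𝓝 (inner ℝ a φ))) :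
    hdotHalfSq a ≤ M := by
  refine mem_of_weak_limit (S := {u | hdotHalfSq u ≤ M}) ?_ ?_ hM hw
  · exact IsSeqClosed.isClosed fun u a hu ha ↦ hdotHalfSq_le_of_tendsto ha hu
  · intro u hu v hv s t hs ht hst
    have : hdotHalfSq (s • u + t • v)
        ≤ ENNReal.ofReal s * hdotHalfSq u + ENNReal.ofReal t * hdotHalfSq v := by
      simp only [hdotHalfSq_eq, Finset.mul_sum, ← Finset.sum_add_distrib]
      exact Finset.sum_le_sum fun i _ ↦ hdotComp_convex i u v hs ht hst
    refine this.trans ?_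
    calc _ ≤ ENNReal.ofReal s * M + ENNReal.ofReal t * M :=
          add_le_add (mul_le_mul_right hu _) (mul_le_mul_right hv _)
      _ = M := by rw [← add_mul, ← ENNReal.ofReal_add hs ht, hst]; simp

end Components

/-! ### The operator |D| on test functions and fields. -/

section AbsD

/-- A real test function as a complex Schwartz function. -/
def IsTest.toSchwartz {f : Plane → ℝ} (hf : IsTest f) : SchwartzMap Plane ℂ :=
  HasCompactSupport.toSchwartzMap (f := fun x ↦ (f x : ℂ))
    (hf.clm_comp Complex.ofRealCLM).2 (hf.clm_comp Complex.ofRealCLM).1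

theorem IsTest.coe_toSchwartz {f : Plane → ℝ} (hf : IsTest f) :
    (hf.toSchwartz : Plane → ℂ) = fun x ↦ (f x : ℂ) := rfl

/-- The Fourier transform of `|D| f`. -/
def absDSymbol (f : Plane → ℝ) (ξ : Plane) : ℂ :=
  ((2 * Real.pi * ‖ξ‖ : ℝ) : ℂ) * 𝓕 (fun y : Plane ↦ (f y : ℂ)) ξ

theorem absD_eq (f : Plane → ℝ) (x : Plane) : absD f x = (𝓕⁻ (absDSymbol f) x).re := rfl

theorem IsTest.fourier_eq {f : Plane → ℝ} (hf : IsTest f) :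
    𝓕 (fun y : Plane ↦ (f y : ℂ)) = 𝓕 hf.toSchwartz := by
  rw [SchwartzMap.fourier_coe, hf.coe_toSchwartz]

theorem continuous_absDSymbol {f : Plane → ℝ} (hf : IsTest f) : Continuous (absDSymbol f) := by
  unfold absDSymbol
  rw [hf.fourier_eq]
  exact (Complex.continuous_ofReal.comp (by fun_prop)).mul (𝓕 hf.toSchwartz).continuous

theorem integrable_absDSymbol {f : Plane → ℝ} (hf : IsTest f) : Integrable (absDSymbol f) := by
  have h := ((𝓕 hf.toSchwartz).integrable_pow_mul volume 1).const_mul (2 * Real.pi)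
  refine h.mono' (continuous_absDSymbol hf).aestronglyMeasurable (ae_of_all _ fun ξ ↦ ?_)
  rw [absDSymbol, hf.fourier_eq, norm_mul, Complex.norm_real, pow_one,
    Real.norm_of_nonneg (by positivity), mul_assoc]

theorem norm_le_sum_abs (ξ : Plane) : ‖ξ‖ ≤ ∑ i : Fin 2, |ξ i| := by
  conv_lhs => rw [plane_eq_sum ξ]
  refine (norm_sum_le _ _).trans (le_of_eq (Finset.sum_congr rfl fun i _ ↦ ?_))
  rw [norm_smul, PiLp.norm_single]
  simp

/-- Since |ξ| ≤ |ξ₁| + |ξ₂|, the transforms of the partial derivatives dominate that of |D|f;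
Plancherel then controls |D|f in L² by the gradient of f. -/
theorem norm_absDSymbol_le {f : Plane → ℝ} (hf : IsTest f) (ξ : Plane) :
    ‖absDSymbol f ξ‖ ≤ ∑ i : Fin 2,
      ‖𝓕 (LineDeriv.lineDerivOp (EuclideanSpace.single i (1 : ℝ) : Plane) hf.toSchwartz) ξ‖ := by
  have h : ∀ i : Fin 2,
      ‖𝓕 (LineDeriv.lineDerivOp (EuclideanSpace.single i (1 : ℝ) : Plane) hf.toSchwartz) ξ‖
        = 2 * Real.pi * (|ξ i| * ‖𝓕 hf.toSchwartz ξ‖) := by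
    intro i
    have hg : (fun x : Plane ↦ (inner ℝ x (EuclideanSpace.single i (1 : ℝ) : Plane) : ℝ)
        ).HasTemperateGrowth := ((innerSL ℝ).flip _).hasTemperateGrowth
    rw [SchwartzMap.fourier_lineDerivOp_eq]
    rw [smul_apply, norm_smul, SchwartzMap.smulLeftCLM_apply_apply hg, norm_smul,
      EuclideanSpace.inner_single_right]
    simp [abs_of_pos Real.pi_pos]
  simp_rw [h]
  rw [absDSymbol, hf.fourier_eq, norm_mul, Complex.norm_real, Real.norm_of_nonneg (by positivity),
    ← Finset.mul_sum, ← Finset.sum_mul, mul_assoc]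
  gcongr
  exact norm_le_sum_abs ξ

theorem lineDeriv_toSchwartz {f : Plane → ℝ} (hf : IsTest f) (e x : Plane) :
    LineDeriv.lineDerivOp e hf.toSchwartz x = ((fderiv ℝ f x e : ℝ) : ℂ) := by
  rw [SchwartzMap.lineDerivOp_apply_eq_fderiv, hf.coe_toSchwartz]
  have : HasFDerivAt (fun x ↦ (f x : ℂ)) (Complex.ofRealCLM.comp (fderiv ℝ f x)) x :=
    Complex.ofRealCLM.hasFDerivAt.comp x (hf.differentiable x).hasFDerivAt
  rw [this.fderiv]; rfl

theorem eLpNorm_absDSymbol_le {f : Plane → ℝ} {C R : ℝ} (hf : ControlledTest f C R) :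
    eLpNorm (absDSymbol f) 2 volume ≤ ENNReal.ofReal (2 * (C * ballConst R)) := by
  have hft := hf.isTest
  let g : Fin 2 → SchwartzMap Plane ℂ := fun i ↦
    LineDeriv.lineDerivOp (EuclideanSpace.single i (1 : ℝ) : Plane) hft.toSchwartz
  have h1 : eLpNorm (absDSymbol f) 2 volume
      ≤ ∑ i : Fin 2, eLpNorm (fun ξ ↦ ‖𝓕 (g i) ξ‖) 2 volume := by
    refine (eLpNorm_mono_real (g := ∑ i : Fin 2, fun ξ ↦ ‖𝓕 (g i) ξ‖) fun ξ ↦ ?_).trans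
      (eLpNorm_sum_le (fun i _ ↦ ?_) (by norm_num))
    · simpa using norm_absDSymbol_le hft ξ
    · exact (𝓕 (g i)).continuous.norm.aestronglyMeasurable
  have h2 : ∀ i, eLpNorm (fun ξ ↦ ‖𝓕 (g i) ξ‖) 2 volume ≤ ENNReal.ofReal (C * ballConst R) := by
    intro i
    rw [eLpNorm_norm]
    have e1 : eLpNorm (𝓕 (g i) : SchwartzMap Plane ℂ) 2 volume = eLpNorm (g i) 2 volume := by
      have := SchwartzMap.norm_fourier_toL2_eq (g i)
      have e : ‖(𝓕 (g i)).toLp 2 volume‖ₑ = ‖(g i).toLp 2 volume‖ₑ := by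
        rw [← ofReal_norm, this, ofReal_norm]
      rwa [Lp.enorm_def, Lp.enorm_def, eLpNorm_congr_ae ((𝓕 (g i)).coeFn_toLp 2 volume),
        eLpNorm_congr_ae ((g i).coeFn_toLp 2 volume)] at e
    rw [e1]
    refine eLpNorm_le_of_support (fun x hx ↦ ?_) fun x ↦ ?_
    · rw [lineDeriv_toSchwartz hft]
      have : fderiv ℝ f x = 0 := by
        have hz : f =ᶠ[𝓝 x] fun _ ↦ 0 := by
          filter_upwards [(continuous_norm.continuousAt (x := x)).eventually (lt_mem_nhds hx)]
            with y hy using hf.support y hy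
        rw [hz.fderiv_eq]; simp
      rw [this]; simp
    · rw [lineDeriv_toSchwartz hft, Complex.norm_real]
      refine ((fderiv ℝ f x).le_opNorm _).trans ?_
      rw [PiLp.norm_single]
      simpa using hf.bound_fderiv x
  refine h1.trans ((Finset.sum_le_sum fun i _ ↦ h2 i).trans (le_of_eq ?_))
  rw [Fin.sum_univ_two, ← two_mul, ENNReal.ofReal_mul zero_le_two]
  simp

theorem memLp_absDSymbol {f : Plane → ℝ} (hf : IsTest f) : MemLp (absDSymbol f) 2 volume := by
  obtain ⟨C, R, -, h⟩ := hf.exists_controlled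
  exact ⟨(continuous_absDSymbol hf).aestronglyMeasurable,
    (eLpNorm_absDSymbol_le h).trans_lt ENNReal.ofReal_lt_top⟩

/-- The symbol is integrable and square integrable, so its inverse Fourier integral agrees with the
inverse Plancherel transform. -/
theorem absD_ae_eq {f : Plane → ℝ} (hf : IsTest f) :
    absD f =ᵐ[volume] fun x ↦ ((𝓕⁻ (l2 (absDSymbol f)) : L2Complex) x).re := by
  filter_upwards [fourierInv_l2 (integrable_absDSymbol hf) (memLp_absDSymbol hf)] with x hx
  rw [hx, absD_eq]

theorem memLp_absD {f : Plane → ℝ} (hf : IsTest f) : MemLp (absD f) 2 volume :=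
  (memLp_congr_ae (absD_ae_eq hf)).2
    ((Lp.memLp (𝓕⁻ (l2 (absDSymbol f)) : L2Complex)).re)

theorem eLpNorm_absD_le {f : Plane → ℝ} {C R : ℝ} (hf : ControlledTest f C R) :
    eLpNorm (absD f) 2 volume ≤ ENNReal.ofReal (2 * (C * ballConst R)) := by
  rw [eLpNorm_congr_ae (absD_ae_eq hf.isTest)]
  refine le_trans (eLpNorm_mono (g := (𝓕⁻ (l2 (absDSymbol f)) : L2Complex)) fun x ↦ ?_)
    ((le_of_eq ?_).trans (eLpNorm_absDSymbol_le hf))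
  · rw [Real.norm_eq_abs]; exact Complex.abs_re_le_norm _
  · rw [← Lp.enorm_def, ← enorm_l2 (memLp_absDSymbol hf.isTest), ← ofReal_norm, ← ofReal_norm]
    congr 1
    exact (Lp.fourierTransformₗᵢ Plane ℂ).symm.norm_map _

/-- Parseval's formula for `|D|`. -/
theorem integral_mul_absD (u : L2Vector) (i : Fin 2) {f : Plane → ℝ} (hf : IsTest f) :
    ∫ x, u x i * absD f x = inner ℝ (fourierComp i u) (l2 (absDSymbol f)) := by
  have h : (l2 (absDSymbol f) : L2Complex) = 𝓕 (𝓕⁻ (l2 (absDSymbol f)) : L2Complex) :=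
    (FourierInvPair.fourier_fourierInv_eq _).symm
  rw [h, fourierComp, real_inner_fourier, L2.inner_def]
  refine integral_congr_ae ?_
  filter_upwards [coeFn_component u i, absD_ae_eq hf] with x h1 h2
  rw [h1, h2]
  simp [Complex.inner, mul_comm]

end AbsD

section AbsDVec

theorem IsTest.component {f : Plane → Plane} (hf : IsTest f) (i : Fin 2) :
    IsTest fun x ↦ f x i := hf.clm_comp (EuclideanSpace.proj i : Plane →L[ℝ] ℝ)

theorem norm_apply_le (x : Plane) (i : Fin 2) : ‖x i‖ ≤ ‖x‖ := PiLp.norm_apply_le x i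

theorem ControlledTest.component {f : Plane → Plane} {C R : ℝ} (hf : ControlledTest f C R)
    (i : Fin 2) : ControlledTest (fun x ↦ f x i) C R := by
  have hd : ∀ x e, fderiv ℝ (fun y ↦ f y i) x e = (fderiv ℝ f x e) i := fun x e ↦
    fderiv_component hf.isTest i x e
  refine ⟨hf.isTest.component i, fun x ↦ (norm_apply_le _ i).trans (hf.bound x), fun x ↦ ?_,
    fun x y ↦ ?_, fun x hx ↦ by simp [hf.support x hx]⟩
  · refine ContinuousLinearMap.opNorm_le_bound _ hf.nonneg fun e ↦ ?_
    rw [hd]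
    refine (norm_apply_le _ i).trans (((fderiv ℝ f x).le_opNorm e).trans ?_)
    gcongr
    exact hf.bound_fderiv x
  · refine ContinuousLinearMap.opNorm_le_bound _ (mul_nonneg hf.nonneg (norm_nonneg _))
      fun e ↦ ?_
    rw [sub_apply, hd, hd, ← PiLp.sub_apply, ← sub_apply]
    refine (norm_apply_le _ i).trans (((fderiv ℝ f x - fderiv ℝ f y).le_opNorm e).trans ?_)
    gcongr
    exact hf.lipschitz_fderiv x y

theorem absDVec_eq (f : Plane → Plane) : absDVec f
    = fun x ↦ ∑ i : Fin 2, absD (fun y ↦ f y i) x • (EuclideanSpace.single i (1 : ℝ) : Plane) := by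
  ext1 x
  rw [plane_eq_sum (absDVec f x)]
  rfl

theorem memLp_absDVec_term {f : Plane → Plane} (hf : IsTest f) (i : Fin 2) :
    MemLp (fun x ↦ absD (fun y ↦ f y i) x • (EuclideanSpace.single i (1 : ℝ) : Plane)) 2
      volume := by
  exact (ContinuousLinearMap.toSpanSingleton ℝ
    (EuclideanSpace.single i (1 : ℝ) : Plane)).comp_memLp' (memLp_absD (hf.component i))

theorem memLp_absDVec {f : Plane → Plane} (hf : IsTest f) : MemLp (absDVec f) 2 volume := by
  rw [absDVec_eq]
  exact memLp_finsetSum _ fun i _ ↦ memLp_absDVec_term hf i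

theorem norm_l2_absDVec_le {f : Plane → Plane} {C R : ℝ} (hf : ControlledTest f C R) :
    ‖l2 (absDVec f)‖ ≤ 4 * (C * ballConst R) := by
  have h0 : 0 ≤ C * ballConst R := mul_nonneg hf.nonneg (ballConst_nonneg R)
  rw [← toReal_enorm, enorm_l2 (memLp_absDVec hf.isTest)]
  refine ENNReal.toReal_le_of_le_ofReal (by positivity) ?_
  have h1 : eLpNorm (absDVec f) 2 volume ≤ ∑ i : Fin 2, eLpNorm (fun x ↦
      absD (fun y ↦ f y i) x • (EuclideanSpace.single i (1 : ℝ) : Plane)) 2 volume := by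
    have e : absDVec f = ∑ i : Fin 2, fun x ↦
        absD (fun y ↦ f y i) x • (EuclideanSpace.single i (1 : ℝ) : Plane) := by
      rw [absDVec_eq]; ext1 x; simp
    rw [e]
    exact eLpNorm_sum_le (fun i _ ↦ (memLp_absDVec_term hf.isTest i).1) (by norm_num)
  have h2 : ∀ i : Fin 2, eLpNorm (fun x ↦
      absD (fun y ↦ f y i) x • (EuclideanSpace.single i (1 : ℝ) : Plane)) 2 volume
      ≤ ENNReal.ofReal (2 * (C * ballConst R)) := by
    intro i
    refine le_trans (eLpNorm_mono fun x ↦ ?_) (eLpNorm_absD_le (hf.component i))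
    rw [norm_smul, PiLp.norm_single]; simp
  refine h1.trans ((Finset.sum_le_sum fun i _ ↦ h2 i).trans (le_of_eq ?_))
  rw [Fin.sum_univ_two, ← ENNReal.ofReal_add (by positivity) (by positivity)]
  congr 1; ring

/-- Parseval's formula for `|D|` on fields. -/
theorem inner_absDVec (u : L2Vector) {f : Plane → Plane} (hf : IsTest f) :
    inner ℝ u (l2 (absDVec f))
      = ∑ i : Fin 2, inner ℝ (fourierComp i u) (l2 (absDSymbol fun y ↦ f y i)) := by
  rw [inner_l2 u (memLp_absDVec hf)]
  have h : ∀ x, (inner ℝ (u x) (absDVec f x) : ℝ)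
      = ∑ i : Fin 2, u x i * absD (fun y ↦ f y i) x := by
    intro x
    rw [PiLp.inner_apply]
    refine Finset.sum_congr rfl fun i _ ↦ ?_
    simp [absDVec, mul_comm]
  simp_rw [h]
  rw [integral_finsetSum]
  · exact Finset.sum_congr rfl fun i _ ↦ integral_mul_absD u i (hf.component i)
  · intro i _
    have := (integrable_inner_l2 u (memLp_absDVec_term hf i))
    refine this.congr (ae_of_all _ fun x ↦ ?_)
    simp only [inner_smul_right, EuclideanSpace.inner_single_right]
    simp [mul_comm]

end AbsDVec

/-! ### The implicit dissipation step as an orthogonal projection. -/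

section Resolvent

/-- The Hilbert space that contains the graph of the square root of `h|D|`. -/
abbrev GraphSpace : Type := WithLp 2 (L2Vector × PiLp 2 fun _ : Fin 2 ↦ L2Complex)

/-- The symbol of the square root of `h|D|`. -/
def sqrtSymbol (h : ℝ) (ξ : Plane) : ℝ := √(h * (2 * Real.pi * ‖ξ‖))

/-- The graph of the square root of `h|D|` on divergence-free fields, in Fourier variables. -/
def sqrtGraph (h : ℝ) : Submodule ℝ GraphSpace where
  carrier := {x | x.fst ∈ divFree ∧
    ∀ i, x.snd i =ᵐ[volume] fun ξ ↦ sqrtSymbol h ξ • fourierComp i x.fst ξ}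
  add_mem' := by
    rintro x y ⟨hx, hx'⟩ ⟨hy, hy'⟩
    refine ⟨divFree.add_mem hx hy, fun i ↦ ?_⟩
    change ((x.snd i + y.snd i : L2Complex) : Plane → ℂ) =ᵐ[volume]
      fun ξ ↦ sqrtSymbol h ξ • fourierComp i (x.fst + y.fst) ξ
    rw [fourierComp_add]
    filter_upwards [hx' i, hy' i, Lp.coeFn_add (x.snd i) (y.snd i),
      Lp.coeFn_add (fourierComp i x.fst) (fourierComp i y.fst)] with ξ h1 h2 h3 h4
    rw [h3, h4, Pi.add_apply, Pi.add_apply, h1, h2, smul_add]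
  zero_mem' := by
    refine ⟨divFree.zero_mem, fun i ↦ ?_⟩
    change ((0 : L2Complex) : Plane → ℂ) =ᵐ[volume]
      fun ξ ↦ sqrtSymbol h ξ • fourierComp i 0 ξ
    have h0 : fourierComp i 0 = 0 := by
      have := fourierComp_smul i 0 0
      simpa using this
    rw [h0]
    filter_upwards [Lp.coeFn_zero ℂ 2 (volume : Measure Plane)] with ξ h1
    rw [h1]; simp
  smul_mem' := by
    rintro c x ⟨hx, hx'⟩
    refine ⟨divFree.smul_mem c hx, fun i ↦ ?_⟩
    change ((c • x.snd i : L2Complex) : Plane → ℂ) =ᵐ[volume]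
      fun ξ ↦ sqrtSymbol h ξ • fourierComp i (c • x.fst) ξ
    rw [fourierComp_smul]
    filter_upwards [hx' i, Lp.coeFn_smul c (x.snd i),
      Lp.coeFn_smul c (fourierComp i x.fst)] with ξ h1 h2 h3
    rw [h2, h3, Pi.smul_apply, Pi.smul_apply, h1, smul_comm]

theorem mem_sqrtGraph {h : ℝ} {x : GraphSpace} : x ∈ sqrtGraph h ↔ x.fst ∈ divFree ∧
    ∀ i, x.snd i =ᵐ[volume] fun ξ ↦ sqrtSymbol h ξ • fourierComp i x.fst ξ := Iff.rfl

theorem isClosed_divFree : IsClosed (divFree : Set L2Vector) := Submodule.isClosed_orthogonal _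

/-- Multiplication by the unbounded symbol is a pointwise relation, hence survives almost everywhere
convergence along a subsequence. -/
theorem isClosed_sqrtGraph (h : ℝ) : IsClosed (sqrtGraph h : Set GraphSpace) := by
  refine IsSeqClosed.isClosed fun x a hx ha ↦ ?_
  have hfst : Tendsto (fun n ↦ (x n).fst) atTop (𝓝 a.fst) :=
    ((WithLp.prod_continuous_ofLp 2 _ _).fst.tendsto a).comp ha
  have hsnd : ∀ i, Tendsto (fun n ↦ (x n).snd i) atTop (𝓝 (a.snd i)) := fun i ↦
    (((PiLp.continuous_apply 2 _ i).comp
      (WithLp.prod_continuous_ofLp 2 _ _).snd).tendsto a).comp ha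
  refine ⟨isClosed_divFree.mem_of_tendsto hfst (Eventually.of_forall fun n ↦ (hx n).1),
    fun i ↦ ?_⟩
  obtain ⟨ns, hns, hae⟩ := exists_subseq_ae_tendsto (hsnd i)
    (((continuous_fourierComp i).tendsto a.fst).comp hfst)
  have hall : ∀ᵐ ξ ∂(volume : Measure Plane), ∀ k, (x (ns k)).snd i ξ
      = sqrtSymbol h ξ • fourierComp i (x (ns k)).fst ξ :=
    ae_all_iff.2 fun k ↦ (hx (ns k)).2 i
  filter_upwards [hae, hall] with ξ h1 h2
  refine tendsto_nhds_unique h1.1 ?_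
  simp_rw [h2]
  exact h1.2.const_smul _

theorem fourierComp_l2 {f : Plane → Plane} (hf : IsTest f) (i : Fin 2) :
    fourierComp i (l2 f) =ᵐ[volume] 𝓕 (fun y : Plane ↦ ((f y i : ℝ) : ℂ)) := by
  have h1 : component (l2 f) i = (hf.component i).toSchwartz.toLp 2 volume := by
    refine Lp.ext ?_
    filter_upwards [coeFn_component (l2 f) i, coeFn_l2 (hf.memLp 2),
      (hf.component i).toSchwartz.coeFn_toLp 2 volume] with x h1 h2 h3
    rw [h1, h2, h3]; rfl
  rw [fourierComp, h1, SchwartzMap.toLp_fourier_eq, (hf.component i).fourier_eq]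
  exact SchwartzMap.coeFn_toLp _ 2 volume

theorem memLp_sqrtSymbol_smul {h : ℝ} (hh : 0 ≤ h) {f : Plane → ℝ} (hf : IsTest f) :
    MemLp (fun ξ ↦ sqrtSymbol h ξ • 𝓕 (fun y : Plane ↦ (f y : ℂ)) ξ) 2 volume := by
  have h1 : MemLp (𝓕 (fun y : Plane ↦ (f y : ℂ))) 2 volume := by
    rw [hf.fourier_eq]; exact SchwartzMap.memLp _ 2 volume
  have h2 : MemLp (fun ξ ↦ ‖𝓕 (fun y : Plane ↦ (f y : ℂ)) ξ‖ + h * ‖absDSymbol f ξ‖) 2 volume :=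
    h1.norm.add ((memLp_absDSymbol hf).norm.const_mul h)
  have hc : Continuous fun ξ ↦ sqrtSymbol h ξ • 𝓕 (fun y : Plane ↦ (f y : ℂ)) ξ := by
    rw [hf.fourier_eq]
    have h3 : Continuous (sqrtSymbol h) := by unfold sqrtSymbol; fun_prop
    have h4 : Continuous fun ξ ↦ (𝓕 hf.toSchwartz : SchwartzMap Plane ℂ) ξ :=
      (𝓕 hf.toSchwartz).continuous
    exact h3.smul h4
  refine h2.mono' hc.aestronglyMeasurable (ae_of_all _ fun ξ ↦ ?_)
  -- From √s ≤ 1 + s: the square root is dominated by the identity plus h|D|, both square integrable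
  -- on test functions.
  · have h3 : sqrtSymbol h ξ ≤ 1 + h * (2 * Real.pi * ‖ξ‖) := by
      have h0 : 0 ≤ h * (2 * Real.pi * ‖ξ‖) := by positivity
      rw [sqrtSymbol, Real.sqrt_le_left (by positivity)]
      nlinarith
    have h4 : 0 ≤ sqrtSymbol h ξ := Real.sqrt_nonneg _
    rw [norm_smul, absDSymbol, norm_mul, Complex.norm_real, Real.norm_of_nonneg h4,
      Real.norm_of_nonneg (by positivity)]
    nlinarith [mul_le_mul_of_nonneg_right h3 (norm_nonneg (𝓕 (fun y : Plane ↦ (f y : ℂ)) ξ))]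

/-- The two square roots multiply to the symbol of h|D|, which is then carried by the test function
alone. -/
theorem inner_sqrtSymbol {h : ℝ} (hh : 0 ≤ h) (u : L2Vector) (i : Fin 2) {W : L2Complex}
    (hW : W =ᵐ[volume] fun ξ ↦ sqrtSymbol h ξ • fourierComp i u ξ) {f : Plane → ℝ}
    (hf : IsTest f) :
    inner ℝ W (l2 fun ξ ↦ sqrtSymbol h ξ • 𝓕 (fun y : Plane ↦ (f y : ℂ)) ξ)
      = h * inner ℝ (fourierComp i u) (l2 (absDSymbol f)) := by
  rw [inner_l2 _ (memLp_sqrtSymbol_smul hh hf), inner_l2 _ (memLp_absDSymbol hf),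
    ← integral_const_mul]
  refine integral_congr_ae ?_
  filter_upwards [hW] with ξ h1
  rw [h1, real_inner_smul_left, real_inner_smul_right, ← mul_assoc, sqrtSymbol,
    Real.mul_self_sqrt (by positivity), absDSymbol, ← Complex.real_smul, real_inner_smul_right]
  ring

theorem exists_projection {H : Type*} [NormedAddCommGroup H] [InnerProductSpace ℝ H]
    [CompleteSpace H] {K : Submodule ℝ H} (hK : IsClosed (K : Set H)) (x : H) :
    ∃ p ∈ K, ‖p‖ ^ 2 ≤ ‖x‖ ^ 2 ∧ ∀ q ∈ K, (inner ℝ x q : ℝ) = inner ℝ p q := by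
  have : CompleteSpace K := hK.completeSpace_coe
  have horth : ∀ q ∈ K, (inner ℝ x q : ℝ) = inner ℝ (K.starProjection x) q := by
    intro q hq
    have := Submodule.inner_left_of_mem_orthogonal hq
      (Submodule.sub_starProjection_mem_orthogonal (K := K) x)
    rwa [inner_sub_left, sub_eq_zero] at this
  refine ⟨K.starProjection x, Submodule.starProjection_apply_mem _ x, ?_, horth⟩
  have h1 := horth _ (Submodule.starProjection_apply_mem _ x)
  rw [real_inner_self_eq_norm_sq] at h1
  have h2 := real_inner_le_norm x (K.starProjection x)
  rw [h1] at h2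
  nlinarith [sq_nonneg (‖K.starProjection x‖ - ‖x‖)]

/-- The pair (w, W) is the projection of (g, 0) onto the graph. Orthogonality of the residual is the
weak resolvent equation, with the pressure absorbed by the divergence-free constraint, and
contractivity of the projection is the energy estimate. -/
theorem exists_graph_projection (h : ℝ) (g : L2Vector) :
    ∃ w ∈ divFree, ∃ W : Fin 2 → L2Complex,
      (∀ i, W i =ᵐ[volume] fun ξ ↦ sqrtSymbol h ξ • fourierComp i w ξ) ∧
      ‖w‖ ^ 2 + ∑ i, ‖W i‖ ^ 2 ≤ ‖g‖ ^ 2 ∧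
      ∀ u ∈ divFree, ∀ U : Fin 2 → L2Complex,
        (∀ i, U i =ᵐ[volume] fun ξ ↦ sqrtSymbol h ξ • fourierComp i u ξ) →
        (inner ℝ g u : ℝ) = inner ℝ w u + ∑ i, inner ℝ (W i) (U i) := by
  obtain ⟨p, hp, hnorm, horth⟩ := exists_projection (isClosed_sqrtGraph h)
    (WithLp.toLp 2 (g, 0) : GraphSpace)
  obtain ⟨hp1, hp2⟩ := mem_sqrtGraph.1 hp
  refine ⟨p.fst, hp1, fun i ↦ p.snd i, hp2, ?_, fun u hu U hU ↦ ?_⟩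
  · rw [WithLp.prod_norm_sq_eq_of_L2, WithLp.prod_norm_sq_eq_of_L2, PiLp.norm_sq_eq_of_L2] at hnorm
    refine hnorm.trans (le_of_eq ?_)
    change ‖g‖ ^ 2 + ‖(0 : PiLp 2 fun _ : Fin 2 ↦ L2Complex)‖ ^ 2 = _
    rw [norm_zero]; ring
  · have h1 := horth (WithLp.toLp 2 (u, WithLp.toLp 2 U)) ⟨hu, hU⟩
    rw [WithLp.prod_inner_apply, WithLp.prod_inner_apply] at h1
    have h2 : (inner ℝ g u : ℝ) + inner ℝ (0 : PiLp 2 fun _ : Fin 2 ↦ L2Complex)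
        (WithLp.toLp 2 U) = inner ℝ p.fst u + inner ℝ p.snd (WithLp.toLp 2 U) := h1
    rwa [inner_zero_left, add_zero, PiLp.inner_apply] at h2

theorem ofReal_norm_sq_sqrtSymbol {h : ℝ} (hh : 0 ≤ h) (u : L2Vector) (i : Fin 2) {W : L2Complex}
    (hW : W =ᵐ[volume] fun ξ ↦ sqrtSymbol h ξ • fourierComp i u ξ) :
    ENNReal.ofReal h * hdotComp i u = ENNReal.ofReal (‖W‖ ^ 2) := by
  rw [ofReal_norm_sq, enorm_sq_eq_lintegral, hdotComp,
    ← lintegral_const_mul' _ _ ENNReal.ofReal_ne_top]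
  refine lintegral_congr_ae ?_
  filter_upwards [hW] with ξ h1
  have h2 : ‖sqrtSymbol h ξ‖ₑ ^ 2 = ENNReal.ofReal h * ENNReal.ofReal (2 * Real.pi * ‖ξ‖) := by
    rw [← ofReal_norm_sq, Real.norm_eq_abs, sq_abs, sqrtSymbol,
      Real.sq_sqrt (by positivity), ENNReal.ofReal_mul hh]
  rw [h1, enorm_smul, mul_pow, h2]
  exact (mul_assoc _ _ _).symm

/-- Existence and estimates for the Stokes type resolvent equation `w + h|D|w + ∇p = g`. -/
theorem exists_resolvent {h : ℝ} (hh : 0 ≤ h) (g : L2Vector) :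
    ∃ w ∈ divFree, ENNReal.ofReal (‖w‖ ^ 2) + ENNReal.ofReal h * hdotHalfSq w
        ≤ ENNReal.ofReal (‖g‖ ^ 2) ∧
      ∀ φ : Plane → Plane, IsTest φ → (∀ x, divergence φ x = 0) →
        inner ℝ g (l2 φ) = inner ℝ w (l2 φ) + h * inner ℝ w (l2 (absDVec φ)) := by
  obtain ⟨w, hw, W, hW, hnorm, horth⟩ := exists_graph_projection h g
  refine ⟨w, hw, ?_, fun φ hφ hdiv ↦ ?_⟩
  · refine le_trans (le_of_eq (Eq.symm ?_)) (ENNReal.ofReal_le_ofReal hnorm)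
    rw [ENNReal.ofReal_add (sq_nonneg _) (Finset.sum_nonneg fun i _ ↦ sq_nonneg _),
      ENNReal.ofReal_sum_of_nonneg fun i _ ↦ sq_nonneg _, hdotHalfSq_eq, Finset.mul_sum]
    congr 1
    exact Finset.sum_congr rfl fun i _ ↦ (ofReal_norm_sq_sqrtSymbol hh w i (hW i)).symm
  · have h1 := horth (l2 φ) (l2_mem_divFree hφ hdiv) (fun i ↦
      l2 fun ξ ↦ sqrtSymbol h ξ • 𝓕 (fun y : Plane ↦ ((φ y i : ℝ) : ℂ)) ξ) fun i ↦ by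
        filter_upwards [coeFn_l2 (memLp_sqrtSymbol_smul hh (hφ.component i)),
          fourierComp_l2 hφ i] with ξ h1 h2
        rw [h1, h2]
    rw [h1, inner_absDVec _ hφ, Finset.mul_sum]
    congr 1
    exact Finset.sum_congr rfl fun i _ ↦ inner_sqrtSymbol hh w i (hW i) (hφ.component i)

/-- The solution operator of the resolvent equation `w + h|D|w + ∇p = g`, `div w = 0`. -/
def resolvent (h : ℝ) (g : L2Vector) : L2Vector :=
  open Classical in if hh : 0 ≤ h then (exists_resolvent hh g).choose else 0

theorem resolvent_mem {h : ℝ} (hh : 0 ≤ h) (g : L2Vector) : resolvent h g ∈ divFree := by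
  rw [resolvent, dif_pos hh]; exact (exists_resolvent hh g).choose_spec.1

theorem resolvent_energy {h : ℝ} (hh : 0 ≤ h) (g : L2Vector) :
    ENNReal.ofReal (‖resolvent h g‖ ^ 2) + ENNReal.ofReal h * hdotHalfSq (resolvent h g)
      ≤ ENNReal.ofReal (‖g‖ ^ 2) := by
  rw [resolvent, dif_pos hh]; exact (exists_resolvent hh g).choose_spec.2.1

theorem inner_resolvent {h : ℝ} (hh : 0 ≤ h) (g : L2Vector) {φ : Plane → Plane} (hφ : IsTest φ)
    (hdiv : ∀ x, divergence φ x = 0) : inner ℝ g (l2 φ)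
      = inner ℝ (resolvent h g) (l2 φ) + h * inner ℝ (resolvent h g) (l2 (absDVec φ)) := by
  rw [resolvent, dif_pos hh]; exact (exists_resolvent hh g).choose_spec.2.2 φ hφ hdiv

end Resolvent

/-! ### Smooth bumps in one variable and their averages. -/

section Bumps

variable {δ ε : ℝ}

/-- A smooth transition from `0` to `1` on the interval `[0, δ]`. -/
def ramp (δ s : ℝ) : ℝ := Real.smoothTransition (s / δ)

/-- The derivative of `ramp`, a bump function of mass one on `[0, δ]`. -/
def bump (δ : ℝ) : ℝ → ℝ := deriv (ramp δ)

/-- The average of `bump δ` over intervals of length `ε`. -/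
def avgBump (δ ε s : ℝ) : ℝ := (ramp δ (s + ε) - ramp δ s) / ε

theorem contDiff_ramp (δ : ℝ) : ContDiff ℝ ((⊤ : ℕ∞) : WithTop ℕ∞) (ramp δ) :=
  Real.smoothTransition.contDiff.comp (contDiff_id.div_const δ)

theorem ramp_of_nonpos (hδ : 0 < δ) {s : ℝ} (hs : s ≤ 0) : ramp δ s = 0 :=
  Real.smoothTransition.zero_of_nonpos (div_nonpos_of_nonpos_of_nonneg hs hδ.le)

theorem ramp_of_le (hδ : 0 < δ) {s : ℝ} (hs : δ ≤ s) : ramp δ s = 1 :=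
  Real.smoothTransition.one_of_one_le ((one_le_div hδ).2 hs)

theorem monotone_ramp (hδ : 0 < δ) : Monotone (ramp δ) := fun _ _ h ↦
  Real.smoothTransition.monotone (div_le_div_of_nonneg_right h hδ.le)

theorem hasDerivAt_ramp (δ s : ℝ) : HasDerivAt (ramp δ) (bump δ s) s :=
  (((contDiff_ramp δ).differentiable (by simp)) s).hasDerivAt

theorem contDiff_bump (δ : ℝ) : ContDiff ℝ ((⊤ : ℕ∞) : WithTop ℕ∞) (bump δ) :=
  ((contDiff_infty_iff_deriv (𝕜 := ℝ)).1 (contDiff_ramp δ)).2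

theorem bump_nonneg (hδ : 0 < δ) (s : ℝ) : 0 ≤ bump δ s := (monotone_ramp hδ).deriv_nonneg

theorem bump_of_neg (hδ : 0 < δ) {s : ℝ} (hs : s < 0) : bump δ s = 0 := by
  have : ramp δ =ᶠ[𝓝 s] fun _ ↦ 0 := by
    filter_upwards [Iio_mem_nhds hs] with r hr using ramp_of_nonpos hδ (le_of_lt hr)
  rw [bump, this.deriv_eq, deriv_const]

theorem bump_of_lt (hδ : 0 < δ) {s : ℝ} (hs : δ < s) : bump δ s = 0 := by
  have : ramp δ =ᶠ[𝓝 s] fun _ ↦ 1 := by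
    filter_upwards [Ioi_mem_nhds hs] with r hr using ramp_of_le hδ (le_of_lt hr)
  rw [bump, this.deriv_eq, deriv_const]

theorem isTest_bump (hδ : 0 < δ) : IsTest (bump δ) := by
  refine ⟨contDiff_bump δ, HasCompactSupport.intro (isCompact_Icc (a := 0) (b := δ)) fun s hs ↦ ?_⟩
  rw [mem_Icc, not_and_or, not_le, not_le] at hs
  exact hs.elim (bump_of_neg hδ) (bump_of_lt hδ)

theorem integral_bump (hδ : 0 < δ) : ∫ s, bump δ s = 1 := by
  have h1 : Tendsto (ramp δ) atBot (𝓝 0) := tendsto_const_nhds.congr' (by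
    filter_upwards [eventually_le_atBot 0] with s hs using (ramp_of_nonpos hδ hs).symm)
  have h2 : Tendsto (ramp δ) atTop (𝓝 1) := tendsto_const_nhds.congr' (by
    filter_upwards [eventually_ge_atTop δ] with s hs using (ramp_of_le hδ hs).symm)
  have := integral_of_hasDerivAt_of_tendsto (hasDerivAt_ramp δ)
    ((isTest_bump hδ).continuous.integrable_of_hasCompactSupport (isTest_bump hδ).2) h1 h2
  rw [this, sub_zero]

theorem contDiff_avgBump (δ ε : ℝ) : ContDiff ℝ ((⊤ : ℕ∞) : WithTop ℕ∞) (avgBump δ ε) :=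
  (((contDiff_ramp δ).comp (contDiff_id.add contDiff_const)).sub (contDiff_ramp δ)).div_const ε

theorem avgBump_nonneg (hδ : 0 < δ) (hε : 0 < ε) (s : ℝ) : 0 ≤ avgBump δ ε s :=
  div_nonneg (sub_nonneg.2 (monotone_ramp hδ (by linarith))) hε.le

theorem avgBump_of_lt_neg (hδ : 0 < δ) (hε : 0 < ε) {s : ℝ} (hs : s < -ε) :
    avgBump δ ε s = 0 := by
  rw [avgBump, ramp_of_nonpos hδ (by linarith), ramp_of_nonpos hδ (by linarith)]; simp

theorem avgBump_of_lt (hδ : 0 < δ) (hε : 0 < ε) {s : ℝ} (hs : δ < s) : avgBump δ ε s = 0 := by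
  rw [avgBump, ramp_of_le hδ (by linarith), ramp_of_le hδ hs.le]; simp

theorem isTest_avgBump (hδ : 0 < δ) (hε : 0 < ε) : IsTest (avgBump δ ε) := by
  refine ⟨contDiff_avgBump δ ε,
    HasCompactSupport.intro (isCompact_Icc (a := -ε) (b := δ)) fun s hs ↦ ?_⟩
  rw [mem_Icc, not_and_or, not_le, not_le] at hs
  exact hs.elim (avgBump_of_lt_neg hδ hε) (avgBump_of_lt hδ hε)

/-- The derivative is an exact difference quotient of `bump`. This is why a gradient of products of
`avgBump` produces exact differences of fluxes. -/
theorem hasDerivAt_avgBump (δ ε s : ℝ) :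
    HasDerivAt (avgBump δ ε) ((bump δ (s + ε) - bump δ s) / ε) s :=
  (((hasDerivAt_ramp δ (s + ε)).comp_add_const s ε).sub (hasDerivAt_ramp δ s)).div_const ε

theorem integral_avgBump (hδ : 0 < δ) (hε : 0 < ε) : ∫ s, avgBump δ ε s = 1 := by
  -- The primitive of `avgBump` is the mean of `ramp` over [s, s + ε], which goes from 0 to 1.
  set Q : ℝ → ℝ := fun s ↦ ∫ r in (0 : ℝ)..s, ramp δ r with hQ
  have hc : Continuous (ramp δ) := (contDiff_ramp δ).continuous
  have hQd : ∀ s, HasDerivAt Q (ramp δ s) s := fun s ↦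
    intervalIntegral.integral_hasDerivAt_right (hc.intervalIntegrable _ _)
      hc.stronglyMeasurable.stronglyMeasurableAtFilter hc.continuousAt
  have hd : ∀ s, HasDerivAt (fun s ↦ (Q (s + ε) - Q s) / ε) (avgBump δ ε s) s := fun s ↦
    (((hQd (s + ε)).comp_add_const s ε).sub (hQd s)).div_const ε
  have hQ' : ∀ s, Q (s + ε) - Q s = ∫ r in s..s + ε, ramp δ r := fun s ↦
    intervalIntegral.integral_interval_sub_left (hc.intervalIntegrable _ _)
      (hc.intervalIntegrable _ _)
  have h1 : Tendsto (fun s ↦ (Q (s + ε) - Q s) / ε) atBot (𝓝 0) := tendsto_const_nhds.congr' (by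
    filter_upwards [eventually_le_atBot (-ε)] with s hs
    rw [hQ', intervalIntegral.integral_congr (g := fun _ ↦ 0) fun r hr ↦ ?_]
    · simp
    · rw [uIcc_of_le (by linarith)] at hr
      exact ramp_of_nonpos hδ (hr.2.trans (by linarith)))
  have h2 : Tendsto (fun s ↦ (Q (s + ε) - Q s) / ε) atTop (𝓝 1) := tendsto_const_nhds.congr' (by
    filter_upwards [eventually_ge_atTop δ] with s hs
    rw [hQ', intervalIntegral.integral_congr (g := fun _ ↦ 1) fun r hr ↦ ?_]
    · simp [hε.ne']
    · rw [uIcc_of_le (by linarith)] at hr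
      exact ramp_of_le hδ (hs.trans hr.1))
  have := integral_of_hasDerivAt_of_tendsto hd
    ((isTest_avgBump hδ hε).continuous.integrable_of_hasCompactSupport (isTest_avgBump hδ hε).2)
    h1 h2
  rw [this, sub_zero]

/-- The bound on the averages depends only on δ, by the mean value inequality; this allows η to be
chosen after δ. -/
theorem exists_bump_le (hδ : 0 < δ) : ∃ A, 0 ≤ A ∧ (∀ s, bump δ s ≤ A) ∧
    ∀ ε, 0 < ε → ∀ s, avgBump δ ε s ≤ A := by
  obtain ⟨A, hA0, hA⟩ := (isTest_bump hδ).exists_bound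
  refine ⟨A, hA0, fun s ↦ (le_abs_self _).trans (hA s), fun ε hε s ↦ ?_⟩
  rw [avgBump, div_le_iff₀ hε]
  have := Convex.norm_image_sub_le_of_norm_hasDerivWithin_le (s := univ) (C := A)
    (fun r _ ↦ (hasDerivAt_ramp δ r).hasDerivWithinAt) (fun r _ ↦ hA r) convex_univ
    (mem_univ s) (mem_univ (s + ε))
  rw [add_sub_cancel_left, Real.norm_of_nonneg hε.le] at this
  exact (le_abs_self _).trans this

end Bumps

/-! ### Regularized fluxes of a velocity field and their regularity. -/

section FluxKernels

variable {δ ε : ℝ}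

/-- The kernel that averages the `i`-th component of a velocity field near a side of a square. -/
def fluxKernel (δ ε : ℝ) (i : Fin 2) (z : Plane) : ℝ := bump δ (z i) * avgBump δ ε (z (i + 1))

/-- In `Fin 2` the index `i + 1` wraps around to the other coordinate. -/
theorem norm_le_sum_coord (z : Plane) (i : Fin 2) : ‖z‖ ≤ |z i| + |z (i + 1)| := by
  have h : ‖z‖ ^ 2 = |z i| ^ 2 + |z (i + 1)| ^ 2 := by
    rw [EuclideanSpace.norm_sq_eq, Fin.sum_univ_two]
    fin_cases i <;> simp [add_comm]
  refine le_of_sq_le_sq ?_ (by positivity)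
  nlinarith [abs_nonneg (z i), abs_nonneg (z (i + 1))]

theorem fluxKernel_eq_zero (hδ : 0 < δ) (hε : 0 < ε) (i : Fin 2) {z : Plane}
    (hz : 2 * (δ + ε) < ‖z‖) : fluxKernel δ ε i z = 0 := by
  by_contra h
  obtain ⟨h1, h2⟩ := mul_ne_zero_iff.1 h
  have h3 : 0 ≤ z i := not_lt.1 fun hn ↦ h1 (bump_of_neg hδ hn)
  have h4 : z i ≤ δ := not_lt.1 fun hn ↦ h1 (bump_of_lt hδ hn)
  have h5 : -ε ≤ z (i + 1) := not_lt.1 fun hn ↦ h2 (avgBump_of_lt_neg hδ hε hn)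
  have h6 : z (i + 1) ≤ δ := not_lt.1 fun hn ↦ h2 (avgBump_of_lt hδ hε hn)
  have h7 : |z i| ≤ δ + ε := abs_le.2 ⟨by linarith, by linarith⟩
  have h8 : |z (i + 1)| ≤ δ + ε := abs_le.2 ⟨by linarith, by linarith⟩
  linarith [norm_le_sum_coord z i]

theorem isTest_fluxKernel (hδ : 0 < δ) (hε : 0 < ε) (i : Fin 2) : IsTest (fluxKernel δ ε i) := by
  refine ⟨?_, HasCompactSupport.intro (isCompact_closedBall 0 (2 * (δ + ε))) fun z hz ↦ ?_⟩
  · exact ((contDiff_bump δ).comp (EuclideanSpace.proj i : Plane →L[ℝ] ℝ).contDiff).mul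
      ((contDiff_avgBump δ ε).comp (EuclideanSpace.proj (i + 1) : Plane →L[ℝ] ℝ).contDiff)
  · rw [mem_closedBall_zero_iff, not_le] at hz
    exact fluxKernel_eq_zero hδ hε i hz

theorem fluxKernel_nonneg (hδ : 0 < δ) (hε : 0 < ε) (i : Fin 2) (z : Plane) :
    0 ≤ fluxKernel δ ε i z := mul_nonneg (bump_nonneg hδ _) (avgBump_nonneg hδ hε _)

theorem integral_fluxKernel (hδ : 0 < δ) (hε : 0 < ε) (i : Fin 2) :
    ∫ z, fluxKernel δ ε i z = 1 := by
  rw [← (PiLp.volume_preserving_toLp (Fin 2)).integral_comp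
    (MeasurableEquiv.toLp 2 (Fin 2 → ℝ)).measurableEmbedding]
  have h : ∀ z : Fin 2 → ℝ, fluxKernel δ ε i (WithLp.toLp 2 z)
      = ∏ j, (if j = i then bump δ else avgBump δ ε) (z j) := fun z ↦ by
    rw [Fin.prod_univ_two]
    fin_cases i <;> simp [fluxKernel, mul_comm]
  simp_rw [h]
  rw [integral_fintype_prod_volume_eq_prod
    (f := fun j (s : ℝ) ↦ (if j = i then bump δ else avgBump δ ε) s)]
  refine Finset.prod_eq_one fun j _ ↦ ?_
  split_ifs
  · exact integral_bump hδ
  · exact integral_avgBump hδ hε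

theorem lintegral_fluxKernel (hδ : 0 < δ) (hε : 0 < ε) (i : Fin 2) :
    ∫⁻ z, ENNReal.ofReal (fluxKernel δ ε i z) = 1 := by
  have hi := (isTest_fluxKernel hδ hε i).continuous.integrable_of_hasCompactSupport
    (μ := (volume : Measure Plane)) (isTest_fluxKernel hδ hε i).2
  rw [← ofReal_integral_eq_lintegral_ofReal hi (ae_of_all _ (fluxKernel_nonneg hδ hε i)),
    integral_fluxKernel hδ hε i, ENNReal.ofReal_one]

end FluxKernels

section Fluxes

variable {δ ε : ℝ}

/-- The regularized `i`-th component of a velocity field. -/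
def flux (δ ε : ℝ) (u : L2Vector) (i : Fin 2) (x : Plane) : ℝ :=
  ∫ y, u y i * fluxKernel δ ε i (y - x)

theorem IsTest.comp_sub_right {F : Type*} [NormedAddCommGroup F] [NormedSpace ℝ F]
    {σ : Plane → F} (hσ : IsTest σ) (x : Plane) : IsTest fun t ↦ σ (t - x) :=
  ⟨hσ.1.comp (contDiff_id.sub contDiff_const), hσ.2.comp_homeomorph (Homeomorph.subRight x)⟩

/-- The test field whose product with `u` is the flux of `u`. -/
def fluxField (δ ε : ℝ) (i : Fin 2) (x y : Plane) : Plane :=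
  fluxKernel δ ε i (y - x) • EuclideanSpace.single i (1 : ℝ)

theorem flux_eq_inner (hδ : 0 < δ) (hε : 0 < ε) (u : L2Vector) (i : Fin 2) (x : Plane) :
    flux δ ε u i x = inner ℝ u (l2 (fluxField δ ε i x)) :=
  (inner_l2_smul_single u ((isTest_fluxKernel hδ hε i).comp_sub_right x) i).symm

theorem isTest_fluxField (hδ : 0 < δ) (hε : 0 < ε) (i : Fin 2) (x : Plane) :
    IsTest (fluxField δ ε i x) := ((isTest_fluxKernel hδ hε i).comp_sub_right x).smul_const _

theorem norm_l2_comp_sub_right {E : Type*} [NormedAddCommGroup E] {f : Plane → E}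
    (hf : MemLp f 2 volume) (x : Plane) : ‖l2 fun y ↦ f (y - x)‖ = ‖l2 f‖ := by
  have hp := measurePreserving_sub_right (volume : Measure Plane) x
  have hm : MemLp (fun y ↦ f (y - x)) 2 volume := hf.comp_measurePreserving hp
  rw [← toReal_enorm, ← toReal_enorm, enorm_l2 hm, enorm_l2 hf]
  congr 1
  exact eLpNorm_comp_measurePreserving hf.1 hp

theorem norm_l2_fluxField (hδ : 0 < δ) (hε : 0 < ε) (i : Fin 2) (x : Plane) :
    ‖l2 (fluxField δ ε i x)‖ = ‖l2 (fluxField δ ε i 0)‖ := by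
  have := norm_l2_comp_sub_right ((isTest_fluxField hδ hε i 0).memLp 2) x
  rw [← this]
  simp only [fluxField, sub_zero]
  rfl

theorem continuous_l2_fluxField (hδ : 0 < δ) (hε : 0 < ε) (i : Fin 2) :
    Continuous fun x ↦ l2 (fluxField δ ε i x) := by
  obtain ⟨C, hC0, hC⟩ := (isTest_fluxKernel hδ hε i).exists_lipschitz
  have hloc : ∀ x₀ x y : Plane, dist x x₀ < 1 → dist y x₀ < 1 →
      ‖l2 (fluxField δ ε i x) - l2 (fluxField δ ε i y)‖
        ≤ (C * ‖x - y‖) * ballConst (‖x₀‖ + 1 + 2 * (δ + ε)) := by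
    intro x₀ x y hx hy
    rw [← l2_sub ((isTest_fluxField hδ hε i x).memLp 2) ((isTest_fluxField hδ hε i y).memLp 2)]
    have hz : ∀ w z : Plane, dist w x₀ < 1 → ‖x₀‖ + 1 + 2 * (δ + ε) < ‖z‖ →
        fluxKernel δ ε i (z - w) = 0 := fun w z hw hz ↦ by
      refine fluxKernel_eq_zero hδ hε i ?_
      have h1 := norm_sub_norm_le z w
      have h2 := norm_sub_norm_le w x₀
      rw [dist_eq_norm] at hw
      linarith
    refine norm_l2_le (fun z hz' ↦ ?_) fun z ↦ ?_
    · rw [fluxField, fluxField, hz x z hx hz', hz y z hy hz']; simp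
    · rw [fluxField, fluxField, ← sub_smul, norm_smul, PiLp.norm_single, norm_one, mul_one]
      refine (hC _ _).trans (le_of_eq ?_)
      rw [show z - x - (z - y) = -(x - y) by abel, norm_neg]
  refine continuous_iff_continuousAt.2 fun x₀ ↦ ?_
  have h0 : Tendsto (fun x ↦ (C * ‖x - x₀‖) * ballConst (‖x₀‖ + 1 + 2 * (δ + ε))) (𝓝 x₀)
      (𝓝 0) := by
    have : Continuous fun x : Plane ↦ (C * ‖x - x₀‖) * ballConst (‖x₀‖ + 1 + 2 * (δ + ε)) := by
      fun_prop
    simpa using this.tendsto x₀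
  refine tendsto_iff_norm_sub_tendsto_zero.2 (squeeze_zero' (Eventually.of_forall fun _ ↦
    norm_nonneg _) ?_ h0)
  filter_upwards [Metric.ball_mem_nhds x₀ one_pos] with x hx
  exact hloc x₀ x x₀ hx (by simp)

theorem continuous_flux (hδ : 0 < δ) (hε : 0 < ε) (u : L2Vector) (i : Fin 2) :
    Continuous (flux δ ε u i) := by
  have : flux δ ε u i = fun x ↦ inner ℝ u (l2 (fluxField δ ε i x)) :=
    funext (flux_eq_inner hδ hε u i)
  rw [this]
  exact continuous_const.inner (continuous_l2_fluxField hδ hε i)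

theorem abs_flux_le (hδ : 0 < δ) (hε : 0 < ε) (u : L2Vector) (i : Fin 2) (x : Plane) :
    |flux δ ε u i x| ≤ ‖u‖ * ‖l2 (fluxField δ ε i 0)‖ := by
  rw [flux_eq_inner hδ hε, ← norm_l2_fluxField hδ hε i x]
  exact abs_real_inner_le_norm _ _

/-- The bound of the flux is uniform in the averaging length. -/
theorem exists_flux_le (hδ : 0 < δ) : ∃ A, 0 ≤ A ∧ ∀ ε, 0 < ε → ε ≤ 1 → ∀ u i x,
    |flux δ ε u i x| ≤ A * ‖u‖ := by
  obtain ⟨A, hA0, hA1, hA2⟩ := exists_bump_le hδ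
  refine ⟨A * A * ballConst (2 * (δ + 1)), mul_nonneg (by positivity) (ballConst_nonneg _),
    fun ε hε hε1 u i x ↦ (abs_flux_le hδ hε u i x).trans ?_⟩
  rw [mul_comm]
  refine mul_le_mul_of_nonneg_right (norm_l2_le (fun z hz ↦ ?_) fun z ↦ ?_) (norm_nonneg _)
  · rw [fluxField, sub_zero, fluxKernel_eq_zero hδ hε i (by linarith), zero_smul]
  · rw [fluxField, norm_smul, PiLp.norm_single, norm_one, mul_one, sub_zero,
      Real.norm_of_nonneg (fluxKernel_nonneg hδ hε i z)]
    exact mul_le_mul (hA1 _) (hA2 ε hε _) (avgBump_nonneg hδ hε _) hA0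

/-- The fluxes of a divergence-free field through the sides of a square add up to zero. -/
theorem sum_flux_sub (hδ : 0 < δ) (hε : 0 < ε) {u : L2Vector} (hu : IsDivFree u) (x : Plane) :
    ∑ i, (flux δ ε u i x - flux δ ε u i (x - ε • EuclideanSpace.single i 1)) = 0 := by
  -- A smoothed indicator of a square of side ε: its i-th derivative is the difference quotient of
  -- `fluxKernel δ ε i` over the shift ε eᵢ. Testing u with its translate gives a discrete
  -- divergence theorem without error term.
  set ψ : Plane → ℝ := fun y ↦ avgBump δ ε (y 0) * avgBump δ ε (y 1) with hψd
  have hψ : IsTest ψ := by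
    refine ⟨((contDiff_avgBump δ ε).comp (EuclideanSpace.proj 0 : Plane →L[ℝ] ℝ).contDiff).mul
      ((contDiff_avgBump δ ε).comp (EuclideanSpace.proj 1 : Plane →L[ℝ] ℝ).contDiff),
      HasCompactSupport.intro (isCompact_closedBall 0 (2 * (δ + ε))) fun z hz ↦ ?_⟩
    rw [mem_closedBall_zero_iff, not_le] at hz
    by_contra h
    obtain ⟨h1, h2⟩ := mul_ne_zero_iff.1 h
    have h3 : -ε ≤ z 0 := not_lt.1 fun hn ↦ h1 (avgBump_of_lt_neg hδ hε hn)
    have h4 : z 0 ≤ δ := not_lt.1 fun hn ↦ h1 (avgBump_of_lt hδ hε hn)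
    have h5 : -ε ≤ z 1 := not_lt.1 fun hn ↦ h2 (avgBump_of_lt_neg hδ hε hn)
    have h6 : z 1 ≤ δ := not_lt.1 fun hn ↦ h2 (avgBump_of_lt hδ hε hn)
    have h7 : |z 0| ≤ δ + ε := abs_le.2 ⟨by linarith, by linarith⟩
    have h8 : |z 1| ≤ δ + ε := abs_le.2 ⟨by linarith, by linarith⟩
    have := norm_le_sum_coord z 0
    simp only [zero_add] at this
    linarith
  have hd : ∀ y a : Plane, fderiv ℝ ψ y a = ∑ i, a i * ((fluxKernel δ ε i
      (y + ε • EuclideanSpace.single i 1) - fluxKernel δ ε i y) / ε) := by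
    intro y a
    have h0 := (hasDerivAt_avgBump δ ε (y 0)).comp_hasFDerivAt y
      (EuclideanSpace.proj 0 : Plane →L[ℝ] ℝ).hasFDerivAt
    have h1 := (hasDerivAt_avgBump δ ε (y 1)).comp_hasFDerivAt y
      (EuclideanSpace.proj 1 : Plane →L[ℝ] ℝ).hasFDerivAt
    have h2 := (h0.mul h1).fderiv
    have h3 : fderiv ℝ ψ y = _ := h2
    rw [h3, Fin.sum_univ_two]
    simp [fluxKernel]
    ring
  have key := hu _ (hψ.comp_sub_right x)
  have hd' : ∀ y a : Plane, fderiv ℝ (fun y ↦ ψ (y - x)) y a = fderiv ℝ ψ (y - x) a := by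
    intro y a
    simp_rw [sub_eq_add_neg, fderiv_comp_add_right]
  simp_rw [hd', hd] at key
  have hint : ∀ i (c : Plane), Integrable fun y ↦ u y i * fluxKernel δ ε i (y - c) := fun i c ↦
    integrable_component_mul u ((isTest_fluxKernel hδ hε i).comp_sub_right c) i
  have hterm : ∀ i, (fun y ↦ u y i * ((fluxKernel δ ε i
      (y - x + ε • EuclideanSpace.single i 1) - fluxKernel δ ε i (y - x)) / ε))
      = fun y ↦ ε⁻¹ * (u y i * fluxKernel δ ε i (y - (x - ε • EuclideanSpace.single i 1))
        - u y i * fluxKernel δ ε i (y - x)) := by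
    intro i; funext y
    rw [show y - (x - ε • EuclideanSpace.single i (1 : ℝ))
      = y - x + ε • EuclideanSpace.single i 1 by abel]
    field_simp
  rw [integral_finsetSum _ fun i _ ↦ ?_] at key
  · simp_rw [hterm, integral_const_mul] at key
    rw [← Finset.mul_sum, mul_eq_zero] at key
    have h0 := key.resolve_left (inv_ne_zero hε.ne')
    rw [← neg_eq_zero, ← Finset.sum_neg_distrib, ← h0]
    refine Finset.sum_congr rfl fun i _ ↦ ?_
    rw [integral_sub (hint _ _) (hint _ _), neg_sub]
    rfl
  · rw [hterm]
    exact ((hint _ _).sub (hint _ _)).const_mul _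

end Fluxes

section FluxEstimates

/-- Jensen's inequality for the probability density K, then Tonelli. Only points z where K is
nonzero matter, which lets the support radius enter the bound. -/
theorem lintegral_sq_average_le {K : Plane → ℝ} (hK0 : ∀ z, 0 ≤ K z) (hK : Measurable K)
    (hK1 : ∫⁻ z, ENNReal.ofReal (K z) = 1) {g : Plane → Plane → ℝ}
    (hg : Measurable (Function.uncurry g)) {M : ℝ≥0∞}
    (hM : ∀ z, K z ≠ 0 → ∫⁻ x, ‖g x z‖ₑ ^ 2 ≤ M) :
    ∫⁻ x, ‖∫ z, K z * g x z‖ₑ ^ 2 ≤ M := by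
  set μ : Measure Plane := volume.withDensity fun z ↦ ENNReal.ofReal (K z) with hμ
  have hprob : IsProbabilityMeasure μ := ⟨by
    rw [hμ, withDensity_apply _ MeasurableSet.univ, Measure.restrict_univ, hK1]⟩
  have hgx : ∀ x, Measurable (g x) := fun x ↦ hg.comp measurable_prodMk_left
  have h1 : ∀ x, ‖∫ z, K z * g x z‖ₑ ^ 2 ≤ ∫⁻ z, ‖g x z‖ₑ ^ 2 ∂μ := by
    intro x
    have h2 : ‖∫ z, K z * g x z‖ₑ ≤ eLpNorm (g x) 1 μ := by
      rw [eLpNorm_one_eq_lintegral_enorm, hμ, lintegral_withDensity_eq_lintegral_mul _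
        hK.ennreal_ofReal (hgx x).enorm]
      refine (enorm_integral_le_lintegral_enorm _).trans (le_of_eq ?_)
      refine lintegral_congr fun z ↦ ?_
      rw [enorm_mul, Real.enorm_of_nonneg (hK0 z), Pi.mul_apply]
    have h3 := h2.trans (eLpNorm_le_eLpNorm_of_exponent_le (p := 1) (q := 2)
      (by norm_num) (hgx x).aestronglyMeasurable)
    have h4 := eLpNorm_nnreal_pow_eq_lintegral (f := g x) (μ := μ) (p := 2) (by norm_num)
    simp only [NNReal.coe_ofNat, ENNReal.rpow_ofNat, ENNReal.coe_ofNat] at h4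
    rw [← h4]
    exact pow_le_pow_left' h3 2
  calc ∫⁻ x, ‖∫ z, K z * g x z‖ₑ ^ 2 ≤ ∫⁻ x, ∫⁻ z, ‖g x z‖ₑ ^ 2 ∂μ := lintegral_mono h1
    _ = ∫⁻ z, (∫⁻ x, ‖g x z‖ₑ ^ 2) ∂μ :=
      lintegral_lintegral_swap (hg.enorm.pow_const 2).aemeasurable
    _ ≤ ∫⁻ _, M ∂μ := by
      refine lintegral_mono_ae ?_
      rw [hμ, ae_withDensity_iff hK.ennreal_ofReal]
      refine ae_of_all _ fun z hz ↦ hM z fun h0 ↦ hz ?_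
      rw [h0, ENNReal.ofReal_zero]
    _ = M := by rw [lintegral_const, measure_univ, mul_one]

variable {δ ε : ℝ}

theorem measurable_component (u : L2Vector) (i : Fin 2) : Measurable fun x ↦ u x i :=
  (EuclideanSpace.proj i : Plane →L[ℝ] ℝ).measurable.comp (Lp.stronglyMeasurable u).measurable

theorem flux_eq_average (u : L2Vector) (i : Fin 2) (x : Plane) :
    flux δ ε u i x = ∫ z, fluxKernel δ ε i z * u (x + z) i := by
  rw [flux, ← integral_add_left_eq_self _ x]
  refine integral_congr_ae (ae_of_all _ fun z ↦ ?_)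
  change u (x + z) i * fluxKernel δ ε i (x + z - x) = _
  rw [add_sub_cancel_left, mul_comm]

theorem integrable_fluxKernel_mul (hδ : 0 < δ) (hε : 0 < ε) (u : L2Vector) (i : Fin 2)
    (x : Plane) : Integrable fun z ↦ fluxKernel δ ε i z * u (x + z) i := by
  have := (integrable_component_mul u ((isTest_fluxKernel hδ hε i).comp_sub_right x)
    i).comp_add_left x
  refine this.congr (ae_of_all _ fun z ↦ ?_)
  simp only [add_sub_cancel_left, mul_comm]

/-- Fractional regularity of a field controls the distance of its regularization. -/
theorem lintegral_flux_sub_le (hδ : 0 < δ) (hε : 0 < ε) (u : L2Vector) (i : Fin 2) (c : Plane) :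
    ∫⁻ x, ‖flux δ ε u i (x - c) - u x i‖ₑ ^ 2
      ≤ ENNReal.ofReal (2 * (2 * (δ + ε) + ‖c‖)) * hdotHalfSq u := by
  have hrep : ∀ x, flux δ ε u i (x - c) - u x i
      = ∫ z, fluxKernel δ ε i z * (u (x - c + z) i - u x i) := by
    intro x
    have hK := (isTest_fluxKernel hδ hε i).continuous.integrable_of_hasCompactSupport
      (μ := (volume : Measure Plane)) (isTest_fluxKernel hδ hε i).2
    simp_rw [mul_sub]
    rw [integral_sub (integrable_fluxKernel_mul hδ hε u i (x - c)) (hK.mul_const _),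
      ← flux_eq_average, integral_mul_const, integral_fluxKernel hδ hε, one_mul]
  simp_rw [hrep]
  have hm := measurable_component u i
  refine lintegral_sq_average_le (g := fun x z ↦ u (x - c + z) i - u x i)
    (fluxKernel_nonneg hδ hε i)
    (isTest_fluxKernel hδ hε i).continuous.measurable (lintegral_fluxKernel hδ hε i) ?_ ?_
  · exact (hm.comp (((measurable_fst.sub_const c).add measurable_snd))).sub
      (hm.comp measurable_fst)
  · intro z hz
    -- The translation vector z - c has length at most the kernel radius plus ‖c‖.
    have hz' : ‖z‖ ≤ 2 * (δ + ε) := not_lt.1 fun h ↦ hz (fluxKernel_eq_zero hδ hε i h)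
    have h1 : ∀ x : Plane, x - c + z = x + (z - c) := fun x ↦ by abel
    simp_rw [h1]
    refine (lintegral_component_translate_sub_le (z - c) u i).trans ?_
    gcongr
    exact (norm_sub_le _ _).trans (by linarith)

theorem lintegral_component_le (u : L2Vector) (i : Fin 2) :
    ∫⁻ x, ‖u x i‖ₑ ^ 2 ≤ ‖u‖ₑ ^ 2 := by
  rw [enorm_sq_eq_lintegral]
  refine lintegral_mono fun x ↦ ?_
  gcongr
  rw [enorm_le_iff_norm_le]
  exact PiLp.norm_apply_le _ _

theorem lintegral_flux_le (hδ : 0 < δ) (hε : 0 < ε) (u : L2Vector) (i : Fin 2) :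
    ∫⁻ x, ‖flux δ ε u i x‖ₑ ^ 2 ≤ ‖u‖ₑ ^ 2 := by
  simp_rw [flux_eq_average]
  refine lintegral_sq_average_le (g := fun x z ↦ u (x + z) i) (fluxKernel_nonneg hδ hε i)
    (isTest_fluxKernel hδ hε i).continuous.measurable (lintegral_fluxKernel hδ hε i)
    ((measurable_component u i).comp measurable_add) fun z _ ↦ ?_
  exact (lintegral_add_right_eq_self (fun x ↦ ‖u x i‖ₑ ^ 2) z).le.trans
    (lintegral_component_le u i)

theorem eLpNorm_flux_le (hδ : 0 < δ) (hε : 0 < ε) (u : L2Vector) (i : Fin 2) :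
    eLpNorm (flux δ ε u i) 2 volume ≤ ‖u‖ₑ := by
  rw [← ENNReal.pow_le_pow_left_iff two_ne_zero, eLpNorm_two_sq]
  exact lintegral_flux_le hδ hε u i

end FluxEstimates

/-! ### Doubly stochastic averages: contractivity, duality and consistency. -/

section Averages

variable {E J : Type*} [NormedAddCommGroup E] [NormedSpace ℝ E] [Fintype J]

/-- Weights `w` and shifts `d` of an averaging operator that preserves constants and integrals. -/
structure DoublyStochastic (w : J → Plane → ℝ) (d : J → Plane) : Prop where
  measurable : ∀ j, Measurable (w j)
  nonneg : ∀ j x, 0 ≤ w j x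
  sum_eq : ∀ x, ∑ j, w j x = 1
  sum_shift_eq : ∀ x, ∑ j, w j (x - d j) = 1

/-- The averaging operator with weights `w` and shifts `d`. -/
def average (w : J → Plane → ℝ) (d : J → Plane) (f : Plane → E) (x : Plane) : E :=
  ∑ j, w j x • f (x + d j)

variable {w : J → Plane → ℝ} {d : J → Plane}

theorem DoublyStochastic.adjoint (h : DoublyStochastic w d) :
    DoublyStochastic (fun j x ↦ w j (x - d j)) fun j ↦ -d j where
  measurable j := (h.measurable j).comp (measurable_id.sub_const _)
  nonneg j x := h.nonneg j _
  sum_eq := h.sum_shift_eq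
  sum_shift_eq x := by simpa using h.sum_eq x

theorem DoublyStochastic.le_one (h : DoublyStochastic w d) (j : J) (x : Plane) : w j x ≤ 1 := by
  rw [← h.sum_eq x]
  exact Finset.single_le_sum (f := fun j ↦ w j x) (fun j _ ↦ h.nonneg j x) (Finset.mem_univ j)

theorem DoublyStochastic.aestronglyMeasurable (h : DoublyStochastic w d) {f : Plane → E}
    (hf : AEStronglyMeasurable f volume) : AEStronglyMeasurable (average w d f) volume := by
  refine Finset.aestronglyMeasurable_fun_sum _ fun j _ ↦
    (h.measurable j).aestronglyMeasurable.smul ?_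
  exact hf.comp_measurePreserving (measurePreserving_add_right volume (d j))

theorem DoublyStochastic.enorm_average_le (h : DoublyStochastic w d) (f : Plane → E) (x : Plane) :
    ‖average w d f x‖ₑ ≤ ∑ j, ENNReal.ofReal (w j x) * ‖f (x + d j)‖ₑ := by
  refine (enorm_sum_le _ _).trans (Finset.sum_le_sum fun j _ ↦ ?_)
  rw [enorm_smul, Real.enorm_of_nonneg (h.nonneg j x)]

theorem DoublyStochastic.sum_ofReal (h : DoublyStochastic w d) (x : Plane) :
    ∑ j, ENNReal.ofReal (w j x) = 1 := by
  rw [← ENNReal.ofReal_sum_of_nonneg fun j _ ↦ h.nonneg j x, h.sum_eq, ENNReal.ofReal_one]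

/-- Pointwise convexity uses that the weights at x sum to 1. After translating each term, the
weights with which f x is used also sum to 1. -/
theorem DoublyStochastic.lintegral_rpow_le (h : DoublyStochastic w d) {f : Plane → E}
    (hf : AEStronglyMeasurable f volume) {q : ℝ} (hq : 1 ≤ q) :
    ∫⁻ x, ‖average w d f x‖ₑ ^ q ≤ ∫⁻ x, ‖f x‖ₑ ^ q := by
  calc ∫⁻ x, ‖average w d f x‖ₑ ^ q
      ≤ ∫⁻ x, ∑ j, ENNReal.ofReal (w j x) * ‖f (x + d j)‖ₑ ^ q := by
        refine lintegral_mono fun x ↦ ?_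
        exact (ENNReal.rpow_le_rpow (h.enorm_average_le f x) (by linarith)).trans
          (ENNReal.rpow_arith_mean_le_arith_mean_rpow _ _ _ (h.sum_ofReal x) hq)
    _ = ∑ j, ∫⁻ x, ENNReal.ofReal (w j x) * ‖f (x + d j)‖ₑ ^ q := by
        refine lintegral_finsetSum' _ fun j _ ↦ ?_
        exact (h.measurable j).ennreal_ofReal.aemeasurable.mul
          ((hf.comp_measurePreserving (measurePreserving_add_right volume (d j))).enorm.pow_const q)
    _ = ∑ j, ∫⁻ x, ENNReal.ofReal (w j (x - d j)) * ‖f x‖ₑ ^ q := by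
        refine Finset.sum_congr rfl fun j _ ↦ ?_
        rw [← lintegral_add_right_eq_self
          (fun x ↦ ENNReal.ofReal (w j (x - d j)) * ‖f x‖ₑ ^ q) (d j)]
        simp only [add_sub_cancel_right]
    _ = ∫⁻ x, ∑ j, ENNReal.ofReal (w j (x - d j)) * ‖f x‖ₑ ^ q := by
        refine (lintegral_finsetSum' _ fun j _ ↦ ?_).symm
        exact (h.adjoint.measurable j).ennreal_ofReal.aemeasurable.mul (hf.enorm.pow_const q)
    _ = ∫⁻ x, ‖f x‖ₑ ^ q := by
        refine lintegral_congr fun x ↦ ?_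
        rw [← Finset.sum_mul, h.adjoint.sum_ofReal, one_mul]

/-- Averaging operators are contractions of all the Lebesgue spaces. -/
theorem DoublyStochastic.eLpNorm_le (h : DoublyStochastic w d) {f : Plane → E}
    (hf : AEStronglyMeasurable f volume) {p : ℝ≥0∞} (hp : 1 ≤ p) :
    eLpNorm (average w d f) p volume ≤ eLpNorm f p volume := by
  rcases eq_or_ne p ⊤ with rfl | htop
  · rw [eLpNorm_exponent_top, eLpNorm_exponent_top]
    refine eLpNormEssSup_le_of_ae_enorm_bound ?_
    have h1 : ∀ j, ∀ᵐ x ∂(volume : Measure Plane), ‖f (x + d j)‖ₑ ≤ eLpNormEssSup f volume :=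
      fun j ↦ (measurePreserving_add_right volume (d j)).quasiMeasurePreserving.ae
        (enorm_ae_le_eLpNormEssSup f volume)
    filter_upwards [ae_all_iff.2 h1] with x hx
    refine (h.enorm_average_le f x).trans ?_
    calc ∑ j, ENNReal.ofReal (w j x) * ‖f (x + d j)‖ₑ
        ≤ ∑ j, ENNReal.ofReal (w j x) * eLpNormEssSup f volume :=
          Finset.sum_le_sum fun j _ ↦ by gcongr; exact hx j
      _ = _ := by rw [← Finset.sum_mul, h.sum_ofReal, one_mul]
  · have hp0 : p ≠ 0 := (zero_lt_one.trans_le hp).ne'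
    rw [eLpNorm_eq_lintegral_rpow_enorm_toReal hp0 htop,
      eLpNorm_eq_lintegral_rpow_enorm_toReal hp0 htop]
    refine ENNReal.rpow_le_rpow (h.lintegral_rpow_le hf ?_) (by positivity)
    rw [← ENNReal.toReal_one]
    exact ENNReal.toReal_mono htop hp

theorem DoublyStochastic.memLp (h : DoublyStochastic w d) {f : Plane → E} {p : ℝ≥0∞}
    (hp : 1 ≤ p) (hf : MemLp f p volume) : MemLp (average w d f) p volume :=
  ⟨h.aestronglyMeasurable hf.1, (h.eLpNorm_le hf.1 hp).trans_lt hf.2⟩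

theorem DoublyStochastic.norm_l2_average_le (h : DoublyStochastic w d)
    (f : Lp E 2 (volume : Measure Plane)) : ‖l2 (average w d f)‖ ≤ ‖f‖ := by
  rw [← enorm_le_iff_norm_le, enorm_l2 (h.memLp (by norm_num) (Lp.memLp f)), Lp.enorm_def]
  exact h.eLpNorm_le (Lp.aestronglyMeasurable f) (by norm_num)

end Averages

section AverageDuality

variable {E J : Type*} [NormedAddCommGroup E] [InnerProductSpace ℝ E] [Fintype J]
  {w : J → Plane → ℝ} {d : J → Plane}

/-- Translating each term moves the averaging to φ, with the weights evaluated at the shifted point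
and the shifts reversed. -/
theorem DoublyStochastic.inner_l2_average (h : DoublyStochastic w d)
    (f : Lp E 2 (volume : Measure Plane)) {φ : Plane → E} (hφ : MemLp φ 2 volume) :
    inner ℝ (l2 (average w d f)) (l2 φ)
      = inner ℝ f (l2 (average (fun j x ↦ w j (x - d j)) (fun j ↦ -d j) φ)) := by
  have hint : ∀ j, Integrable fun x ↦ w j (x - d j) * (inner ℝ (f x) (φ (x - d j)) : ℝ) := by
    intro j
    have h1 : MemLp (fun x ↦ φ (x - d j)) 2 volume :=
      hφ.comp_measurePreserving (measurePreserving_sub_right volume (d j))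
    refine (integrable_inner_l2 f h1).bdd_mul (c := 1)
      (h.adjoint.measurable j).aestronglyMeasurable (ae_of_all _ fun x ↦ ?_)
    rw [Real.norm_of_nonneg (h.nonneg j _)]
    exact h.le_one j _
  have hshift : ∀ j, (fun x ↦ w j x * (inner ℝ (f (x + d j)) (φ x) : ℝ))
      = fun x ↦ (fun y ↦ w j (y - d j) * (inner ℝ (f y) (φ (y - d j)) : ℝ)) (x + d j) := by
    intro j; funext x; simp
  rw [inner_l2 _ hφ, inner_l2 _ (h.adjoint.memLp (by norm_num) hφ)]
  have h2 : ∫ x, (inner ℝ (l2 (average w d f) x) (φ x) : ℝ)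
      = ∫ x, ∑ j, w j x * (inner ℝ (f (x + d j)) (φ x) : ℝ) := by
    refine integral_congr_ae ?_
    filter_upwards [coeFn_l2 (h.memLp (by norm_num) (Lp.memLp f))] with x hx
    rw [hx, average, sum_inner]
    exact Finset.sum_congr rfl fun j _ ↦ real_inner_smul_left _ _ _
  have h3 : ∫ x, (inner ℝ (f x) (average (fun j x ↦ w j (x - d j)) (fun j ↦ -d j) φ x) : ℝ)
      = ∫ x, ∑ j, w j (x - d j) * (inner ℝ (f x) (φ (x - d j)) : ℝ) := by
    refine integral_congr_ae (ae_of_all _ fun x ↦ ?_)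
    simp only [average, inner_sum, real_inner_smul_right, ← sub_eq_add_neg]
  rw [h2, h3, integral_finsetSum _ fun j _ ↦ hint j, integral_finsetSum _ fun j _ ↦ by
    rw [hshift]; exact (hint j).comp_add_right (d j)]
  refine Finset.sum_congr rfl fun j _ ↦ ?_
  rw [hshift, integral_add_right_eq_self
    (fun y ↦ w j (y - d j) * (inner ℝ (f y) (φ (y - d j)) : ℝ)) (d j)]

end AverageDuality

section Taylor

variable {E J : Type*} [NormedAddCommGroup E] [NormedSpace ℝ E] [Fintype J]
  {w : J → Plane → ℝ} {d : J → Plane}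

theorem ControlledTest.taylor {f : Plane → E} {C R : ℝ} (hf : ControlledTest f C R)
    (x a : Plane) : ‖f (x + a) - f x - fderiv ℝ f x a‖ ≤ C * ‖a‖ ^ 2 := by
  have h := Convex.norm_image_sub_le_of_norm_fderiv_le' (𝕜 := ℝ) (f := f) (φ := fderiv ℝ f x)
    (s := Metric.closedBall x ‖a‖) (x := x) (y := x + a) (C := C * ‖a‖)
    (fun y _ ↦ hf.isTest.differentiable y) (fun y hy ↦ ?_) (convex_closedBall _ _)
    (Metric.mem_closedBall_self (norm_nonneg a)) (by simp)
  · rw [add_sub_cancel_left] at h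
    exact h.trans (le_of_eq (by ring))
  · refine (hf.lipschitz_fderiv y x).trans ?_
    rw [mem_closedBall_iff_norm] at hy
    exact mul_le_mul_of_nonneg_left hy hf.nonneg

/-- Weights of sum 1 remove the zeroth-order term, and the first-order term is the derivative along
the mean shift; the Taylor remainder is left. -/
theorem DoublyStochastic.norm_average_sub_le (h : DoublyStochastic w d) {ε : ℝ}
    (hd : ∀ j, ‖d j‖ ≤ ε) {f : Plane → E} {C R : ℝ} (hf : ControlledTest f C R) (x : Plane) :
    ‖average w d f x - f x - fderiv ℝ f x (∑ j, w j x • d j)‖ ≤ C * ε ^ 2 := by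
  have h1 : average w d f x - f x - fderiv ℝ f x (∑ j, w j x • d j)
      = ∑ j, w j x • (f (x + d j) - f x - fderiv ℝ f x (d j)) := by
    simp only [smul_sub, Finset.sum_sub_distrib, ← Finset.sum_smul, h.sum_eq, one_smul, map_sum,
      map_smul, average]
  rw [h1]
  calc ‖∑ j, w j x • (f (x + d j) - f x - fderiv ℝ f x (d j))‖
      ≤ ∑ j, w j x * (C * ε ^ 2) := by
        refine (norm_sum_le _ _).trans (Finset.sum_le_sum fun j _ ↦ ?_)
        rw [norm_smul, Real.norm_of_nonneg (h.nonneg j x)]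
        refine mul_le_mul_of_nonneg_left ((hf.taylor x (d j)).trans ?_) (h.nonneg j x)
        exact mul_le_mul_of_nonneg_left (pow_le_pow_left₀ (norm_nonneg _) (hd j) 2) hf.nonneg
    _ = C * ε ^ 2 := by rw [← Finset.sum_mul, h.sum_eq, one_mul]

theorem average_eq_zero {ε : ℝ} (hd : ∀ j, ‖d j‖ ≤ ε) {f : Plane → E} {C R : ℝ}
    (hf : ControlledTest f C R) {x : Plane} (hx : R + ε < ‖x‖) : average w d f x = 0 := by
  refine Finset.sum_eq_zero fun j _ ↦ ?_
  rw [hf.support, smul_zero]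
  have := norm_sub_le (x + d j) (d j)
  rw [add_sub_cancel_right] at this
  linarith [hd j]

theorem ControlledTest.fderiv_eq_zero {f : Plane → E} {C R : ℝ} (hf : ControlledTest f C R)
    {x : Plane} (hx : R < ‖x‖) : fderiv ℝ f x = 0 := by
  have : f =ᶠ[𝓝 x] fun _ ↦ 0 := by
    filter_upwards [(isOpen_lt continuous_const continuous_norm).mem_nhds hx] with y hy
    exact hf.support y hy
  rw [this.fderiv_eq]; simp

theorem ControlledTest.memLp_fderiv {f : Plane → E} {C R : ℝ} (hf : ControlledTest f C R)
    {u : Plane → Plane} (hu : MemLp u 2 volume) : MemLp (fun x ↦ fderiv ℝ f x (u x)) 2 volume := by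
  refine hu.of_le_mul (c := C) ?_ (ae_of_all _ fun x ↦ ?_)
  · exact isBoundedBilinearMap_apply.continuous.comp_aestronglyMeasurable
      (hf.isTest.toFDeriv.continuous.aestronglyMeasurable.prodMk hu.1)
  · exact (ContinuousLinearMap.le_opNorm _ _).trans
      (mul_le_mul_of_nonneg_right (hf.bound_fderiv x) (norm_nonneg _))

theorem ControlledTest.enorm_l2_fderiv_le {f : Plane → E} {C R : ℝ} (hf : ControlledTest f C R)
    {u : Plane → Plane} (hu : MemLp u 2 volume) :
    ‖l2 fun x ↦ fderiv ℝ f x (u x)‖ₑ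
      ≤ ENNReal.ofReal C * eLpNorm ((Metric.closedBall 0 R).indicator u) 2 volume := by
  rw [enorm_l2 (hf.memLp_fderiv hu)]
  refine eLpNorm_le_mul_eLpNorm_of_ae_le_mul (ae_of_all _ fun x ↦ ?_) 2
  by_cases hx : x ∈ Metric.closedBall 0 R
  · rw [indicator_of_mem hx]
    exact (ContinuousLinearMap.le_opNorm _ _).trans
      (mul_le_mul_of_nonneg_right (hf.bound_fderiv x) (norm_nonneg _))
  · rw [mem_closedBall_zero_iff, not_le] at hx
    rw [hf.fderiv_eq_zero hx, zero_apply, norm_zero]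
    exact mul_nonneg hf.nonneg (norm_nonneg _)

end Taylor

/-! ### The four-point transport weights and the mean velocity. -/

section Transport

variable {δ ε η : ℝ}

/-- The unit vectors of the plane. -/
abbrev unitVec (i : Fin 2) : Plane := EuclideanSpace.single i (1 : ℝ)

/-- The weights of the transport step. -/
def fluxWeight (δ ε η : ℝ) (u : L2Vector) (j : Fin 2 × Bool) (x : Plane) : ℝ :=
  if j.2 then 1 / 4 - η / 2 * flux δ ε u j.1 x
  else 1 / 4 + η / 2 * flux δ ε u j.1 (x - ε • unitVec j.1)

/-- The shifts of the transport step. -/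
def fluxShift (ε : ℝ) (j : Fin 2 × Bool) : Plane :=
  if j.2 then ε • unitVec j.1 else -(ε • unitVec j.1)

theorem norm_fluxShift (hε : 0 ≤ ε) (j : Fin 2 × Bool) : ‖fluxShift ε j‖ ≤ ε := by
  rw [fluxShift]
  split_ifs <;> simp [norm_smul, abs_of_nonneg hε]

/-- A velocity field whose flux is small enough for the transport step. -/
def IsSlow (δ ε η : ℝ) (u : L2Vector) : Prop := ∀ i x, η * |flux δ ε u i x| ≤ 1 / 2

/-- Slowness keeps (η/2)|flux| below 1/4, hence positivity. Both weight sums differ from 1 by η/2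
times the discrete divergence, which vanishes by `sum_flux_sub`. -/
theorem doublyStochastic_fluxWeight (hδ : 0 < δ) (hε : 0 < ε) (hη : 0 ≤ η) {u : L2Vector}
    (hu : IsDivFree u) (hs : IsSlow δ ε η u) :
    DoublyStochastic (fluxWeight δ ε η u) (fluxShift ε) where
  measurable j := by
    have h1 := (continuous_flux hδ hε u j.1).measurable
    have h2 : Measurable fun x ↦ flux δ ε u j.1 (x - ε • unitVec j.1) :=
      h1.comp (measurable_id.sub_const _)
    unfold fluxWeight
    split_ifs
    · exact (h1.const_mul _).const_sub _
    · exact (h2.const_mul _).const_add _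
  nonneg j x := by
    have h : ∀ y, |η * flux δ ε u j.1 y| ≤ 1 / 2 := fun y ↦ by
      rw [abs_mul, abs_of_nonneg hη]; exact hs _ _
    rw [fluxWeight]
    split_ifs
    · linarith [(abs_le.1 (h x)).2]
    · linarith [(abs_le.1 (h (x - ε • unitVec j.1))).1]
  sum_eq x := by
    have := sum_flux_sub hδ hε hu x
    rw [Fin.sum_univ_two] at this
    rw [Fintype.sum_prod_type]
    simp only [Fintype.sum_bool, fluxWeight, Fin.sum_univ_two, if_true, Bool.false_eq_true,
      if_false]
    linear_combination (-η / 2) * this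
  sum_shift_eq x := by
    have := sum_flux_sub hδ hε hu x
    rw [Fin.sum_univ_two] at this
    rw [Fintype.sum_prod_type]
    simp only [Fintype.sum_bool, fluxWeight, fluxShift, Fin.sum_univ_two, if_true,
      Bool.false_eq_true, if_false, sub_neg_eq_add, add_sub_cancel_right]
    linear_combination (η / 2) * this

theorem flux_zero (i : Fin 2) (x : Plane) : flux δ ε 0 i x = 0 := by
  rw [flux]
  refine integral_eq_zero_of_ae ?_
  filter_upwards [Lp.coeFn_zero Plane 2 (volume : Measure Plane)] with y hy
  rw [hy]; simp

open Classical in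
/-- Velocity fields that are too fast for the transport step are replaced by zero. -/
def cut (δ ε η : ℝ) (u : L2Vector) : L2Vector := if IsSlow δ ε η u then u else 0

theorem isSlow_cut (u : L2Vector) : IsSlow δ ε η (cut δ ε η u) := by
  rw [cut]
  split_ifs with h
  · exact h
  · intro i x; rw [flux_zero]; norm_num

theorem isDivFree_cut {u : L2Vector} (hu : IsDivFree u) : IsDivFree (cut δ ε η u) := by
  rw [cut]
  split_ifs with h
  · exact hu
  · exact mem_divFree.1 divFree.zero_mem

theorem norm_cut_le (u : L2Vector) : ‖cut δ ε η u‖ ≤ ‖u‖ := by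
  rw [cut]
  split_ifs with h
  · exact le_rfl
  · rw [norm_zero]; exact norm_nonneg _

/-- The average of the fluxes on opposite sides of a square. -/
def meanFlux (δ ε : ℝ) (u : L2Vector) (x : Plane) : Plane :=
  WithLp.toLp 2 fun i ↦ (flux δ ε u i x + flux δ ε u i (x - ε • unitVec i)) / 2

/-- In the adjoint the quarters cancel between opposite neighbours. With ε = η² the mean
displacement is η³ times the velocity, which is why the time step is η³. -/
theorem sum_fluxWeight_smul (u : L2Vector) (x : Plane) :
    ∑ j, fluxWeight δ ε η u j (x - fluxShift ε j) • -fluxShift ε j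
      = (η * ε) • meanFlux δ ε u x := by
  rw [plane_eq_sum (meanFlux δ ε u x), Finset.smul_sum, Fintype.sum_prod_type]
  refine Finset.sum_congr rfl fun i _ ↦ ?_
  simp only [Fintype.sum_bool, fluxWeight, fluxShift, if_true,
      Bool.false_eq_true, if_false, sub_neg_eq_add, add_sub_cancel_right, meanFlux, neg_neg]
  module

theorem eLpNorm_le_sum_component {f : Plane → Plane} (hf : ∀ i, AEStronglyMeasurable
    (fun x ↦ f x i) volume) :
    eLpNorm f 2 volume ≤ ∑ i, eLpNorm (fun x ↦ f x i) 2 volume := by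
  refine le_trans (eLpNorm_mono_ae_real (g := fun x ↦ ∑ i, ‖f x i‖) (ae_of_all _ fun x ↦ ?_)) ?_
  · have := norm_le_sum_coord (f x) 0
    simpa [Fin.sum_univ_two] using this
  · have h := eLpNorm_sum_le (s := Finset.univ) (f := fun i x ↦ ‖f x i‖) (μ := volume) (p := 2)
      (fun i _ ↦ (hf i).norm) (by norm_num)
    refine le_trans (le_of_eq ?_) (h.trans (le_of_eq ?_))
    · congr 1
    · simp only [eLpNorm_norm]

theorem aestronglyMeasurable_of_component {f : Plane → Plane} (hf : ∀ i, AEStronglyMeasurable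
    (fun x ↦ f x i) volume) : AEStronglyMeasurable f volume := by
  have h : f = fun x ↦ ∑ i, f x i • unitVec i := funext fun x ↦ plane_eq_sum (f x)
  rw [h]
  exact Finset.aestronglyMeasurable_fun_sum _ fun i _ ↦ (hf i).smul_const _

theorem continuous_flux_shift (hδ : 0 < δ) (hε : 0 < ε) (u : L2Vector) (i : Fin 2) :
    Continuous fun x ↦ flux δ ε u i (x - ε • unitVec i) :=
  (continuous_flux hδ hε u i).comp (continuous_id.sub continuous_const)

theorem continuous_meanFlux_component (hδ : 0 < δ) (hε : 0 < ε) (u : L2Vector) (i : Fin 2) :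
    Continuous fun x ↦ meanFlux δ ε u x i :=
  ((continuous_flux hδ hε u i).add (continuous_flux_shift hδ hε u i)).div_const 2

theorem eLpNorm_half_add_le {a b : Plane → ℝ} (ha : AEStronglyMeasurable a volume)
    (hb : AEStronglyMeasurable b volume) {M : ℝ≥0∞} (hM : eLpNorm a 2 volume ≤ M)
    (hM' : eLpNorm b 2 volume ≤ M) : eLpNorm (fun x ↦ (a x + b x) / 2) 2 volume ≤ M := by
  have h : (fun x ↦ (a x + b x) / 2) = (2⁻¹ : ℝ) • (a + b) := by
    funext x; simp [div_eq_inv_mul]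
  rw [h, eLpNorm_const_smul]
  calc ‖(2⁻¹ : ℝ)‖ₑ * eLpNorm (a + b) 2 volume ≤ 2⁻¹ * (M + M) := by
        refine mul_le_mul' ?_ ((eLpNorm_add_le ha hb (by norm_num)).trans (add_le_add hM hM'))
        rw [Real.enorm_of_nonneg (by norm_num), ENNReal.ofReal_inv_of_pos (by norm_num)]
        simp
    _ = M := by
        rw [← two_mul, ← mul_assoc, ENNReal.inv_mul_cancel two_ne_zero (by simp), one_mul]

theorem eLpNorm_meanFlux_le (hδ : 0 < δ) (hε : 0 < ε) (u : L2Vector) :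
    eLpNorm (meanFlux δ ε u) 2 volume ≤ 2 * ‖u‖ₑ := by
  refine (eLpNorm_le_sum_component fun i ↦
    (continuous_meanFlux_component hδ hε u i).aestronglyMeasurable).trans ?_
  have h : ∀ i, eLpNorm (fun x ↦ meanFlux δ ε u x i) 2 volume ≤ ‖u‖ₑ := fun i ↦ by
    refine eLpNorm_half_add_le (continuous_flux hδ hε u i).aestronglyMeasurable
      (continuous_flux_shift hδ hε u i).aestronglyMeasurable (eLpNorm_flux_le hδ hε u i) ?_
    have := eLpNorm_comp_measurePreserving (p := 2)
      (continuous_flux hδ hε u i).aestronglyMeasurable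
      (measurePreserving_sub_right (volume : Measure Plane) (ε • unitVec i))
    exact this.le.trans (eLpNorm_flux_le hδ hε u i)
  rw [Fin.sum_univ_two, two_mul]
  exact add_le_add (h 0) (h 1)

theorem memLp_meanFlux (hδ : 0 < δ) (hε : 0 < ε) (u : L2Vector) :
    MemLp (meanFlux δ ε u) 2 volume :=
  ⟨aestronglyMeasurable_of_component fun i ↦
    (continuous_meanFlux_component hδ hε u i).aestronglyMeasurable,
    (eLpNorm_meanFlux_le hδ hε u).trans_lt (ENNReal.mul_lt_top (by simp) (by simp))⟩

theorem eLpNorm_meanFlux_sub_le (hδ : 0 < δ) (hε : 0 < ε) (u : L2Vector) :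
    eLpNorm (fun x ↦ meanFlux δ ε u x - u x) 2 volume
      ≤ 2 * (ENNReal.ofReal (4 * δ + 6 * ε) * hdotHalfSq u) ^ (1 / 2 : ℝ) := by
  have hu : ∀ i, AEStronglyMeasurable (fun x ↦ u x i) volume := fun i ↦
    (measurable_component u i).aestronglyMeasurable
  have h1 := fun i ↦ (continuous_flux hδ hε u i).aestronglyMeasurable (μ := volume)
  have h2 := fun i ↦ (continuous_flux_shift hδ hε u i).aestronglyMeasurable (μ := volume)
  refine (eLpNorm_le_sum_component fun i ↦ ((continuous_meanFlux_component hδ hε u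
    i).aestronglyMeasurable.sub (hu i))).trans ?_
  have hsq : ∀ (f : Plane → ℝ) (M : ℝ≥0∞), ∫⁻ x, ‖f x‖ₑ ^ 2 ≤ M →
      eLpNorm f 2 volume ≤ M ^ (1 / 2 : ℝ) := fun f M hM ↦ by
    rw [← eLpNorm_two_sq] at hM
    rw [one_div, ENNReal.le_rpow_inv_iff two_pos]
    exact_mod_cast hM
  have h : ∀ i, eLpNorm (fun x ↦ (meanFlux δ ε u x - u x) i) 2 volume
      ≤ (ENNReal.ofReal (4 * δ + 6 * ε) * hdotHalfSq u) ^ (1 / 2 : ℝ) := fun i ↦ by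
    have h3 : (fun x ↦ (meanFlux δ ε u x - u x) i) = fun x ↦ ((flux δ ε u i x - u x i)
        + (flux δ ε u i (x - ε • unitVec i) - u x i)) / 2 := by
      funext x
      change (flux δ ε u i x + flux δ ε u i (x - ε • unitVec i)) / 2 - u x i = _
      ring
    rw [h3]
    -- The constant is 2(2(δ + ε) + ε) = 4δ + 6ε: kernel radius plus a shift of at most ε.
    have hb : ∀ c : Plane, ‖c‖ ≤ ε → ∫⁻ x, ‖flux δ ε u i (x - c) - u x i‖ₑ ^ 2
        ≤ ENNReal.ofReal (4 * δ + 6 * ε) * hdotHalfSq u := fun c hc ↦ by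
      refine (lintegral_flux_sub_le hδ hε u i c).trans ?_
      gcongr
      linarith
    refine eLpNorm_half_add_le ((h1 i).sub (hu i)) ((h2 i).sub (hu i)) (hsq _ _ ?_)
      (hsq _ _ (hb _ ?_))
    · simpa using hb 0 (by simpa using hε.le)
    · simp [norm_smul, abs_of_pos hε]
  rw [Fin.sum_univ_two, two_mul]
  exact add_le_add (h 0) (h 1)

end Transport

/-! ### One transport step and the generator of its adjoint. -/

section TransportStep

variable {E : Type*} [NormedAddCommGroup E]

/-- One explicit transport step of length `η³` with the velocity field `u`, regularized at
scale `δ`. -/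
def transport [NormedSpace ℝ E] (δ η : ℝ) (u : L2Vector) (f : Lp E 2 (volume : Measure Plane)) :
    Lp E 2 (volume : Measure Plane) :=
  l2 (average (fluxWeight δ (η ^ 2) η (cut δ (η ^ 2) η u)) (fluxShift (η ^ 2)) f)

/-- The generator of the adjoint of the transport step. -/
def generator [NormedSpace ℝ E] (δ η : ℝ) (u : L2Vector) (φ : Plane → E) (x : Plane) : E :=
  (η ^ 3)⁻¹ • (average (fun j x ↦ fluxWeight δ (η ^ 2) η (cut δ (η ^ 2) η u) j
    (x - fluxShift (η ^ 2) j)) (fun j ↦ -fluxShift (η ^ 2) j) φ x - φ x)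

variable {δ η : ℝ} {u : L2Vector}

theorem doublyStochastic_cut (hδ : 0 < δ) (hη : 0 < η) (hu : IsDivFree u) :
    DoublyStochastic (fluxWeight δ (η ^ 2) η (cut δ (η ^ 2) η u)) (fluxShift (η ^ 2)) :=
  doublyStochastic_fluxWeight hδ (pow_pos hη 2) hη.le (isDivFree_cut hu) (isSlow_cut u)

theorem norm_transport_le [NormedSpace ℝ E] (hδ : 0 < δ) (hη : 0 < η) (hu : IsDivFree u)
    (f : Lp E 2 (volume : Measure Plane)) : ‖transport δ η u f‖ ≤ ‖f‖ :=
  (doublyStochastic_cut hδ hη hu).norm_l2_average_le f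

theorem eLpNorm_transport_le [NormedSpace ℝ E] (hδ : 0 < δ) (hη : 0 < η) (hu : IsDivFree u)
    (f : Lp E 2 (volume : Measure Plane)) {p : ℝ≥0∞} (hp : 1 ≤ p) :
    eLpNorm (transport δ η u f) p volume ≤ eLpNorm f p volume := by
  have h := doublyStochastic_cut hδ hη hu
  rw [transport, eLpNorm_congr_ae (coeFn_l2 (h.memLp (by norm_num) (Lp.memLp f)))]
  exact h.eLpNorm_le (Lp.aestronglyMeasurable f) hp

theorem memLp_generator [NormedSpace ℝ E] (hδ : 0 < δ) (hη : 0 < η) (hu : IsDivFree u)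
    {φ : Plane → E} (hφ : MemLp φ 2 volume) : MemLp (generator δ η u φ) 2 volume :=
  (((doublyStochastic_cut hδ hη hu).adjoint.memLp (by norm_num) hφ).sub hφ).const_smul _

/-- By duality the step acts on the test function, so no regularity of f is used. -/
theorem inner_transport [InnerProductSpace ℝ E] (hδ : 0 < δ) (hη : 0 < η) (hu : IsDivFree u)
    (f : Lp E 2 (volume : Measure Plane)) {φ : Plane → E} (hφ : MemLp φ 2 volume) :
    (inner ℝ (transport δ η u f) (l2 φ) : ℝ)
      = inner ℝ f (l2 φ) + η ^ 3 * inner ℝ f (l2 (generator δ η u φ)) := by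
  have h := doublyStochastic_cut hδ hη hu
  have h1 := h.adjoint.memLp (by norm_num : (1 : ℝ≥0∞) ≤ 2) hφ
  rw [transport, h.inner_l2_average f hφ]
  have h2 : l2 (generator δ η u φ) = (η ^ 3)⁻¹ • (l2 (average (fun j x ↦
      fluxWeight δ (η ^ 2) η (cut δ (η ^ 2) η u) j (x - fluxShift (η ^ 2) j))
      (fun j ↦ -fluxShift (η ^ 2) j) φ) - l2 φ) := by
    rw [← l2_sub h1 hφ]
    exact l2_smul (h1.sub hφ) _
  rw [h2, inner_smul_right, inner_sub_right, mul_inv_cancel_left₀ (by positivity)]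
  ring

/-- The generator of the transport step is close to the directional derivative along the
regularized velocity field. -/
theorem norm_l2_generator_sub_le [NormedSpace ℝ E] (hδ : 0 < δ) (hη : 0 < η) (hη1 : η ≤ 1)
    (hu : IsDivFree u) {φ : Plane → E} {C R : ℝ} (hφ : ControlledTest φ C R) :
    ‖l2 fun x ↦ generator δ η u φ x
      - fderiv ℝ φ x (meanFlux δ (η ^ 2) (cut δ (η ^ 2) η u) x)‖
      ≤ C * η * ballConst (R + 1) := by
  have h := (doublyStochastic_cut hδ hη hu).adjoint
  have hd : ∀ j, ‖-fluxShift (η ^ 2) j‖ ≤ η ^ 2 := fun j ↦ by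
    rw [norm_neg]; exact norm_fluxShift (by positivity) j
  have hη2 : η ^ 2 ≤ 1 := pow_le_one₀ hη.le hη1
  refine norm_l2_le (fun x hx ↦ ?_) fun x ↦ ?_
  · rw [generator, average_eq_zero hd hφ (by linarith), hφ.support x (by linarith),
      hφ.fderiv_eq_zero (by linarith)]
    simp
  · have h1 := h.norm_average_sub_le hd hφ x
    rw [sum_fluxWeight_smul] at h1
    have h2 : generator δ η u φ x - fderiv ℝ φ x (meanFlux δ (η ^ 2) (cut δ (η ^ 2) η u) x)
        = (η ^ 3)⁻¹ • (average (fun j x ↦ fluxWeight δ (η ^ 2) η (cut δ (η ^ 2) η u) j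
          (x - fluxShift (η ^ 2) j)) (fun j ↦ -fluxShift (η ^ 2) j) φ x - φ x
          - fderiv ℝ φ x ((η * η ^ 2) • meanFlux δ (η ^ 2) (cut δ (η ^ 2) η u) x)) := by
      rw [generator, map_smul, smul_sub (η ^ 3)⁻¹ (_ - _), smul_smul,
        show η * η ^ 2 = η ^ 3 by ring, inv_mul_cancel₀ (by positivity), one_smul]
    rw [h2, norm_smul, norm_inv, norm_pow, Real.norm_of_nonneg hη.le]
    -- The squared shift η⁴ over the time step η³: the numerical diffusion is of order η.
    calc (η ^ 3)⁻¹ * _ ≤ (η ^ 3)⁻¹ * (C * (η ^ 2) ^ 2) :=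
          mul_le_mul_of_nonneg_left h1 (by positivity)
      _ = C * η := by field_simp

theorem norm_l2_generator_le [NormedSpace ℝ E] (hδ : 0 < δ) (hη : 0 < η) (hη1 : η ≤ 1)
    (hu : IsDivFree u) {φ : Plane → E} {C R : ℝ} (hφ : ControlledTest φ C R) :
    ‖l2 (generator δ η u φ)‖ ≤ C * ballConst (R + 1) + 2 * C * ‖u‖ := by
  have hC := hφ.nonneg
  have h1 := norm_l2_generator_sub_le hδ hη hη1 hu hφ
  have hm := memLp_meanFlux hδ (pow_pos hη 2) (cut δ (η ^ 2) η u)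
  rw [l2_sub (memLp_generator hδ hη hu (hφ.isTest.memLp 2)) (hφ.memLp_fderiv hm)] at h1
  have h2 := hφ.enorm_l2_fderiv_le hm
  have h3 : ‖l2 fun x ↦ fderiv ℝ φ x (meanFlux δ (η ^ 2) (cut δ (η ^ 2) η u) x)‖
      ≤ 2 * C * ‖u‖ := by
    have h4 := h2.trans (mul_le_mul_right ((eLpNorm_indicator_le _).trans
      (eLpNorm_meanFlux_le hδ (pow_pos hη 2) _)) (ENNReal.ofReal C))
    have h5 : ENNReal.ofReal C * (2 * ‖cut δ (η ^ 2) η u‖ₑ)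
        = ENNReal.ofReal (C * (2 * ‖cut δ (η ^ 2) η u‖)) := by
      rw [ENNReal.ofReal_mul hC, ENNReal.ofReal_mul (by norm_num), ofReal_norm]; simp
    rw [h5, ← ofReal_norm, ENNReal.ofReal_le_ofReal_iff (by positivity)] at h4
    refine h4.trans ?_
    have := mul_le_mul_of_nonneg_left (norm_cut_le (δ := δ) (ε := η ^ 2) (η := η) u) hC
    linarith
  have h6 := norm_le_norm_add_norm_sub' (l2 (generator δ η u φ))
    (l2 fun x ↦ fderiv ℝ φ x (meanFlux δ (η ^ 2) (cut δ (η ^ 2) η u) x))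
  have h7 : C * η * ballConst (R + 1) ≤ C * ballConst (R + 1) :=
    mul_le_mul_of_nonneg_right (mul_le_of_le_one_right hC hη1) (ballConst_nonneg _)
  linarith

/-- The generator of the transport step is close to the directional derivative along a slow
velocity field. -/
theorem enorm_l2_generator_sub_le [NormedSpace ℝ E] (hδ : 0 < δ) (hη : 0 < η) (hη1 : η ≤ 1)
    (hu : IsDivFree u) (hs : IsSlow δ (η ^ 2) η u) {φ : Plane → E} {C R : ℝ}
    (hφ : ControlledTest φ C R) :
    ‖l2 (generator δ η u φ) - l2 fun x ↦ fderiv ℝ φ x (u x)‖ₑ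
      ≤ ENNReal.ofReal (C * η * ballConst (R + 1)) + ENNReal.ofReal C *
        (2 * (ENNReal.ofReal (4 * δ + 6 * η ^ 2) * hdotHalfSq u) ^ (1 / 2 : ℝ)) := by
  have h1 := norm_l2_generator_sub_le hδ hη hη1 hu hφ
  rw [cut, if_pos hs] at h1
  have hm := memLp_meanFlux hδ (pow_pos hη 2) u
  have hg := memLp_generator hδ hη hu (hφ.isTest.memLp 2)
  rw [l2_sub hg (hφ.memLp_fderiv hm)] at h1
  have h2 := hφ.enorm_l2_fderiv_le (u := fun x ↦ meanFlux δ (η ^ 2) u x - u x)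
    (hm.sub (Lp.memLp u))
  simp_rw [map_sub] at h2
  rw [l2_sub (hφ.memLp_fderiv hm) (hφ.memLp_fderiv (Lp.memLp u))] at h2
  rw [← sub_add_sub_cancel (l2 (generator δ η u φ))
    (l2 fun x ↦ fderiv ℝ φ x (meanFlux δ (η ^ 2) u x))]
  refine (enorm_add_le _ _).trans (add_le_add ?_ (h2.trans ?_))
  · rw [← ofReal_norm]; exact ENNReal.ofReal_le_ofReal h1
  · exact mul_le_mul_right ((eLpNorm_indicator_le _).trans
      (eLpNorm_meanFlux_sub_le hδ (pow_pos hη 2) u)) _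

end TransportStep

/-! ### Step functions of time. -/

section StepFunctions

variable {h : ℝ}

theorem floor_mul_le (hh : 0 < h) {t : ℝ} (ht : 0 ≤ t) : (⌊t / h⌋₊ : ℝ) * h ≤ t := by
  rw [← le_div_iff₀ hh]; exact Nat.floor_le (by positivity)

theorem floor_add_step (hh : 0 < h) {t : ℝ} (ht : 0 ≤ t) : ⌊(t + h) / h⌋₊ = ⌊t / h⌋₊ + 1 := by
  rw [add_div, div_self hh.ne', Nat.floor_add_one (by positivity)]

theorem stronglyMeasurable_step {X : Type*} [TopologicalSpace X] (a : ℕ → X) (h : ℝ) :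
    StronglyMeasurable fun t : ℝ ↦ a ⌊t / h⌋₊ :=
  (StronglyMeasurable.of_discrete (f := a)).comp_measurable
    (Nat.measurable_floor.comp (measurable_id.div_const h))

/-- At most (t - s)/h + 1 jumps separate s from t; the extra jump is the term h. -/
theorem abs_step_sub_le (hh : 0 < h) {a : ℕ → ℝ} {T K : ℝ}
    (ha : ∀ k : ℕ, k * h ≤ T → |a (k + 1) - a k| ≤ h * K) {s t : ℝ} (hs : 0 ≤ s) (hst : s ≤ t)
    (ht : t ≤ T) : |a ⌊t / h⌋₊ - a ⌊s / h⌋₊| ≤ K * (t - s + h) := by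
  have hK : 0 ≤ K := by
    have := (abs_nonneg _).trans (ha 0 (by simp; linarith))
    exact nonneg_of_mul_nonneg_right this hh
  have hmono : ⌊s / h⌋₊ ≤ ⌊t / h⌋₊ := Nat.floor_le_floor (div_le_div_of_nonneg_right hst hh.le)
  have h1 := dist_le_Ico_sum_of_dist_le (f := a) hmono (d := fun _ ↦ h * K) fun {k} _ hk ↦ by
    rw [dist_comm, Real.dist_eq]
    refine ha k ?_
    have h2 : (k : ℝ) ≤ ⌊t / h⌋₊ := by exact_mod_cast hk.le
    have := floor_mul_le hh (hs.trans hst)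
    nlinarith
  rw [dist_comm, Real.dist_eq, Finset.sum_const, Nat.card_Ico, nsmul_eq_mul,
    Nat.cast_sub hmono] at h1
  refine h1.trans ?_
  have h3 := floor_mul_le hh (hs.trans hst)
  have h4 : s < (⌊s / h⌋₊ + 1 : ℝ) * h := by
    rw [← div_lt_iff₀ hh]; exact Nat.lt_floor_add_one _
  nlinarith

/-- The last interval is counted in full, which matches the sum over `k + 1` terms in
`scheme_energy`. -/
theorem lintegral_step_le (hh : 0 < h) (F : ℕ → ℝ≥0∞) (T : ℝ) :
    ∫⁻ t in Ioc 0 T, F ⌊t / h⌋₊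
      ≤ ∑ j ∈ Finset.range (⌊T / h⌋₊ + 1), ENNReal.ofReal h * F j := by
  have hpt : ∀ t ∈ Ioc 0 T, F ⌊t / h⌋₊ ≤ ∑ j ∈ Finset.range (⌊T / h⌋₊ + 1),
      (Ico (j * h) ((j + 1) * h)).indicator (fun _ ↦ F j) t := by
    intro t ht
    have hmem : ⌊t / h⌋₊ ∈ Finset.range (⌊T / h⌋₊ + 1) :=
      Finset.mem_range.2 (Nat.lt_succ_of_le
        (Nat.floor_le_floor (div_le_div_of_nonneg_right ht.2 hh.le)))
    refine le_trans ?_ (Finset.single_le_sum (f := fun j : ℕ ↦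
      (Ico (j * h) ((j + 1) * h)).indicator (fun _ ↦ F j) t) (fun _ _ ↦ zero_le) hmem)
    have hIco : t ∈ Ico ((⌊t / h⌋₊ : ℝ) * h) ((⌊t / h⌋₊ + 1) * h) :=
      ⟨floor_mul_le hh ht.1.le, by rw [← div_lt_iff₀ hh]; exact Nat.lt_floor_add_one _⟩
    simp only [indicator_of_mem hIco, le_refl]
  calc ∫⁻ t in Ioc 0 T, F ⌊t / h⌋₊
      ≤ ∫⁻ t in Ioc 0 T, ∑ j ∈ Finset.range (⌊T / h⌋₊ + 1),
          (Ico (j * h) ((j + 1) * h)).indicator (fun _ ↦ F j) t :=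
        setLIntegral_mono_ae' measurableSet_Ioc (ae_of_all _ hpt)
    _ ≤ ∫⁻ t, ∑ j ∈ Finset.range (⌊T / h⌋₊ + 1),
          (Ico (j * h) ((j + 1) * h)).indicator (fun _ ↦ F j) t := setLIntegral_le_lintegral _ _
    _ = ∑ j ∈ Finset.range (⌊T / h⌋₊ + 1), ENNReal.ofReal h * F j := by
        rw [lintegral_finsetSum' _ fun j _ ↦
          (measurable_const.indicator measurableSet_Ico).aemeasurable]
        refine Finset.sum_congr rfl fun j _ ↦ ?_
        rw [lintegral_indicator_const measurableSet_Ico, Real.volume_Ico, mul_comm]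
        congr 2; ring

end StepFunctions

/-! ### The buoyancy force as a bounded linear map. -/

section Buoyancy

/-- The vertical field with a given second component. -/
def buoyancy : L2Scalar →L[ℝ] L2Vector :=
  (ContinuousLinearMap.toSpanSingleton ℝ (unitVec 1)).compLpL 2 volume

theorem coeFn_buoyancy (θ : L2Scalar) : buoyancy θ =ᵐ[volume] fun x ↦ θ x • unitVec 1 :=
  ContinuousLinearMap.coeFn_compLpL _ _

theorem norm_buoyancy_le (θ : L2Scalar) : ‖buoyancy θ‖ ≤ ‖θ‖ := by
  refine ((ContinuousLinearMap.toSpanSingleton ℝ (unitVec 1)).norm_compLp_le θ).trans ?_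
  rw [ContinuousLinearMap.norm_toSpanSingleton]
  simp

theorem inner_buoyancy (θ : L2Scalar) {φ : Plane → Plane} (hφ : IsTest φ) :
    (inner ℝ (buoyancy θ) (l2 φ) : ℝ) = ∫ x, θ x * φ x 1 := by
  rw [inner_l2 _ (hφ.memLp 2)]
  refine integral_congr_ae ?_
  filter_upwards [coeFn_buoyancy θ] with x hx
  rw [hx, real_inner_smul_left, EuclideanSpace.inner_single_left]
  simp

end Buoyancy

/-! ### The time stepping scheme and its energy estimate. -/

section Scheme

variable {δ η : ℝ} {v₀ : L2Vector} {θ₀ : L2Scalar}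

/-- The time stepping scheme: explicit transport by the regularized velocity, followed by an
implicit step of the dissipation. -/
def scheme (δ η : ℝ) (v₀ : L2Vector) (θ₀ : L2Scalar) : ℕ → L2Vector × L2Scalar
  -- Applying the resolvent already to the initial velocity makes the dissipation of the first
  -- interval part of the energy estimate.
  | 0 => (resolvent (η ^ 3) v₀, θ₀)
  | k + 1 =>
    (resolvent (η ^ 3) (transport δ η (scheme δ η v₀ θ₀ k).1 (scheme δ η v₀ θ₀ k).1
      + (η ^ 3) • buoyancy (scheme δ η v₀ θ₀ k).2),
    transport δ η (scheme δ η v₀ θ₀ k).1 (scheme δ η v₀ θ₀ k).2)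

theorem isDivFree_scheme (hη : 0 < η) (k : ℕ) : IsDivFree (scheme δ η v₀ θ₀ k).1 := by
  rw [← mem_divFree]
  cases k <;> exact resolvent_mem (by positivity) _

theorem norm_scheme_snd_le (hδ : 0 < δ) (hη : 0 < η) (k : ℕ) :
    ‖(scheme δ η v₀ θ₀ k).2‖ ≤ ‖θ₀‖ := by
  induction k with
  | zero => exact le_rfl
  | succ k ih => exact (norm_transport_le hδ hη (isDivFree_scheme hη k) _).trans ih

theorem eLpNorm_scheme_snd_le (hδ : 0 < δ) (hη : 0 < η) {p : ℝ≥0∞} (hp : 1 ≤ p) (k : ℕ) :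
    eLpNorm (scheme δ η v₀ θ₀ k).2 p volume ≤ eLpNorm θ₀ p volume := by
  induction k with
  | zero => exact le_rfl
  | succ k ih => exact (eLpNorm_transport_le hδ hη (isDivFree_scheme hη k) _ hp).trans ih

/-- The discrete energy estimate. -/
theorem scheme_energy (hδ : 0 < δ) (hη : 0 < η) (k : ℕ) :
    ENNReal.ofReal (‖(scheme δ η v₀ θ₀ k).1‖ ^ 2)
      + ∑ j ∈ Finset.range (k + 1), ENNReal.ofReal (η ^ 3) * hdotHalfSq (scheme δ η v₀ θ₀ j).1
      ≤ ENNReal.ofReal ((‖v₀‖ + k * η ^ 3 * ‖θ₀‖) ^ 2) := by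
  have hh : 0 ≤ η ^ 3 := by positivity
  induction k with
  | zero =>
    simpa [scheme] using resolvent_energy hh v₀
  | succ k ih =>
    set V := (scheme δ η v₀ θ₀ k).1 with hV
    set s := ‖v₀‖ + k * η ^ 3 * ‖θ₀‖ with hs
    have hs0 : 0 ≤ s := by positivity
    set g := transport δ η V V + (η ^ 3) • buoyancy (scheme δ η v₀ θ₀ k).2 with hg
    have hVs : ‖V‖ ≤ s := by
      have := (le_self_add).trans ih
      rw [ENNReal.ofReal_le_ofReal_iff (by positivity)] at this
      exact le_of_sq_le_sq this hs0
    have hgn : ‖g‖ ≤ ‖V‖ + η ^ 3 * ‖θ₀‖ := by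
      refine (norm_add_le _ _).trans (add_le_add
        (norm_transport_le hδ hη (isDivFree_scheme hη k) _) ?_)
      rw [norm_smul, Real.norm_of_nonneg hh]
      exact mul_le_mul_of_nonneg_left ((norm_buoyancy_le _).trans (norm_scheme_snd_le hδ hη k)) hh
    -- ‖V‖² is kept, to be absorbed with the past dissipation by the induction hypothesis; only the
    -- cross term uses ‖V‖ ≤ s. The remaining terms complete the square (s + η³‖θ₀‖)².
    have hgs : ‖g‖ ^ 2 ≤ ‖V‖ ^ 2 + (2 * (η ^ 3 * ‖θ₀‖) * s + (η ^ 3 * ‖θ₀‖) ^ 2) := by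
      have h1 := pow_le_pow_left₀ (norm_nonneg g) hgn 2
      have h2 : (η ^ 3 * ‖θ₀‖) * ‖V‖ ≤ (η ^ 3 * ‖θ₀‖) * s :=
        mul_le_mul_of_nonneg_left hVs (by positivity)
      nlinarith
    have henergy : ENNReal.ofReal (‖(scheme δ η v₀ θ₀ (k + 1)).1‖ ^ 2)
        + ENNReal.ofReal (η ^ 3) * hdotHalfSq (scheme δ η v₀ θ₀ (k + 1)).1
        ≤ ENNReal.ofReal (‖g‖ ^ 2) := resolvent_energy hh g
    rw [Finset.sum_range_succ, add_comm (Finset.sum _ _), ← add_assoc]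
    calc _ ≤ ENNReal.ofReal (‖V‖ ^ 2 + (2 * (η ^ 3 * ‖θ₀‖) * s + (η ^ 3 * ‖θ₀‖) ^ 2))
          + ∑ j ∈ Finset.range (k + 1),
            ENNReal.ofReal (η ^ 3) * hdotHalfSq (scheme δ η v₀ θ₀ j).1 :=
          add_le_add_left (henergy.trans (ENNReal.ofReal_le_ofReal hgs)) _
      _ = (ENNReal.ofReal (‖V‖ ^ 2) + ∑ j ∈ Finset.range (k + 1),
            ENNReal.ofReal (η ^ 3) * hdotHalfSq (scheme δ η v₀ θ₀ j).1)
          + ENNReal.ofReal (2 * (η ^ 3 * ‖θ₀‖) * s + (η ^ 3 * ‖θ₀‖) ^ 2) := by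
          rw [ENNReal.ofReal_add (by positivity) (by positivity)]; ring
      _ ≤ ENNReal.ofReal (s ^ 2)
          + ENNReal.ofReal (2 * (η ^ 3 * ‖θ₀‖) * s + (η ^ 3 * ‖θ₀‖) ^ 2) := add_le_add_left ih _
      _ = _ := by
          rw [← ENNReal.ofReal_add (by positivity) (by positivity), hs]
          congr 1; push_cast; ring

theorem norm_scheme_fst_le (hδ : 0 < δ) (hη : 0 < η) (k : ℕ) :
    ‖(scheme δ η v₀ θ₀ k).1‖ ≤ ‖v₀‖ + k * η ^ 3 * ‖θ₀‖ := by
  have := (le_self_add).trans (scheme_energy (v₀ := v₀) (θ₀ := θ₀) hδ hη k)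
  rw [ENNReal.ofReal_le_ofReal_iff (by positivity)] at this
  exact le_of_sq_le_sq this (by positivity)

/-- Transport and buoyancy are taken at step k and the dissipation at step k + 1; the pressure is
invisible to divergence-free φ. -/
theorem scheme_fst_increment (hδ : 0 < δ) (hη : 0 < η) (k : ℕ) {φ : Plane → Plane}
    (hφ : IsTest φ) (hdiv : ∀ x, divergence φ x = 0) :
    (inner ℝ (scheme δ η v₀ θ₀ (k + 1)).1 (l2 φ) : ℝ) - inner ℝ (scheme δ η v₀ θ₀ k).1 (l2 φ)
      = η ^ 3 * (inner ℝ (scheme δ η v₀ θ₀ k).1 (l2 (generator δ η (scheme δ η v₀ θ₀ k).1 φ))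
        + inner ℝ (buoyancy (scheme δ η v₀ θ₀ k).2) (l2 φ)
        - inner ℝ (scheme δ η v₀ θ₀ (k + 1)).1 (l2 (absDVec φ))) := by
  have h1 := inner_resolvent (h := η ^ 3) (by positivity)
    (transport δ η (scheme δ η v₀ θ₀ k).1 (scheme δ η v₀ θ₀ k).1
      + (η ^ 3) • buoyancy (scheme δ η v₀ θ₀ k).2) hφ hdiv
  rw [inner_add_left, real_inner_smul_left,
    inner_transport hδ hη (isDivFree_scheme hη k) _ (hφ.memLp 2)] at h1
  have h2 : (scheme δ η v₀ θ₀ (k + 1)).1 = resolvent (η ^ 3)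
    (transport δ η (scheme δ η v₀ θ₀ k).1 (scheme δ η v₀ θ₀ k).1
      + (η ^ 3) • buoyancy (scheme δ η v₀ θ₀ k).2) := rfl
  rw [h2]
  linarith

theorem scheme_snd_increment (hδ : 0 < δ) (hη : 0 < η) (k : ℕ) {ψ : Plane → ℝ} (hψ : IsTest ψ) :
    (inner ℝ (scheme δ η v₀ θ₀ (k + 1)).2 (l2 ψ) : ℝ) - inner ℝ (scheme δ η v₀ θ₀ k).2 (l2 ψ)
      = η ^ 3 * inner ℝ (scheme δ η v₀ θ₀ k).2
        (l2 (generator δ η (scheme δ η v₀ θ₀ k).1 ψ)) := by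
  have h1 := inner_transport hδ hη (isDivFree_scheme (δ := δ) (v₀ := v₀) (θ₀ := θ₀) hη k)
    (scheme δ η v₀ θ₀ k).2 (hψ.memLp 2)
  have h2 : (scheme δ η v₀ θ₀ (k + 1)).2
    = transport δ η (scheme δ η v₀ θ₀ k).1 (scheme δ η v₀ θ₀ k).2 := rfl
  rw [h2]
  linarith

end Scheme

/-! ### Approximate solutions and bounds on their increments. -/

section Approximations

variable {δ η : ℝ} {v₀ : L2Vector} {θ₀ : L2Scalar}

/-- The approximate velocity, a step function of time. -/
def velocity (δ η : ℝ) (v₀ : L2Vector) (θ₀ : L2Scalar) (t : ℝ) : L2Vector :=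
  (scheme δ η v₀ θ₀ ⌊t / η ^ 3⌋₊).1

/-- The approximate temperature, a step function of time. -/
def temperature (δ η : ℝ) (v₀ : L2Vector) (θ₀ : L2Scalar) (t : ℝ) : L2Scalar :=
  (scheme δ η v₀ θ₀ ⌊t / η ^ 3⌋₊).2

theorem norm_velocity_le (hδ : 0 < δ) (hη : 0 < η) {t : ℝ} (ht : 0 ≤ t) :
    ‖velocity δ η v₀ θ₀ t‖ ≤ ‖v₀‖ + t * ‖θ₀‖ := by
  refine (norm_scheme_fst_le hδ hη _).trans ?_
  have := mul_le_mul_of_nonneg_right (floor_mul_le (pow_pos hη 3) ht) (norm_nonneg θ₀)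
  linarith

theorem lintegral_hdotHalfSq_velocity_le (hδ : 0 < δ) (hη : 0 < η) {T : ℝ} (hT : 0 ≤ T) :
    ∫⁻ t in Ioc 0 T, hdotHalfSq (velocity δ η v₀ θ₀ t)
      ≤ ENNReal.ofReal ((‖v₀‖ + T * ‖θ₀‖) ^ 2) := by
  refine (lintegral_step_le (pow_pos hη 3) (fun k ↦ hdotHalfSq (scheme δ η v₀ θ₀ k).1) T).trans
    ((le_add_self.trans (scheme_energy hδ hη _)).trans (ENNReal.ofReal_le_ofReal ?_))
  gcongr
  exact floor_mul_le (pow_pos hη 3) hT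

/-- The difference quotient of the velocity, tested with `φ`. -/
theorem velocity_increment (hδ : 0 < δ) (hη : 0 < η) {t : ℝ} (ht : 0 ≤ t) {φ : Plane → Plane}
    (hφ : IsTest φ) (hdiv : ∀ x, divergence φ x = 0) :
    (η ^ 3)⁻¹ * (inner ℝ (velocity δ η v₀ θ₀ (t + η ^ 3) - velocity δ η v₀ θ₀ t) (l2 φ) : ℝ)
      = inner ℝ (velocity δ η v₀ θ₀ t) (l2 (generator δ η (velocity δ η v₀ θ₀ t) φ))
        + inner ℝ (buoyancy (temperature δ η v₀ θ₀ t)) (l2 φ)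
        - inner ℝ (velocity δ η v₀ θ₀ (t + η ^ 3)) (l2 (absDVec φ)) := by
  rw [inner_sub_left]
  unfold velocity temperature
  rw [floor_add_step (pow_pos hη 3) ht, scheme_fst_increment hδ hη _ hφ hdiv,
    inv_mul_cancel_left₀ (by positivity)]

theorem temperature_increment (hδ : 0 < δ) (hη : 0 < η) {t : ℝ} (ht : 0 ≤ t) {ψ : Plane → ℝ}
    (hψ : IsTest ψ) :
    (η ^ 3)⁻¹ * (inner ℝ (temperature δ η v₀ θ₀ (t + η ^ 3) - temperature δ η v₀ θ₀ t) (l2 ψ) : ℝ)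
      = inner ℝ (temperature δ η v₀ θ₀ t) (l2 (generator δ η (velocity δ η v₀ θ₀ t) ψ)) := by
  rw [inner_sub_left]
  unfold velocity temperature
  rw [floor_add_step (pow_pos hη 3) ht, scheme_snd_increment hδ hη _ hψ,
    inv_mul_cancel_left₀ (by positivity)]

theorem norm_temperature_le (hδ : 0 < δ) (hη : 0 < η) (t : ℝ) :
    ‖temperature δ η v₀ θ₀ t‖ ≤ ‖θ₀‖ := norm_scheme_snd_le hδ hη _

theorem isDivFree_velocity (hη : 0 < η) (t : ℝ) : IsDivFree (velocity δ η v₀ θ₀ t) :=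
  isDivFree_scheme hη _

/-- A bound free of δ and η. The implicit term is evaluated at t + η³ ≤ T + 1, whence the T + 1. -/
theorem abs_velocity_increment_le (hδ : 0 < δ) (hη : 0 < η) (hη1 : η ≤ 1) {t T : ℝ} (ht : 0 ≤ t)
    (htT : t ≤ T) {φ : Plane → Plane} {C R : ℝ} (hφ : ControlledTest φ C R)
    (hdiv : ∀ x, divergence φ x = 0) :
    |(η ^ 3)⁻¹ * (inner ℝ (velocity δ η v₀ θ₀ (t + η ^ 3) - velocity δ η v₀ θ₀ t) (l2 φ) : ℝ)|
      ≤ (‖v₀‖ + (T + 1) * ‖θ₀‖) * (C * ballConst (R + 1) + 2 * C * (‖v₀‖ + (T + 1) * ‖θ₀‖)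
        + 4 * (C * ballConst R)) + ‖θ₀‖ * (C * ballConst R) := by
  set M := ‖v₀‖ + (T + 1) * ‖θ₀‖ with hM
  have hC := hφ.nonneg
  have hη3 : η ^ 3 ≤ 1 := pow_le_one₀ hη.le hη1
  have hη3' : 0 < η ^ 3 := pow_pos hη 3
  have hM1 : ∀ s, 0 ≤ s → s ≤ T + 1 → ‖velocity δ η v₀ θ₀ s‖ ≤ M := fun s hs hs' ↦
    (norm_velocity_le hδ hη hs).trans
      (by have := mul_le_mul_of_nonneg_right hs' (norm_nonneg θ₀); linarith)
  have hMt := hM1 t ht (by linarith)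
  have hMt' := hM1 (t + η ^ 3) (by linarith) (by linarith)
  have hM0 : 0 ≤ M := (norm_nonneg _).trans hMt
  rw [velocity_increment hδ hη ht hφ.isTest hdiv]
  have h1 : |(inner ℝ (velocity δ η v₀ θ₀ t) (l2 (generator δ η (velocity δ η v₀ θ₀ t) φ)) : ℝ)|
      ≤ M * (C * ballConst (R + 1) + 2 * C * M) := by
    refine (abs_real_inner_le_norm _ _).trans (mul_le_mul hMt ((norm_l2_generator_le hδ hη hη1
      (isDivFree_velocity hη t) hφ).trans ?_) (norm_nonneg _) hM0)
    have := mul_le_mul_of_nonneg_left hMt hC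
    linarith
  have h2 : |(inner ℝ (buoyancy (temperature δ η v₀ θ₀ t)) (l2 φ) : ℝ)|
      ≤ ‖θ₀‖ * (C * ballConst R) :=
    (abs_real_inner_le_norm _ _).trans (mul_le_mul ((norm_buoyancy_le _).trans
      (norm_temperature_le hδ hη t)) (norm_l2_le hφ.support hφ.bound) (norm_nonneg _)
      (norm_nonneg _))
  have h3 : |(inner ℝ (velocity δ η v₀ θ₀ (t + η ^ 3)) (l2 (absDVec φ)) : ℝ)|
      ≤ M * (4 * (C * ballConst R)) :=
    (abs_real_inner_le_norm _ _).trans (mul_le_mul hMt' (norm_l2_absDVec_le hφ)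
      (norm_nonneg _) hM0)
  rw [abs_le] at *
  constructor <;> linarith [h1.1, h1.2, h2.1, h2.2, h3.1, h3.2]

theorem abs_temperature_increment_le (hδ : 0 < δ) (hη : 0 < η) (hη1 : η ≤ 1) {t T : ℝ}
    (ht : 0 ≤ t) (htT : t ≤ T) {ψ : Plane → ℝ} {C R : ℝ} (hψ : ControlledTest ψ C R) :
    |(η ^ 3)⁻¹ * (inner ℝ (temperature δ η v₀ θ₀ (t + η ^ 3) - temperature δ η v₀ θ₀ t)
      (l2 ψ) : ℝ)| ≤ ‖θ₀‖ * (C * ballConst (R + 1) + 2 * C * (‖v₀‖ + T * ‖θ₀‖)) := by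
  have hC := hψ.nonneg
  rw [temperature_increment hδ hη ht hψ.isTest]
  refine (abs_real_inner_le_norm _ _).trans (mul_le_mul (norm_temperature_le hδ hη t)
    ((norm_l2_generator_le hδ hη hη1 (isDivFree_velocity hη t) hψ).trans ?_) (norm_nonneg _)
    (norm_nonneg _))
  have h1 := (norm_velocity_le (v₀ := v₀) (θ₀ := θ₀) hδ hη ht).trans
    (add_le_add_right (mul_le_mul_of_nonneg_right htT (norm_nonneg θ₀)) _)
  have := mul_le_mul_of_nonneg_left h1 hC
  linarith

theorem stronglyMeasurable_velocity : StronglyMeasurable (velocity δ η v₀ θ₀) :=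
  stronglyMeasurable_step (fun k ↦ (scheme δ η v₀ θ₀ k).1) _

theorem stronglyMeasurable_temperature : StronglyMeasurable (temperature δ η v₀ θ₀) :=
  stronglyMeasurable_step (fun k ↦ (scheme δ η v₀ θ₀ k).2) _

theorem velocity_of_lt (hη : 0 < η) {t : ℝ} (ht : t < η ^ 3) :
    velocity δ η v₀ θ₀ t = resolvent (η ^ 3) v₀ := by
  rw [velocity, Nat.floor_eq_zero.2 ((div_lt_one (pow_pos hη 3)).2 ht)]; rfl

theorem temperature_of_lt (hη : 0 < η) {t : ℝ} (ht : t < η ^ 3) :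
    temperature δ η v₀ θ₀ t = θ₀ := by
  rw [temperature, Nat.floor_eq_zero.2 ((div_lt_one (pow_pos hη 3)).2 ht)]; rfl

/-- Increments of bounded speed over the time steps give asymptotic equicontinuity. -/
theorem abs_step_function_sub_le {H : Type*} [NormedAddCommGroup H] [InnerProductSpace ℝ H]
    {h : ℝ} (hh : 0 < h) (a : ℕ → H) (b : H) {T K : ℝ}
    (ha : ∀ t, 0 ≤ t → t ≤ T →
      |h⁻¹ * (inner ℝ (a ⌊(t + h) / h⌋₊ - a ⌊t / h⌋₊) b : ℝ)| ≤ K) {s t : ℝ} (hs : 0 ≤ s)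
    (hst : s ≤ t) (ht : t ≤ T) :
    |(inner ℝ (a ⌊t / h⌋₊) b : ℝ) - inner ℝ (a ⌊s / h⌋₊) b| ≤ K * (t - s + h) := by
  refine abs_step_sub_le hh (a := fun k ↦ (inner ℝ (a k) b : ℝ)) (fun k hk ↦ ?_) hs hst ht
  have h1 := ha (k * h) (by positivity) hk
  rw [floor_add_step hh (by positivity), mul_div_cancel_right₀ _ hh.ne', Nat.floor_natCast,
    abs_mul, abs_of_pos (inv_pos.2 hh), inv_mul_le_iff₀ hh, inner_sub_left] at h1
  exact h1

end Approximations

/-! ### Choice of the parameters. -/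

section Parameters

/-- Parameters for which every bounded field is eventually slow. -/
theorem exists_parameters : ∃ δ η : ℕ → ℝ, (∀ n, 0 < δ n) ∧ (∀ n, 0 < η n) ∧ (∀ n, η n ≤ 1) ∧
    Tendsto δ atTop (𝓝 0) ∧ Tendsto η atTop (𝓝 0) ∧
    ∀ (n : ℕ) (u : L2Vector), ‖u‖ ≤ (n + 1) / 2 → IsSlow (δ n) (η n ^ 2) (η n) u := by
  have hpos : ∀ n : ℕ, (0 : ℝ) < 1 / (n + 1) := fun n ↦ by positivity
  choose A hA0 hA using fun n : ℕ ↦ exists_flux_le (hpos n)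
  have hη : ∀ n : ℕ, 1 / ((n + 1) * (1 + A n)) ≤ 1 / ((n : ℝ) + 1) := fun n ↦ by
    have := hA0 n
    refine one_div_le_one_div_of_le (by positivity) ?_
    nlinarith [Nat.cast_nonneg (α := ℝ) n]
  have hη0 : ∀ n : ℕ, 0 < 1 / (((n : ℝ) + 1) * (1 + A n)) := fun n ↦ by
    have := hA0 n
    positivity
  have hη1 : ∀ n : ℕ, 1 / (((n : ℝ) + 1) * (1 + A n)) ≤ 1 := fun n ↦ (hη n).trans (by
    rw [div_le_one (by positivity)]; linarith [Nat.cast_nonneg (α := ℝ) n])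
  -- η is taken small relative to the flux constant A at scale δ = 1/(n + 1), so that η A ‖u‖ ≤ 1/2
  -- for norms up to (n + 1)/2.
  refine ⟨fun n ↦ 1 / (n + 1), fun n ↦ 1 / ((n + 1) * (1 + A n)), hpos, hη0, hη1,
    tendsto_one_div_add_atTop_nhds_zero_nat,
    squeeze_zero (fun n ↦ (hη0 n).le) hη tendsto_one_div_add_atTop_nhds_zero_nat,
    fun n u hu i x ↦ ?_⟩
  have h1 := hA n ((1 / (((n : ℝ) + 1) * (1 + A n))) ^ 2) (pow_pos (hη0 n) 2)
    (pow_le_one₀ (hη0 n).le (hη1 n)) u i x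
  have h2 := hA0 n
  calc _ ≤ 1 / (((n : ℝ) + 1) * (1 + A n)) * ((1 + A n) * ((n + 1) / 2)) := by
        refine mul_le_mul_of_nonneg_left (h1.trans ?_) (hη0 n).le
        exact mul_le_mul (by linarith) hu (norm_nonneg _) (by positivity)
    _ = 1 / 2 := by field_simp

end Parameters

instance separableSpace_l2 {E : Type*} [NormedAddCommGroup E] [SecondCountableTopology E] :
    TopologicalSpace.SeparableSpace (Lp E 2 (volume : Measure Plane)) := by
  have : Fact ((2 : ℝ≥0∞) ≠ ⊤) := ⟨by norm_num⟩
  infer_instance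

/-- `(v, θ)` is the limit, weakly in `L²` at every time, of approximations with vanishing
parameters. -/
structure IsLimit (δ η : ℕ → ℝ) (v₀ : L2Vector) (θ₀ : L2Scalar) (v : ℝ → L2Vector)
    (θ : ℝ → L2Scalar) : Prop where
  δ_pos : ∀ n, 0 < δ n
  η_pos : ∀ n, 0 < η n
  η_le_one : ∀ n, η n ≤ 1
  tendsto_δ : Tendsto δ atTop (𝓝 0)
  tendsto_η : Tendsto η atTop (𝓝 0)
  isSlow : ∀ M : ℝ, ∀ᶠ n in atTop, ∀ u : L2Vector, ‖u‖ ≤ M → IsSlow (δ n) (η n ^ 2) (η n) u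
  velocity_of_neg : ∀ t < 0, v t = 0
  temperature_of_neg : ∀ t < 0, θ t = 0
  tendsto_velocity : ∀ t, 0 ≤ t → ∀ φ, Tendsto (fun n ↦ inner ℝ (velocity (δ n) (η n) v₀ θ₀ t) φ)
    atTop (𝓝 (inner ℝ (v t) φ))
  tendsto_temperature : ∀ t, 0 ≤ t → ∀ φ, Tendsto
    (fun n ↦ inner ℝ (temperature (δ n) (η n) v₀ θ₀ t) φ) atTop (𝓝 (inner ℝ (θ t) φ))

/-! ### Equicontinuity in time and extraction of a limit. -/

section Existence

variable {v₀ : L2Vector} {θ₀ : L2Scalar}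

/-- Against gradients the pairing vanishes identically; against divergence-free fields the
increments have bounded speed. No bound on the pressure is required. -/
theorem velocity_equicontinuous {δ η : ℕ → ℝ} (hδ : ∀ n, 0 < δ n) (hη : ∀ n, 0 < η n)
    (hη1 : ∀ n, η n ≤ 1) {φ : L2Vector} (hφ : φ ∈ testFields) (T : ℝ) :
    ∃ K : ℝ, ∀ n s t, 0 ≤ s → s ≤ t → t ≤ T →
      |(inner ℝ (velocity (δ n) (η n) v₀ θ₀ t) φ : ℝ) - inner ℝ (velocity (δ n) (η n) v₀ θ₀ s) φ|
        ≤ K * (t - s + η n ^ 3) := by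
  rcases hφ with ⟨ψ, hψ, rfl⟩ | ⟨φ, hφ, hdiv, rfl⟩
  · refine ⟨0, fun n s t _ _ _ ↦ ?_⟩
    rw [inner_l2_grad _ hψ, inner_l2_grad _ hψ, isDivFree_velocity (hη n) t ψ hψ,
      isDivFree_velocity (hη n) s ψ hψ]
    simp
  · obtain ⟨C, R, hR, hc⟩ := hφ.exists_controlled
    exact ⟨_, fun n s t hs hst ht ↦ abs_step_function_sub_le (pow_pos (hη n) 3)
      (fun k ↦ (scheme (δ n) (η n) v₀ θ₀ k).1) (l2 φ) (T := T)
      (fun r hr hrT ↦ abs_velocity_increment_le (hδ n) (hη n) (hη1 n) hr hrT hc hdiv) hs hst ht⟩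

theorem temperature_equicontinuous {δ η : ℕ → ℝ} (hδ : ∀ n, 0 < δ n) (hη : ∀ n, 0 < η n)
    (hη1 : ∀ n, η n ≤ 1) {ψ : Plane → ℝ} (hψ : IsTest ψ) (T : ℝ) :
    ∃ K : ℝ, ∀ n s t, 0 ≤ s → s ≤ t → t ≤ T →
      |(inner ℝ (temperature (δ n) (η n) v₀ θ₀ t) (l2 ψ) : ℝ)
        - inner ℝ (temperature (δ n) (η n) v₀ θ₀ s) (l2 ψ)| ≤ K * (t - s + η n ^ 3) := by
  obtain ⟨C, R, hR, hc⟩ := hψ.exists_controlled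
  exact ⟨_, fun n s t hs hst ht ↦ abs_step_function_sub_le (pow_pos (hη n) 3)
    (fun k ↦ (scheme (δ n) (η n) v₀ θ₀ k).2) (l2 ψ) (T := T)
    (fun r hr hrT ↦ abs_temperature_increment_le (hδ n) (hη n) (hη1 n) hr hrT hc) hs hst ht⟩

theorem tendsto_pow_three {η : ℕ → ℝ} (h : Tendsto η atTop (𝓝 0)) :
    Tendsto (fun n ↦ η n ^ 3) atTop (𝓝 0) := by
  simpa using h.pow 3

theorem exists_isLimit (v₀ : L2Vector) (θ₀ : L2Scalar) : ∃ δ η v θ, IsLimit δ η v₀ θ₀ v θ := by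
  obtain ⟨δ, η, hδ, hη, hη1, hδ0, hη0, hslow⟩ := exists_parameters
  obtain ⟨a, v, ha, hvneg, hv⟩ := exists_subseq_weak_limit
    (u := fun n ↦ velocity (δ n) (η n) v₀ θ₀) (fun n t ht ↦ norm_velocity_le (hδ n) (hη n) ht)
    span_testFields_dense fun φ hφ T ↦ by
      obtain ⟨K, hK⟩ := velocity_equicontinuous (v₀ := v₀) (θ₀ := θ₀) hδ hη hη1 hφ T
      exact ⟨K, _, tendsto_pow_three hη0, Eventually.of_forall hK⟩
  obtain ⟨b, θ, hb, hθneg, hθ⟩ := exists_subseq_weak_limit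
    (u := fun n ↦ temperature (δ (a n)) (η (a n)) v₀ θ₀)
    (fun n t _ ↦ norm_temperature_le (hδ (a n)) (hη (a n)) t) span_scalar_tests_dense
    fun φ hφ T ↦ by
      obtain ⟨ψ, hψ, rfl⟩ := hφ
      obtain ⟨K, hK⟩ := temperature_equicontinuous (v₀ := v₀) (θ₀ := θ₀)
        (fun n ↦ hδ (a n)) (fun n ↦ hη (a n)) (fun n ↦ hη1 (a n)) hψ T
      exact ⟨K, _, tendsto_pow_three (hη0.comp ha.tendsto_atTop), Eventually.of_forall hK⟩
  have hab := ha.tendsto_atTop.comp hb.tendsto_atTop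
  refine ⟨fun n ↦ δ (a (b n)), fun n ↦ η (a (b n)), v, θ, fun n ↦ hδ _, fun n ↦ hη _,
    fun n ↦ hη1 _, hδ0.comp hab, hη0.comp hab, fun M ↦ ?_, hvneg, hθneg,
    fun t ht φ ↦ (hv t ht φ).comp hb.tendsto_atTop, hθ⟩
  have h1 : Tendsto (fun n : ℕ ↦ ((a (b n) : ℝ) + 1) / 2) atTop atTop :=
    ((tendsto_natCast_atTop_atTop.comp hab).atTop_add tendsto_const_nhds).atTop_div_const two_pos
  filter_upwards [h1.eventually_ge_atTop M] with n hn u hu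
  exact hslow _ u (hu.trans hn)

end Existence

/-! ### Bounds and measurability of the limit. -/

section LimitProperties

variable {v₀ : L2Vector} {θ₀ : L2Scalar} {δ η : ℕ → ℝ} {v : ℝ → L2Vector} {θ : ℝ → L2Scalar}

theorem IsLimit.comp (h : IsLimit δ η v₀ θ₀ v θ) {ns : ℕ → ℕ} (hns : Tendsto ns atTop atTop) :
    IsLimit (fun n ↦ δ (ns n)) (fun n ↦ η (ns n)) v₀ θ₀ v θ where
  δ_pos _ := h.δ_pos _
  η_pos _ := h.η_pos _
  η_le_one _ := h.η_le_one _
  tendsto_δ := h.tendsto_δ.comp hns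
  tendsto_η := h.tendsto_η.comp hns
  isSlow M := hns.eventually (h.isSlow M)
  velocity_of_neg := h.velocity_of_neg
  temperature_of_neg := h.temperature_of_neg
  tendsto_velocity t ht φ := (h.tendsto_velocity t ht φ).comp hns
  tendsto_temperature t ht φ := (h.tendsto_temperature t ht φ).comp hns

theorem IsLimit.norm_velocity_le (h : IsLimit δ η v₀ θ₀ v θ) {t : ℝ} (ht : 0 ≤ t) :
    ‖v t‖ ≤ ‖v₀‖ + t * ‖θ₀‖ :=
  norm_le_of_weak_limit (Eventually.of_forall fun n ↦
    Boussinesq.norm_velocity_le (h.δ_pos n) (h.η_pos n) ht) (h.tendsto_velocity t ht _)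

theorem IsLimit.norm_temperature_le (h : IsLimit δ η v₀ θ₀ v θ) {t : ℝ} (ht : 0 ≤ t) :
    ‖θ t‖ ≤ ‖θ₀‖ :=
  norm_le_of_weak_limit (Eventually.of_forall fun n ↦
    Boussinesq.norm_temperature_le (h.δ_pos n) (h.η_pos n) t) (h.tendsto_temperature t ht _)

theorem measurable_of_tendsto_of_nonneg {f : ℕ → ℝ → ℝ} {g : ℝ → ℝ} (hf : ∀ n, Measurable (f n))
    (hg : ∀ t < 0, g t = 0) (h : ∀ t, 0 ≤ t → Tendsto (fun n ↦ f n t) atTop (𝓝 (g t))) :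
    Measurable g := by
  refine measurable_of_tendsto_metrizable (f := fun n ↦ (Ici (0 : ℝ)).indicator (f n))
    (fun n ↦ (hf n).indicator measurableSet_Ici) (tendsto_pi_nhds.2 fun t ↦ ?_)
  by_cases ht : 0 ≤ t
  · simpa only [indicator_of_mem (mem_Ici.2 ht)] using h t ht
  · rw [not_le] at ht
    have : t ∉ Ici (0 : ℝ) := fun h ↦ not_le.2 ht h
    simp only [indicator_of_notMem this, hg t ht, tendsto_const_nhds]

theorem IsLimit.stronglyMeasurable_velocity (h : IsLimit δ η v₀ θ₀ v θ) : StronglyMeasurable v :=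
  stronglyMeasurable_of_inner fun φ ↦ measurable_of_tendsto_of_nonneg
    (fun _ ↦ (Boussinesq.stronglyMeasurable_velocity.inner stronglyMeasurable_const).measurable)
    (fun t ht ↦ by rw [h.velocity_of_neg t ht, inner_zero_left])
    fun t ht ↦ h.tendsto_velocity t ht φ

theorem IsLimit.stronglyMeasurable_temperature (h : IsLimit δ η v₀ θ₀ v θ) :
    StronglyMeasurable θ :=
  stronglyMeasurable_of_inner fun φ ↦ measurable_of_tendsto_of_nonneg
    (fun _ ↦ (Boussinesq.stronglyMeasurable_temperature.inner stronglyMeasurable_const).measurable)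
    (fun t ht ↦ by rw [h.temperature_of_neg t ht, inner_zero_left])
    fun t ht ↦ h.tendsto_temperature t ht φ

theorem IsLimit.isDivFree (h : IsLimit δ η v₀ θ₀ v θ) {t : ℝ} (ht : 0 ≤ t) :
    IsDivFree (v t) := by
  intro ψ hψ
  rw [← inner_l2_grad _ hψ]
  refine tendsto_nhds_unique (h.tendsto_velocity t ht (l2 (grad ψ))) ?_
  have : ∀ n, (inner ℝ (velocity (δ n) (η n) v₀ θ₀ t) (l2 (grad ψ)) : ℝ) = 0 := fun n ↦ by
    rw [inner_l2_grad _ hψ, isDivFree_velocity (h.η_pos n) t ψ hψ]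
  simp only [this, tendsto_const_nhds]

theorem lowerSemicontinuous_hdotHalfSq : LowerSemicontinuous hdotHalfSq := by
  rw [lowerSemicontinuous_iff_isClosed_preimage]
  exact fun M ↦ IsSeqClosed.isClosed fun u a hu ha ↦ hdotHalfSq_le_of_tendsto ha hu

theorem measurable_hdotHalfSq {w : ℝ → L2Vector} (hw : StronglyMeasurable w) :
    Measurable fun t ↦ hdotHalfSq (w t) := by
  borelize L2Vector
  exact lowerSemicontinuous_hdotHalfSq.measurable.comp hw.measurable

/-- For any M above the liminf the approximations are frequently in the sublevel set of M, which is
weakly closed. -/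
theorem IsLimit.hdotHalfSq_le_liminf (h : IsLimit δ η v₀ θ₀ v θ) {t : ℝ} (ht : 0 ≤ t) :
    hdotHalfSq (v t) ≤ liminf (fun n ↦ hdotHalfSq (velocity (δ n) (η n) v₀ θ₀ t)) atTop := by
  refine le_of_forall_gt_imp_ge_of_dense fun M hM ↦ ?_
  exact hdotHalfSq_le_of_weak_limit ((frequently_lt_of_liminf_lt (by isBoundedDefault) hM).mono
    fun _ hn ↦ hn.le) (h.tendsto_velocity t ht)

theorem IsLimit.lintegral_hdotHalfSq_le (h : IsLimit δ η v₀ θ₀ v θ) {T : ℝ} (hT : 0 ≤ T) :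
    ∫⁻ t in Ioc 0 T, hdotHalfSq (v t) ≤ ENNReal.ofReal ((‖v₀‖ + T * ‖θ₀‖) ^ 2) := by
  calc ∫⁻ t in Ioc 0 T, hdotHalfSq (v t)
      ≤ ∫⁻ t in Ioc 0 T, liminf (fun n ↦ hdotHalfSq (velocity (δ n) (η n) v₀ θ₀ t)) atTop :=
        setLIntegral_mono_ae' measurableSet_Ioc
          (ae_of_all _ fun t ht ↦ h.hdotHalfSq_le_liminf ht.1.le)
    _ ≤ liminf (fun n ↦ ∫⁻ t in Ioc 0 T, hdotHalfSq (velocity (δ n) (η n) v₀ θ₀ t)) atTop :=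
        lintegral_liminf_le fun n ↦ measurable_hdotHalfSq Boussinesq.stronglyMeasurable_velocity
    _ ≤ ENNReal.ofReal ((‖v₀‖ + T * ‖θ₀‖) ^ 2) :=
        liminf_le_of_frequently_le' (Frequently.of_forall fun n ↦
          lintegral_hdotHalfSq_velocity_le (h.δ_pos n) (h.η_pos n) hT)

/-- Weak convergence at the shifted times of the implicit terms. -/
theorem IsLimit.tendsto_velocity_shift (h : IsLimit δ η v₀ θ₀ v θ) {t : ℝ} (ht : 0 ≤ t)
    (φ : L2Vector) : Tendsto (fun n ↦ (inner ℝ (velocity (δ n) (η n) v₀ θ₀ (t + η n ^ 3)) φ : ℝ))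
      atTop (𝓝 (inner ℝ (v t) φ)) := by
  have hη3 : ∀ n, 0 ≤ η n ^ 3 := fun n ↦ (pow_pos (h.η_pos n) 3).le
  have hη31 : ∀ n, η n ^ 3 ≤ 1 := fun n ↦ pow_le_one₀ (h.η_pos n).le (h.η_le_one n)
  have hbound : ∀ n, ‖velocity (δ n) (η n) v₀ θ₀ (t + η n ^ 3)‖ ≤ ‖v₀‖ + (t + 1) * ‖θ₀‖ :=
    fun n ↦ (Boussinesq.norm_velocity_le (h.δ_pos n) (h.η_pos n)
      (by linarith [hη3 n])).trans (by
        have := mul_le_mul_of_nonneg_right (hη31 n) (norm_nonneg θ₀); linarith)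
  have htest : ∀ φ ∈ testFields, Tendsto (fun n ↦
      (inner ℝ (velocity (δ n) (η n) v₀ θ₀ (t + η n ^ 3)) φ : ℝ)) atTop (𝓝 (inner ℝ (v t) φ)) := by
    intro φ hφ
    obtain ⟨K, hK⟩ := velocity_equicontinuous (v₀ := v₀) (θ₀ := θ₀) h.δ_pos h.η_pos h.η_le_one
      hφ (t + 1)
    have h0 : Tendsto (fun n ↦ K * (t + η n ^ 3 - t + η n ^ 3)) atTop (𝓝 0) := by
      have := ((tendsto_pow_three h.tendsto_η).add (tendsto_pow_three h.tendsto_η)).const_mul K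
      simpa using this
    have h1 : Tendsto (fun n ↦ (inner ℝ (velocity (δ n) (η n) v₀ θ₀ (t + η n ^ 3)) φ : ℝ)
        - inner ℝ (velocity (δ n) (η n) v₀ θ₀ t) φ) atTop (𝓝 0) :=
      squeeze_zero_norm (fun n ↦ hK n t (t + η n ^ 3) ht (by linarith [hη3 n])
        (by linarith [hη31 n])) h0
    simpa using h1.add (h.tendsto_velocity t ht φ)
  -- Convergence must be extended from test fields to all of L², since it is applied to |D|φ, which
  -- need not be a test field.
  have hdense : φ ∈ (Submodule.span ℝ testFields).topologicalClosure := by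
    rw [span_testFields_dense]; trivial
  rw [← SetLike.mem_coe, Submodule.topologicalClosure_coe] at hdense
  have hspan : ∀ φ ∈ Submodule.span ℝ testFields, Tendsto (fun n ↦
      (inner ℝ (velocity (δ n) (η n) v₀ θ₀ (t + η n ^ 3)) φ : ℝ)) atTop
        (𝓝 (inner ℝ (v t) φ)) := by
    intro φ hφ
    induction hφ using Submodule.span_induction with
    | mem x hx => exact htest x hx
    | zero => simp
    | add x y _ _ hx hy => simpa only [inner_add_right] using hx.add hy
    | smul c x _ hx => simpa only [inner_smul_right] using hx.const_mul c
  have hcauchy := cauchySeq_inner_of_dense hbound span_testFields_dense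
    (fun φ hφ ↦ (htest φ hφ).cauchySeq)
  obtain ⟨a, ha⟩ := exists_weak_limit hbound hcauchy
  have heq : ∀ φ ∈ Submodule.span ℝ testFields, (inner ℝ a φ : ℝ) = inner ℝ (v t) φ :=
    fun φ hφ ↦ tendsto_nhds_unique (ha φ) (hspan φ hφ)
  have hφ := closure_minimal (s := (Submodule.span ℝ testFields : Set L2Vector))
    (t := {φ | (inner ℝ a φ : ℝ) = inner ℝ (v t) φ}) heq
    (isClosed_eq (by fun_prop) (by fun_prop)) hdense
  have := ha φ
  rwa [hφ] at this

end LimitProperties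

/-! ### Local L² distances and regularized distances. -/

section LocalNorm

/-- The `L²` norm of a field on the ball of radius `R`. -/
def localNorm (R : ℝ) (u : L2Vector) : ℝ≥0∞ :=
  eLpNorm u 2 (volume.restrict (Metric.closedBall 0 R))

theorem continuous_localNorm (R : ℝ) : Continuous (localNorm R) := by
  have h : localNorm R = fun u ↦
      ‖LpToLpRestrictCLM Plane Plane ℝ volume 2 (Metric.closedBall 0 R) u‖ₑ := funext fun u ↦ by
    rw [Lp.enorm_def, localNorm]
    exact (eLpNorm_congr_ae (LpToLpRestrictCLM_coeFn ℝ (Metric.closedBall 0 R) u)).symm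
  rw [h]
  exact (ContinuousLinearMap.continuous _).enorm

theorem localNorm_sq (R : ℝ) (u : L2Vector) :
    localNorm R u ^ 2 = ∫⁻ x in Metric.closedBall 0 R, ‖u x‖ₑ ^ 2 := by
  have := eLpNorm_nnreal_pow_eq_lintegral (f := u)
    (μ := (volume : Measure Plane).restrict (Metric.closedBall 0 R)) (p := 2) (by norm_num)
  rw [localNorm]
  simpa only [NNReal.coe_ofNat, ENNReal.rpow_ofNat, ENNReal.coe_ofNat] using this

theorem localNorm_le (R : ℝ) (u : L2Vector) : localNorm R u ≤ ‖u‖ₑ := by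
  rw [Lp.enorm_def]; exact eLpNorm_restrict_le _ _ _ _

theorem enorm_sq_eq_sum (z : Plane) : ‖z‖ₑ ^ 2 = ∑ i, ‖z i‖ₑ ^ 2 := by
  rw [← ofReal_norm_sq, EuclideanSpace.norm_sq_eq,
    ENNReal.ofReal_sum_of_nonneg fun i _ ↦ sq_nonneg _]
  exact Finset.sum_congr rfl fun i _ ↦ ofReal_norm_sq _

theorem enorm_sq_add_three_le (a b c : ℝ) :
    ‖a + b + c‖ₑ ^ 2 ≤ 3 * (‖a‖ₑ ^ 2 + ‖b‖ₑ ^ 2 + ‖c‖ₑ ^ 2) := by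
  simp only [← ofReal_norm_sq, Real.norm_eq_abs, sq_abs]
  rw [← ENNReal.ofReal_add (by positivity) (by positivity),
    ← ENNReal.ofReal_add (by positivity) (by positivity),
    show (3 : ℝ≥0∞) = ENNReal.ofReal 3 by simp, ← ENNReal.ofReal_mul (by norm_num)]
  refine ENNReal.ofReal_le_ofReal ?_
  nlinarith [sq_nonneg (a - b), sq_nonneg (b - c), sq_nonneg (a - c)]

/-- The difference of the fluxes of two fields on a ball. -/
def fluxDistSq (ρ R : ℝ) (u w : L2Vector) : ℝ≥0∞ :=
  ∑ i, ∫⁻ x in Metric.closedBall 0 R, ‖flux ρ ρ u i x - flux ρ ρ w i x‖ₑ ^ 2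

/-- Local distances of fractionally regular fields are controlled by their regularizations. -/
theorem localNorm_sub_sq_le {ρ : ℝ} (hρ : 0 < ρ) (R : ℝ) (u w : L2Vector) :
    localNorm R (u - w) ^ 2 ≤ 3 * fluxDistSq ρ R u w
      + 6 * ENNReal.ofReal (8 * ρ) * (hdotHalfSq u + hdotHalfSq w) := by
  set B := Metric.closedBall (0 : Plane) R with hB
  have hc : ∀ (u : L2Vector) i, ∫⁻ x in B, ‖flux ρ ρ u i x - u x i‖ₑ ^ 2
      ≤ ENNReal.ofReal (8 * ρ) * hdotHalfSq u := fun u i ↦ by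
    refine (setLIntegral_le_lintegral _ _).trans ?_
    have := lintegral_flux_sub_le hρ hρ u i 0
    simp only [sub_zero, norm_zero, add_zero] at this
    rwa [show 2 * (2 * (ρ + ρ)) = 8 * ρ by ring] at this
  have hm : ∀ (u : L2Vector) i, Measurable fun x ↦ ‖flux ρ ρ u i x - u x i‖ₑ ^ 2 := fun u i ↦
    ((continuous_flux hρ hρ u i).measurable.sub (measurable_component u i)).enorm.pow_const 2
  have hm' : ∀ i, Measurable fun x ↦ ‖flux ρ ρ u i x - flux ρ ρ w i x‖ₑ ^ 2 := fun i ↦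
    ((continuous_flux hρ hρ u i).measurable.sub
      (continuous_flux hρ hρ w i).measurable).enorm.pow_const 2
  have hsum : ∀ i, Measurable fun x ↦ ‖flux ρ ρ u i x - flux ρ ρ w i x‖ₑ ^ 2
      + ‖flux ρ ρ u i x - u x i‖ₑ ^ 2 + ‖flux ρ ρ w i x - w x i‖ₑ ^ 2 := fun i ↦
    ((hm' i).add (hm u i)).add (hm w i)
  rw [localNorm_sq]
  calc ∫⁻ x in B, ‖(u - w : L2Vector) x‖ₑ ^ 2
      ≤ ∫⁻ x in B, ∑ i, 3 * (‖flux ρ ρ u i x - flux ρ ρ w i x‖ₑ ^ 2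
          + ‖flux ρ ρ u i x - u x i‖ₑ ^ 2 + ‖flux ρ ρ w i x - w x i‖ₑ ^ 2) := by
        refine lintegral_mono_ae (ae_restrict_of_ae ?_)
        filter_upwards [Lp.coeFn_sub u w] with x hx
        rw [hx, enorm_sq_eq_sum]
        refine Finset.sum_le_sum fun i _ ↦ ?_
        -- Three-term splitting through the fluxes of u and w. The factor 3 comes from squaring a
        -- three-term sum and becomes 6 over the two components; 8ρ is the constant of
        -- `lintegral_flux_sub_le` at scales δ = ε = ρ.
        have h1 := enorm_sq_add_three_le (flux ρ ρ u i x - flux ρ ρ w i x)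
          (-(flux ρ ρ u i x - u x i)) (flux ρ ρ w i x - w x i)
        rw [enorm_neg] at h1
        refine le_trans (le_of_eq ?_) h1
        congr 2
        simp only [Pi.sub_apply, PiLp.sub_apply]
        ring
    _ = ∑ i, 3 * ((∫⁻ x in B, ‖flux ρ ρ u i x - flux ρ ρ w i x‖ₑ ^ 2)
          + (∫⁻ x in B, ‖flux ρ ρ u i x - u x i‖ₑ ^ 2)
          + ∫⁻ x in B, ‖flux ρ ρ w i x - w x i‖ₑ ^ 2) := by
        rw [lintegral_finsetSum' _ fun i _ ↦ ((hsum i).const_mul 3).aemeasurable]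
        refine Finset.sum_congr rfl fun i _ ↦ ?_
        rw [lintegral_const_mul _ (hsum i),
          lintegral_add_right _ (hm w i), lintegral_add_right _ (hm u i)]
    _ ≤ ∑ i, 3 * ((∫⁻ x in B, ‖flux ρ ρ u i x - flux ρ ρ w i x‖ₑ ^ 2)
          + ENNReal.ofReal (8 * ρ) * hdotHalfSq u + ENNReal.ofReal (8 * ρ) * hdotHalfSq w) := by
        gcongr
        · exact hc u _
        · exact hc w _
    _ = _ := by
        rw [fluxDistSq, Fin.sum_univ_two, Fin.sum_univ_two]
        ring

end LocalNorm

/-! ### Strong convergence of the velocities on bounded sets. -/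

section StrongConvergence

variable {v₀ : L2Vector} {θ₀ : L2Scalar} {δ η : ℕ → ℝ} {v : ℝ → L2Vector} {θ : ℝ → L2Scalar}

/-- At a fixed scale each flux value is a pairing with a fixed field, so weak convergence is
pointwise convergence; uniform boundedness on the ball gives domination. -/
theorem tendsto_fluxDistSq {ρ : ℝ} (hρ : 0 < ρ) (R : ℝ) {u : ℕ → L2Vector} {w : L2Vector} {M : ℝ}
    (hM : ∀ n, ‖u n‖ ≤ M)
    (hw : ∀ φ : L2Vector, Tendsto (fun n ↦ inner ℝ (u n) φ) atTop (𝓝 (inner ℝ w φ))) :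
    Tendsto (fun n ↦ fluxDistSq ρ R (u n) w) atTop (𝓝 0) := by
  have hwM : ‖w‖ ≤ M := norm_le_of_weak_limit (Eventually.of_forall hM) (hw w)
  rw [show (0 : ℝ≥0∞) = ∑ _i : Fin 2, ∫⁻ _ in Metric.closedBall (0 : Plane) R, 0 by simp]
  refine tendsto_finsetSum _ fun i _ ↦ ?_
  set A := ‖l2 (fluxField ρ ρ i 0)‖ with hA
  refine tendsto_lintegral_of_dominated_convergence
    (bound := fun _ ↦ ENNReal.ofReal ((2 * (M * A)) ^ 2)) (fun n ↦ ?_) (fun n ↦ ?_) ?_ ?_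
  · exact ((continuous_flux hρ hρ (u n) i).measurable.sub
      (continuous_flux hρ hρ w i).measurable).enorm.pow_const 2
  · refine ae_of_all _ fun x ↦ ?_
    beta_reduce
    rw [← ofReal_norm_sq]
    refine ENNReal.ofReal_le_ofReal (pow_le_pow_left₀ (norm_nonneg _) ?_ 2)
    have h1 := (abs_flux_le hρ hρ (u n) i x).trans
      (mul_le_mul_of_nonneg_right (hM n) (norm_nonneg _))
    have h2 := (abs_flux_le hρ hρ w i x).trans (mul_le_mul_of_nonneg_right hwM (norm_nonneg _))
    have h3 := norm_sub_le (flux ρ ρ (u n) i x) (flux ρ ρ w i x)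
    simp only [Real.norm_eq_abs] at h3 ⊢
    linarith
  · rw [lintegral_const, Measure.restrict_apply_univ]
    exact (ENNReal.mul_lt_top ENNReal.ofReal_lt_top
      (isCompact_closedBall _ _).measure_lt_top).ne
  · refine ae_of_all _ fun x ↦ ?_
    have h1 : Tendsto (fun n ↦ flux ρ ρ (u n) i x - flux ρ ρ w i x) atTop (𝓝 0) := by
      simp only [flux_eq_inner hρ hρ]
      have := (hw (l2 (fluxField ρ ρ i x))).sub_const (inner ℝ w (l2 (fluxField ρ ρ i x)))
      rwa [sub_self] at this
    have h2 := ((ENNReal.continuous_pow 2).tendsto _).comp (h1.enorm)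
    simpa using! h2

/-- The approximate velocities converge strongly on bounded sets of space and time. -/
theorem IsLimit.tendsto_lintegral_localNorm (h : IsLimit δ η v₀ θ₀ v θ) (R : ℝ) {T : ℝ}
    (hT : 0 ≤ T) : Tendsto (fun n ↦ ∫⁻ t in Ioc 0 T,
      localNorm R (velocity (δ n) (η n) v₀ θ₀ t - v t) ^ 2) atTop (𝓝 0) := by
  set V : ℕ → ℝ → L2Vector := fun n ↦ velocity (δ n) (η n) v₀ θ₀ with hV
  set S := ENNReal.ofReal ((‖v₀‖ + T * ‖θ₀‖) ^ 2) with hS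
  set M := ‖v₀‖ + T * ‖θ₀‖ with hM
  have hVM : ∀ n t, 0 ≤ t → t ≤ T → ‖V n t‖ ≤ M := fun n t ht htT ↦
    (Boussinesq.norm_velocity_le (h.δ_pos n) (h.η_pos n) ht).trans
      (add_le_add_right (mul_le_mul_of_nonneg_right htT (norm_nonneg θ₀)) _)
  have hvM : ∀ t, 0 ≤ t → t ≤ T → ‖v t‖ ≤ M := fun t ht htT ↦ (h.norm_velocity_le ht).trans
    (add_le_add_right (mul_le_mul_of_nonneg_right htT (norm_nonneg θ₀)) _)
  have hVm : ∀ n, StronglyMeasurable (V n) := fun n ↦ Boussinesq.stronglyMeasurable_velocity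
  have hmV : ∀ n, Measurable fun t ↦ hdotHalfSq (V n t) := fun n ↦ measurable_hdotHalfSq (hVm n)
  have hmv : Measurable fun t ↦ hdotHalfSq (v t) :=
    measurable_hdotHalfSq h.stronglyMeasurable_velocity
  have hmE : ∀ n, Measurable fun t ↦ localNorm R (V n t - v t) ^ 2 := fun n ↦
    (((continuous_localNorm R).comp_stronglyMeasurable
      ((hVm n).sub h.stronglyMeasurable_velocity)).measurable).pow_const 2
  rw [ENNReal.tendsto_nhds_zero]
  intro e he
  -- The scale ρ is fixed before n: its regularization error is small uniformly in n, because the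
  -- time integrals of the Sobolev norms are bounded by S.
  obtain ⟨ρ, hρe, hρ⟩ : ∃ ρ : ℝ, 6 * ENNReal.ofReal (8 * ρ) * (S + S) ≤ e / 2 ∧ 0 < ρ := by
    have h1 : Tendsto (fun ρ : ℝ ↦ 6 * ENNReal.ofReal (8 * ρ) * (S + S)) (𝓝[>] 0) (𝓝 0) := by
      have h2 : Tendsto (fun ρ : ℝ ↦ ENNReal.ofReal (8 * ρ)) (𝓝 0) (𝓝 0) := by
        have := ENNReal.tendsto_ofReal ((tendsto_id (α := ℝ) (x := 𝓝 0)).const_mul 8)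
        rwa [mul_zero, ENNReal.ofReal_zero] at this
      have h3 := ENNReal.Tendsto.mul_const (ENNReal.Tendsto.const_mul (a := 6) h2
        (Or.inr (by simp))) (b := S + S) (Or.inr (by simp [hS]))
      rw [mul_zero, zero_mul] at h3
      exact h3.mono_left nhdsWithin_le_nhds
    have h4 := (ENNReal.tendsto_nhds_zero.1 h1) (e / 2) (ENNReal.half_pos he.ne')
    obtain ⟨ρ, h5, h6⟩ := (h4.and self_mem_nhdsWithin).exists
    exact ⟨ρ, h5, h6⟩
  set κ := 6 * ENNReal.ofReal (8 * ρ) with hκ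
  -- The Sobolev norms are bounded only after integration in time, so their share is subtracted
  -- first. The truncated remainder is below `3 * fluxDistSq`, which tends to zero at each time, and
  -- is uniformly bounded.
  let G : ℕ → ℝ → ℝ≥0∞ := fun n t ↦
    localNorm R (V n t - v t) ^ 2 - κ * (hdotHalfSq (V n t) + hdotHalfSq (v t))
  have hGm : ∀ n, Measurable (G n) := fun n ↦ (hmE n).sub (((hmV n).add hmv).const_mul κ)
  have hG : Tendsto (fun n ↦ ∫⁻ t in Ioc 0 T, G n t) atTop (𝓝 0) := by
    rw [show (0 : ℝ≥0∞) = ∫⁻ _ in Ioc (0 : ℝ) T, 0 by simp]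
    refine tendsto_lintegral_of_dominated_convergence
      (bound := fun _ ↦ ENNReal.ofReal ((2 * M) ^ 2)) hGm (fun n ↦ ?_) ?_ ?_
    · refine (ae_restrict_iff' measurableSet_Ioc).2 (ae_of_all _ fun t ht ↦ ?_)
      refine tsub_le_self.trans ((pow_le_pow_left' (localNorm_le R _) 2).trans ?_)
      rw [← ofReal_norm_sq]
      refine ENNReal.ofReal_le_ofReal (pow_le_pow_left₀ (norm_nonneg _) ?_ 2)
      exact (norm_sub_le _ _).trans (by linarith [hVM n t ht.1.le ht.2, hvM t ht.1.le ht.2])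
    · rw [lintegral_const, Measure.restrict_apply_univ]
      exact (ENNReal.mul_lt_top ENNReal.ofReal_lt_top (by simp)).ne
    · refine (ae_restrict_iff' measurableSet_Ioc).2 (ae_of_all _ fun t ht ↦ ?_)
      have h1 := tendsto_fluxDistSq hρ R (fun n ↦ hVM n t ht.1.le ht.2)
        (h.tendsto_velocity t ht.1.le)
      have h2 := ENNReal.Tendsto.const_mul (a := 3) h1 (Or.inr (by simp))
      rw [mul_zero] at h2
      refine tendsto_of_tendsto_of_tendsto_of_le_of_le tendsto_const_nhds h2
        (fun _ ↦ zero_le) fun n ↦ ?_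
      exact tsub_le_iff_right.2 (localNorm_sub_sq_le hρ R _ _)
  have hmVv : ∀ n, Measurable fun t ↦ hdotHalfSq (V n t) + hdotHalfSq (v t) := fun n ↦
    (hmV n).add hmv
  filter_upwards [ENNReal.tendsto_nhds_zero.1 hG (e / 2) (ENNReal.half_pos he.ne')] with n hn
  calc ∫⁻ t in Ioc 0 T, localNorm R (V n t - v t) ^ 2
      ≤ ∫⁻ t in Ioc 0 T, (G n t + κ * (hdotHalfSq (V n t) + hdotHalfSq (v t))) :=
        lintegral_mono fun t ↦ le_tsub_add
    _ = (∫⁻ t in Ioc 0 T, G n t) + κ * ((∫⁻ t in Ioc 0 T, hdotHalfSq (V n t))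
          + ∫⁻ t in Ioc 0 T, hdotHalfSq (v t)) := by
        rw [lintegral_add_left (hGm n), lintegral_const_mul _ (hmVv n),
          lintegral_add_left (hmV n)]
    _ ≤ e / 2 + κ * (S + S) := by
        gcongr
        · exact lintegral_hdotHalfSq_velocity_le (h.δ_pos n) (h.η_pos n) hT
        · exact h.lintegral_hdotHalfSq_le hT
    _ ≤ e / 2 + e / 2 := by gcongr
    _ = e := ENNReal.add_halves e

/-- Integrals that tend to zero have subsequences of integrands that tend to zero almost
everywhere. -/
theorem exists_subseq_ae_tendsto_zero {X : Type*} [MeasurableSpace X] {μ : Measure X}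
    {f : ℕ → X → ℝ≥0∞} (hf : ∀ n, Measurable (f n))
    (h : Tendsto (fun n ↦ ∫⁻ x, f n x ∂μ) atTop (𝓝 0)) :
    ∃ ns : ℕ → ℕ, StrictMono ns ∧ ∀ᵐ x ∂μ, Tendsto (fun k ↦ f (ns k) x) atTop (𝓝 0) := by
  have hpos : ∀ k : ℕ, (0 : ℝ≥0∞) < 2⁻¹ ^ k := fun k ↦ by
    apply ENNReal.pow_pos; simp
  -- Integrals below 2⁻ᵏ make the series of integrands integrable, hence finite almost everywhere.
  obtain ⟨ns, hns, hle⟩ := extraction_forall_of_eventually fun k ↦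
    (ENNReal.tendsto_nhds_zero.1 h) (2⁻¹ ^ k) (hpos k)
  refine ⟨ns, hns, ?_⟩
  have hsum : ∫⁻ x, ∑' k, f (ns k) x ∂μ ≠ ⊤ := by
    rw [lintegral_tsum fun k ↦ (hf _).aemeasurable]
    refine ne_top_of_le_ne_top ?_ (ENNReal.tsum_le_tsum hle)
    rw [ENNReal.tsum_geometric]
    simp
  filter_upwards [ae_lt_top (Measurable.tsum fun k ↦ hf (ns k)) hsum] with x hx
  exact ENNReal.tendsto_atTop_zero_of_tsum_ne_top hx.ne

/-- Along a subsequence, the velocities converge strongly at almost every time, with negligible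
dissipation at the scale of the regularization. -/
theorem IsLimit.exists_subseq (h : IsLimit δ η v₀ θ₀ v θ) (R : ℝ) {T : ℝ} (hT : 0 ≤ T) :
    ∃ ns : ℕ → ℕ, StrictMono ns ∧ ∀ᵐ t ∂(volume.restrict (Ioc 0 T)),
      Tendsto (fun k ↦ localNorm R (velocity (δ (ns k)) (η (ns k)) v₀ θ₀ t - v t)) atTop (𝓝 0) ∧
      Tendsto (fun k ↦ ENNReal.ofReal (4 * δ (ns k) + 6 * η (ns k) ^ 2)
        * hdotHalfSq (velocity (δ (ns k)) (η (ns k)) v₀ θ₀ t)) atTop (𝓝 0) := by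
  have hmE : ∀ n, Measurable fun t ↦ localNorm R (velocity (δ n) (η n) v₀ θ₀ t - v t) ^ 2 :=
    fun n ↦ (((continuous_localNorm R).comp_stronglyMeasurable
      (Boussinesq.stronglyMeasurable_velocity.sub
        h.stronglyMeasurable_velocity)).measurable).pow_const 2
  have hmV : ∀ n, Measurable fun t ↦ ENNReal.ofReal (4 * δ n + 6 * η n ^ 2)
      * hdotHalfSq (velocity (δ n) (η n) v₀ θ₀ t) := fun n ↦
    (measurable_hdotHalfSq Boussinesq.stronglyMeasurable_velocity).const_mul _
  have h2 : Tendsto (fun n ↦ ∫⁻ t in Ioc 0 T, ENNReal.ofReal (4 * δ n + 6 * η n ^ 2)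
      * hdotHalfSq (velocity (δ n) (η n) v₀ θ₀ t)) atTop (𝓝 0) := by
    have h3 : Tendsto (fun n ↦ ENNReal.ofReal (4 * δ n + 6 * η n ^ 2)
        * ENNReal.ofReal ((‖v₀‖ + T * ‖θ₀‖) ^ 2)) atTop (𝓝 0) := by
      have h4 : Tendsto (fun n ↦ 4 * δ n + 6 * η n ^ 2) atTop (𝓝 0) := by
        simpa using (h.tendsto_δ.const_mul 4).add ((h.tendsto_η.pow 2).const_mul 6)
      have h5 := ENNReal.Tendsto.mul_const (ENNReal.tendsto_ofReal h4)
        (b := ENNReal.ofReal ((‖v₀‖ + T * ‖θ₀‖) ^ 2)) (Or.inr (by simp))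
      simpa using h5
    refine tendsto_of_tendsto_of_tendsto_of_le_of_le tendsto_const_nhds h3
      (fun _ ↦ zero_le) fun n ↦ ?_
    rw [lintegral_const_mul _ (measurable_hdotHalfSq Boussinesq.stronglyMeasurable_velocity)]
    gcongr
    exact lintegral_hdotHalfSq_velocity_le (h.δ_pos n) (h.η_pos n) hT
  -- Adding the two integrands lets a single extraction serve both.
  have h1 := (h.tendsto_lintegral_localNorm R hT).add h2
  rw [add_zero] at h1
  simp only [← lintegral_add_left (hmE _)] at h1
  obtain ⟨ns, hns, hae⟩ := exists_subseq_ae_tendsto_zero (fun n ↦ (hmE n).add (hmV n)) h1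
  refine ⟨ns, hns, ?_⟩
  filter_upwards [hae] with t ht
  constructor
  · have h3 : Tendsto (fun k ↦
        localNorm R (velocity (δ (ns k)) (η (ns k)) v₀ θ₀ t - v t) ^ 2) atTop (𝓝 0) :=
      tendsto_of_tendsto_of_tendsto_of_le_of_le tendsto_const_nhds ht (fun _ ↦ zero_le)
        fun _ ↦ le_self_add
    have h4 := (ENNReal.continuous_rpow_const (y := 1 / 2)).tendsto 0 |>.comp h3
    rw [ENNReal.zero_rpow_of_pos (by norm_num)] at h4
    refine h4.congr fun k ↦ ?_
    rw [Function.comp_apply, ← ENNReal.rpow_natCast_mul]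
    norm_num
  · exact tendsto_of_tendsto_of_tendsto_of_le_of_le tendsto_const_nhds ht (fun _ ↦ zero_le)
      fun _ ↦ le_add_self

end StrongConvergence

variable {v₀ : L2Vector} {θ₀ : L2Scalar} {δ η : ℕ → ℝ} {v : ℝ → L2Vector} {θ : ℝ → L2Scalar}

/-! ### Passage to the limit in the equations. -/

section LimitEquations

theorem ControlledTest.enorm_l2_fderiv_sub_le {E : Type*} [NormedAddCommGroup E]
    [NormedSpace ℝ E] {φ : Plane → E} {C R : ℝ} (hφ : ControlledTest φ C R) (u w : L2Vector) :
    ‖(l2 fun x ↦ fderiv ℝ φ x (u x)) - l2 fun x ↦ fderiv ℝ φ x (w x)‖ₑ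
      ≤ ENNReal.ofReal C * localNorm R (u - w) := by
  have h := hφ.enorm_l2_fderiv_le (u := fun x ↦ u x - w x) ((Lp.memLp u).sub (Lp.memLp w))
  simp_rw [map_sub] at h
  rw [l2_sub (hφ.memLp_fderiv (Lp.memLp u)) (hφ.memLp_fderiv (Lp.memLp w)),
    eLpNorm_indicator_eq_eLpNorm_restrict Metric.isClosed_closedBall.measurableSet] at h
  refine h.trans (le_of_eq ?_)
  rw [localNorm]
  congr 1
  exact eLpNorm_congr_ae (ae_restrict_of_ae (Lp.coeFn_sub u w).symm)

/-- The generators of the transport steps converge to the directional derivative along the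
velocity. -/
theorem IsLimit.tendsto_generator {E : Type*} [NormedAddCommGroup E] [NormedSpace ℝ E]
    (h : IsLimit δ η v₀ θ₀ v θ) {t : ℝ} (ht : 0 ≤ t) {φ : Plane → E} {C R : ℝ}
    (hφ : ControlledTest φ C R)
    (h1 : Tendsto (fun n ↦ localNorm R (velocity (δ n) (η n) v₀ θ₀ t - v t)) atTop (𝓝 0))
    (h2 : Tendsto (fun n ↦ ENNReal.ofReal (4 * δ n + 6 * η n ^ 2)
      * hdotHalfSq (velocity (δ n) (η n) v₀ θ₀ t)) atTop (𝓝 0)) :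
    Tendsto (fun n ↦ l2 (generator (δ n) (η n) (velocity (δ n) (η n) v₀ θ₀ t) φ)) atTop
      (𝓝 (l2 fun x ↦ fderiv ℝ φ x (v t x))) := by
  rw [tendsto_iff_edist_tendsto_0]
  have h3 : Tendsto (fun n ↦ ENNReal.ofReal (C * η n * ballConst (R + 1)) + ENNReal.ofReal C *
      (2 * (ENNReal.ofReal (4 * δ n + 6 * η n ^ 2)
        * hdotHalfSq (velocity (δ n) (η n) v₀ θ₀ t)) ^ (1 / 2 : ℝ))
      + ENNReal.ofReal C * localNorm R (velocity (δ n) (η n) v₀ θ₀ t - v t)) atTop (𝓝 0) := by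
    have a1 := ENNReal.tendsto_ofReal
      ((h.tendsto_η.const_mul C).mul_const (ballConst (R + 1)))
    have a2 := (ENNReal.continuous_rpow_const (y := 1 / 2)).tendsto 0 |>.comp h2
    rw [ENNReal.zero_rpow_of_pos (by norm_num)] at a2
    have a3 := ENNReal.Tendsto.const_mul (a := ENNReal.ofReal C)
      (ENNReal.Tendsto.const_mul (a := 2) a2 (Or.inr (by simp))) (Or.inr (by simp))
    have a4 := ENNReal.Tendsto.const_mul (a := ENNReal.ofReal C) h1 (Or.inr (by simp))
    have a5 := (a1.add a3).add a4
    simpa using! a5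
  refine tendsto_of_tendsto_of_tendsto_of_le_of_le' tendsto_const_nhds h3
    (Eventually.of_forall fun _ ↦ zero_le) ?_
  -- For large n the velocity at time t is slow, and `cut` leaves it unchanged.
  filter_upwards [h.isSlow (‖v₀‖ + t * ‖θ₀‖)] with n hn
  rw [edist_eq_enorm_sub, ← sub_add_sub_cancel _
    (l2 fun x ↦ fderiv ℝ φ x (velocity (δ n) (η n) v₀ θ₀ t x))]
  exact (enorm_add_le _ _).trans (add_le_add (enorm_l2_generator_sub_le (h.δ_pos n) (h.η_pos n)
    (h.η_le_one n) (isDivFree_velocity (h.η_pos n) t)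
    (hn _ (Boussinesq.norm_velocity_le (h.δ_pos n) (h.η_pos n) ht)) hφ)
    (hφ.enorm_l2_fderiv_sub_le _ _))

theorem inner_buoyancy_eq (θ : L2Scalar) {φ : Plane → Plane} (hφ : IsTest φ) :
    (inner ℝ (buoyancy θ) (l2 φ) : ℝ) = inner ℝ θ (l2 fun x ↦ φ x 1) := by
  rw [inner_buoyancy θ hφ, inner_l2 _ ((hφ.component 1).memLp 2)]
  refine integral_congr_ae (ae_of_all _ fun x ↦ ?_)
  simp [mul_comm]

theorem l2_absDVec_zero : l2 (absDVec fun _ ↦ 0) = 0 := by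
  have h : ControlledTest (fun _ : Plane ↦ (0 : Plane)) 0 0 :=
    ⟨⟨contDiff_const, HasCompactSupport.zero⟩, by simp, by simp, by simp, by simp⟩
  have := norm_l2_absDVec_le h
  rw [zero_mul, mul_zero] at this
  exact norm_le_zero_iff.1 this

/-- By the resolvent equation the difference of the pairings is h⟨w, |D|φ⟩, with w bounded by ‖g‖.
-/
theorem tendsto_resolvent {h : ℕ → ℝ} (hh : ∀ n, 0 ≤ h n) (hh0 : Tendsto h atTop (𝓝 0))
    (g : L2Vector) {φ : Plane → Plane} (hφ : IsTest φ) (hdiv : ∀ x, divergence φ x = 0) :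
    Tendsto (fun n ↦ (inner ℝ (resolvent (h n) g) (l2 φ) : ℝ)) atTop (𝓝 (inner ℝ g (l2 φ))) := by
  have h1 : ∀ n, (inner ℝ (resolvent (h n) g) (l2 φ) : ℝ) = inner ℝ g (l2 φ)
      - h n * inner ℝ (resolvent (h n) g) (l2 (absDVec φ)) := fun n ↦ by
    rw [inner_resolvent (hh n) g hφ hdiv]; ring
  have h2 : ∀ n, ‖resolvent (h n) g‖ ≤ ‖g‖ := fun n ↦ by
    have := le_self_add.trans (resolvent_energy (hh n) g)
    rw [ENNReal.ofReal_le_ofReal_iff (by positivity)] at this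
    exact le_of_sq_le_sq this (norm_nonneg g)
  have h3 : Tendsto (fun n ↦ h n * (inner ℝ (resolvent (h n) g) (l2 (absDVec φ)) : ℝ)) atTop
      (𝓝 0) := by
    have h4 : Tendsto (fun n ↦ h n * (‖g‖ * ‖l2 (absDVec φ)‖)) atTop (𝓝 0) := by
      simpa using hh0.mul_const (‖g‖ * ‖l2 (absDVec φ)‖)
    refine squeeze_zero_norm (fun n ↦ ?_) h4
    rw [norm_mul, Real.norm_of_nonneg (hh n)]
    exact mul_le_mul_of_nonneg_left ((norm_inner_le_norm _ _).trans
      (mul_le_mul_of_nonneg_right (h2 n) (norm_nonneg _))) (hh n)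
  simp only [h1]
  simpa using h3.const_sub (inner ℝ g (l2 φ))

/-- The subsequence with strong convergence depends on the support of φ. This is harmless: v and θ
are already fixed as limits of the whole sequence. -/
theorem IsLimit.momentum (h : IsLimit δ η v₀ θ₀ v θ) {φ : ℝ × Plane → Plane} (hφ : IsTest φ)
    (hdiv : ∀ t : ℝ, 0 ≤ t → ∀ x : Plane, divergence (fun y ↦ φ (t, y)) x = 0) :
    (∫ t in Ioi (0 : ℝ), (inner ℝ (v t) (l2 fun x ↦ fderiv ℝ φ (t, x) (1, 0))
      + (inner ℝ (v t) (l2 fun x ↦ fderiv ℝ (fun y ↦ φ (t, y)) x (v t x))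
        + inner ℝ (buoyancy (θ t)) (l2 fun y ↦ φ (t, y))
        - inner ℝ (v t) (l2 (absDVec fun y ↦ φ (t, y))))))
      + inner ℝ v₀ (l2 fun y ↦ φ (0, y)) = 0 := by
  obtain ⟨C, R, hR, hc, hsupp⟩ := hφ.exists_controlled_slice
  have hT : 0 ≤ R + 1 := by linarith
  have hzero : ∀ t, R + 1 ≤ t → (fun y ↦ φ (t, y)) = fun _ ↦ 0 := fun t ht ↦
    funext fun y ↦ hsupp t y (Or.inl (by rw [abs_of_nonneg (by linarith)]; linarith))
  obtain ⟨ns, hns, hae⟩ := h.exists_subseq R hT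
  have h' := h.comp hns.tendsto_atTop
  have hη3 : ∀ n, 0 < η (ns n) ^ 3 := fun n ↦ pow_pos (h.η_pos _) 3
  refine weak_form_of_increments (w := fun n ↦ velocity (δ (ns n)) (η (ns n)) v₀ θ₀)
    (h := fun n ↦ η (ns n) ^ 3) (w₀ := fun n ↦ resolvent (η (ns n) ^ 3) v₀) (W := v) (a := v₀)
    (φ := fun t ↦ l2 fun y ↦ φ (t, y)) (φ' := fun t ↦ l2 fun x ↦ fderiv ℝ φ (t, x) (1, 0))
    (B := fun t ↦ inner ℝ (v t) (l2 fun x ↦ fderiv ℝ (fun y ↦ φ (t, y)) x (v t x))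
        + inner ℝ (buoyancy (θ t)) (l2 fun y ↦ φ (t, y))
        - inner ℝ (v t) (l2 (absDVec fun y ↦ φ (t, y))))
    (M := ‖v₀‖ + (R + 1 + 1) * ‖θ₀‖) hT hη3
    (fun n ↦ pow_le_one₀ (h.η_pos _).le (h.η_le_one _)) (tendsto_pow_three h'.tendsto_η)
    (fun n ↦ Boussinesq.stronglyMeasurable_velocity)
    (fun n t ht htT ↦ (Boussinesq.norm_velocity_le (h.δ_pos _) (h.η_pos _) ht).trans
      (add_le_add_right (mul_le_mul_of_nonneg_right htT (norm_nonneg θ₀)) _))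
    (fun n t _ ht ↦ velocity_of_lt (h.η_pos _) ht) hφ.hasDerivAt_l2
    (hφ.fderiv_apply (1, 0)).continuous_l2 (fun t ht ↦ ?_) h'.tendsto_velocity
    (tendsto_resolvent (fun n ↦ (hη3 n).le) (tendsto_pow_three h'.tendsto_η) v₀ (hφ.slice 0)
      (hdiv 0 le_rfl)) ?_
    (fun n t ht htT ↦ abs_velocity_increment_le (h.δ_pos _) (h.η_pos _) (h.η_le_one _) ht.le
      htT.le (hc t) (hdiv t ht.le)) fun t ht ↦ ?_
  · rw [hzero t ht, l2_zero]
  · have hae' := ae_restrict_of_ae_restrict_of_subset (Ioo_subset_Ioc_self) hae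
    filter_upwards [hae', ae_restrict_mem measurableSet_Ioo] with t ht ht0
    have hg := h'.tendsto_generator ht0.1.le (hc t) ht.1 ht.2
    -- The quadratic term: weakly convergent velocities against strongly convergent generators of φ.
    have h1 := tendsto_inner_of_weak_of_strong (Eventually.of_forall fun n ↦
      Boussinesq.norm_velocity_le (h'.δ_pos n) (h'.η_pos n) ht0.1.le)
      (h'.tendsto_velocity t ht0.1.le _) hg
    have h2 := h'.tendsto_temperature t ht0.1.le (l2 fun x ↦ φ (t, x) 1)
    simp only [← inner_buoyancy_eq _ (hc t).isTest] at h2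
    have h3 := h'.tendsto_velocity_shift ht0.1.le (l2 (absDVec fun y ↦ φ (t, y)))
    refine ((h1.add h2).sub h3).congr fun n ↦ ?_
    exact (velocity_increment (h.δ_pos _) (h.η_pos _) ht0.1.le (hc t).isTest
      (hdiv t ht0.1.le)).symm
  · rw [hzero t ht, l2_absDVec_zero]
    have : (fun x ↦ fderiv ℝ (fun _ : Plane ↦ (0 : Plane)) x (v t x)) = fun _ ↦ 0 := by
      funext x; simp
    rw [this, l2_zero]
    simp

/-- The temperatures converge only weakly; strong local convergence of the velocities is enough for
θ v·∇ψ. -/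
theorem IsLimit.temperature (h : IsLimit δ η v₀ θ₀ v θ) {ψ : ℝ × Plane → ℝ} (hψ : IsTest ψ) :
    (∫ t in Ioi (0 : ℝ), (inner ℝ (θ t) (l2 fun x ↦ fderiv ℝ ψ (t, x) (1, 0))
      + inner ℝ (θ t) (l2 fun x ↦ fderiv ℝ (fun y ↦ ψ (t, y)) x (v t x))))
      + inner ℝ θ₀ (l2 fun y ↦ ψ (0, y)) = 0 := by
  obtain ⟨C, R, hR, hc, hsupp⟩ := hψ.exists_controlled_slice
  have hT : 0 ≤ R + 1 := by linarith
  have hzero : ∀ t, R + 1 ≤ t → (fun y ↦ ψ (t, y)) = fun _ ↦ 0 := fun t ht ↦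
    funext fun y ↦ hsupp t y (Or.inl (by rw [abs_of_nonneg (by linarith)]; linarith))
  obtain ⟨ns, hns, hae⟩ := h.exists_subseq R hT
  have h' := h.comp hns.tendsto_atTop
  have hη3 : ∀ n, 0 < η (ns n) ^ 3 := fun n ↦ pow_pos (h.η_pos _) 3
  refine weak_form_of_increments (w := fun n ↦ Boussinesq.temperature (δ (ns n)) (η (ns n)) v₀ θ₀)
    (h := fun n ↦ η (ns n) ^ 3) (w₀ := fun n ↦ θ₀) (W := θ) (a := θ₀)
    (φ := fun t ↦ l2 fun y ↦ ψ (t, y)) (φ' := fun t ↦ l2 fun x ↦ fderiv ℝ ψ (t, x) (1, 0))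
    (B := fun t ↦ inner ℝ (θ t) (l2 fun x ↦ fderiv ℝ (fun y ↦ ψ (t, y)) x (v t x))) (M := ‖θ₀‖) hT hη3
    (fun n ↦ pow_le_one₀ (h.η_pos _).le (h.η_le_one _)) (tendsto_pow_three h'.tendsto_η)
    (fun n ↦ Boussinesq.stronglyMeasurable_temperature)
    (fun n t ht htT ↦ Boussinesq.norm_temperature_le (h.δ_pos _) (h.η_pos _) t)
    (fun n t _ ht ↦ temperature_of_lt (h.η_pos _) ht) hψ.hasDerivAt_l2
    (hψ.fderiv_apply (1, 0)).continuous_l2 (fun t ht ↦ ?_) h'.tendsto_temperature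
    tendsto_const_nhds ?_
    (fun n t ht htT ↦ abs_temperature_increment_le (h.δ_pos _) (h.η_pos _) (h.η_le_one _) ht.le
      htT.le (hc t)) fun t ht ↦ ?_
  · rw [hzero t ht, l2_zero]
  · have hae' := ae_restrict_of_ae_restrict_of_subset (Ioo_subset_Ioc_self) hae
    filter_upwards [hae', ae_restrict_mem measurableSet_Ioo] with t ht ht0
    have hg := h'.tendsto_generator ht0.1.le (hc t) ht.1 ht.2
    have h1 := tendsto_inner_of_weak_of_strong (Eventually.of_forall fun n ↦
      Boussinesq.norm_temperature_le (h'.δ_pos n) (h'.η_pos n) t)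
      (h'.tendsto_temperature t ht0.1.le _) hg
    refine h1.congr fun n ↦ ?_
    exact (temperature_increment (h.δ_pos _) (h.η_pos _) ht0.1.le (hc t).isTest).symm
  · rw [hzero t ht]
    have : (fun x ↦ fderiv ℝ (fun _ : Plane ↦ (0 : ℝ)) x (v t x)) = fun _ ↦ 0 := by
      funext x; simp
    rw [this, l2_zero]
    simp

end LimitEquations

/-! ### The limit is a weak solution with the required bounds. -/

section WeakSolutions

theorem IsLimit.isGlobalWeakSolution (h : IsLimit δ η v₀ θ₀ v θ) :
    IsGlobalWeakSolution v₀ θ₀ v θ where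
  velocity_bounded T := by
    refine memLp_top_of_bound h.stronglyMeasurable_velocity.aestronglyMeasurable
      (‖v₀‖ + T * ‖θ₀‖) ((ae_restrict_iff' measurableSet_Ioc).2 (ae_of_all _ fun t ht ↦ ?_))
    exact (h.norm_velocity_le ht.1.le).trans
      (add_le_add_right (mul_le_mul_of_nonneg_right ht.2 (norm_nonneg θ₀)) _)
  velocity_hdotHalf T := by
    rcases le_total 0 T with hT | hT
    · exact (h.lintegral_hdotHalfSq_le hT).trans_lt ENNReal.ofReal_lt_top
    · rw [Ioc_eq_empty (not_lt.2 hT)]; simp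
  temperature_bounded := by
    refine memLp_top_of_bound h.stronglyMeasurable_temperature.aestronglyMeasurable
      ‖θ₀‖ ((ae_restrict_iff' measurableSet_Ioi).2 (ae_of_all _ fun t ht ↦ ?_))
    exact h.norm_temperature_le (le_of_lt ht)
  div_free := (ae_restrict_iff' measurableSet_Ioi).2
    (ae_of_all _ fun t ht ↦ h.isDivFree (le_of_lt ht))
  momentum φ hφ hdiv := by
    obtain ⟨C, R, hR, hc, -⟩ := hφ.exists_controlled_slice
    refine Eq.trans ?_ (h.momentum hφ hdiv)
    rw [inner_l2 _ ((hφ.slice 0).memLp 2)]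
    congr 1
    refine setIntegral_congr_fun measurableSet_Ioi fun t ht ↦ ?_
    have m1 := ((hφ.fderiv_apply (1, 0)).slice t).memLp 2
    have m2 := (hc t).memLp_fderiv (Lp.memLp (v t))
    have m3 := memLp_absDVec (hc t).isTest
    have i4 : Integrable fun x ↦ θ t x * φ (t, x) 1 := by
      refine (integrable_inner_l2 (θ t) (((hc t).isTest.component 1).memLp 2)).congr
        (ae_of_all _ fun x ↦ ?_)
      simp [mul_comm]
    have i1 := integrable_inner_l2 (v t) m1
    have i2 := integrable_inner_l2 (v t) m2
    have i3 := integrable_inner_l2 (v t) m3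
    have i12 : Integrable fun x ↦ (inner ℝ (v t x) (fderiv ℝ φ (t, x) (1, 0)) : ℝ)
      + inner ℝ (v t x) (fderiv ℝ (fun y ↦ φ (t, y)) x (v t x)) := i1.add i2
    have i123 : Integrable fun x ↦ (inner ℝ (v t x) (fderiv ℝ φ (t, x) (1, 0)) : ℝ)
      + inner ℝ (v t x) (fderiv ℝ (fun y ↦ φ (t, y)) x (v t x))
      - inner ℝ (v t x) (absDVec (fun y ↦ φ (t, y)) x) := i12.sub i3
    simp only [(hasDerivAt_slice hφ t _).deriv]
    rw [integral_add i123 i4, integral_sub i12 i3, integral_add i1 i2, ← inner_l2 _ m1,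
      ← inner_l2 _ m2, ← inner_l2 _ m3, inner_buoyancy _ (hc t).isTest]
    ring
  temperature ψ hψ := by
    obtain ⟨C, R, hR, hc, -⟩ := hψ.exists_controlled_slice
    refine Eq.trans ?_ (h.temperature hψ)
    rw [inner_l2 _ ((hψ.slice 0).memLp 2)]
    congr 1
    · refine setIntegral_congr_fun measurableSet_Ioi fun t ht ↦ ?_
      have m1 := ((hψ.fderiv_apply (1, 0)).slice t).memLp 2
      have m2 := (hc t).memLp_fderiv (Lp.memLp (v t))
      simp only [(hasDerivAt_slice hψ t _).deriv]
      rw [inner_l2 _ m1, inner_l2 _ m2,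
        ← integral_add (integrable_inner_l2 (θ t) m1) (integrable_inner_l2 (θ t) m2)]
      refine integral_congr_ae (ae_of_all _ fun x ↦ ?_)
      simp only [RCLike.inner_apply, conj_trivial]
      ring
    · refine integral_congr_ae (ae_of_all _ fun x ↦ ?_)
      simp [mul_comm]

/-- Norm and dissipation are each at most (‖v₀‖ + t‖θ₀‖)², hence the 2; Cauchy–Schwarz bounds this
square by (‖v₀‖² + ‖θ₀‖²)(1 + t²). -/
theorem IsLimit.energyBounds (h : IsLimit δ η v₀ θ₀ v θ) :
    EnergyBounds (2 * (‖v₀‖ ^ 2 + ‖θ₀‖ ^ 2)) θ₀ v θ := by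
  refine fun t ht ↦ ⟨?_, h.norm_temperature_le ht⟩
  have h1 : ENNReal.ofReal (‖v t‖ ^ 2) ≤ ENNReal.ofReal ((‖v₀‖ + t * ‖θ₀‖) ^ 2) :=
    ENNReal.ofReal_le_ofReal (pow_le_pow_left₀ (norm_nonneg _) (h.norm_velocity_le ht) 2)
  refine (add_le_add h1 (h.lintegral_hdotHalfSq_le ht)).trans ?_
  rw [← ENNReal.ofReal_add (by positivity) (by positivity)]
  refine ENNReal.ofReal_le_ofReal ?_
  nlinarith [sq_nonneg (‖v₀‖ * t - ‖θ₀‖)]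

theorem isClosed_eLpNorm_le (p : ℝ≥0∞) (M : ℝ≥0∞) :
    IsClosed {f : L2Scalar | eLpNorm f p volume ≤ M} := by
  refine IsSeqClosed.isClosed fun f a hf ha ↦ ?_
  obtain ⟨ns, hns, hae⟩ := exists_subseq_ae_tendsto ha ha
  exact (Lp.eLpNorm_lim_le_liminf_eLpNorm (fun n ↦ Lp.aestronglyMeasurable (f (ns n))) a
    (hae.mono fun x hx ↦ hx.1)).trans
    (liminf_le_of_frequently_le' (Frequently.of_forall fun n ↦ hf (ns n)))

theorem convex_eLpNorm_le {p : ℝ≥0∞} (hp : 1 ≤ p) (M : ℝ≥0∞) :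
    Convex ℝ {f : L2Scalar | eLpNorm f p volume ≤ M} := by
  intro f hf g hg s t hs ht hst
  change eLpNorm (s • f + t • g : L2Scalar) p volume ≤ M
  have h1 : (s • f + t • g : L2Scalar) =ᵐ[volume] s • (f : Plane → ℝ) + t • (g : Plane → ℝ) :=
    (Lp.coeFn_add _ _).trans ((Lp.coeFn_smul s f).add (Lp.coeFn_smul t g))
  rw [eLpNorm_congr_ae h1]
  refine (eLpNorm_add_le ((Lp.aestronglyMeasurable f).const_smul s)
    ((Lp.aestronglyMeasurable g).const_smul t) hp).trans ?_
  rw [eLpNorm_const_smul, eLpNorm_const_smul, Real.enorm_of_nonneg hs, Real.enorm_of_nonneg ht]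
  calc _ ≤ ENNReal.ofReal s * M + ENNReal.ofReal t * M :=
        add_le_add (mul_le_mul_right hf _) (mul_le_mul_right hg _)
    _ = M := by
        rw [← add_mul, ← ENNReal.ofReal_add hs ht, hst, ENNReal.ofReal_one, one_mul]

/-- A ball of L^p is convex, and closed in L² by Fatou's lemma, so it keeps the weak L² limits of
the scheme. -/
theorem IsLimit.eLpNorm_temperature_le (h : IsLimit δ η v₀ θ₀ v θ) {t : ℝ} (ht : 0 ≤ t)
    {p : ℝ≥0∞} (hp : 1 ≤ p) : eLpNorm (θ t) p volume ≤ eLpNorm θ₀ p volume :=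
  mem_of_weak_limit (S := {f : L2Scalar | eLpNorm f p volume ≤ eLpNorm θ₀ p volume})
    (isClosed_eLpNorm_le p _) (convex_eLpNorm_le hp _)
    (Frequently.of_forall fun n ↦ eLpNorm_scheme_snd_le (h.δ_pos n) (h.η_pos n) hp _)
    (h.tendsto_temperature t ht)

end WeakSolutions

end Boussinesq

end

theorem proposition5p1 :
    ∃ C : ℝ → ℝ → ℝ, ∀ (v₀ : Boussinesq.L2Vector) (θ₀ : Boussinesq.L2Scalar),
      Boussinesq.IsDivFree v₀ →
      (∃ (v : ℝ → Boussinesq.L2Vector) (θ : ℝ → Boussinesq.L2Scalar),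
        Boussinesq.IsGlobalWeakSolution v₀ θ₀ v θ ∧
        Boussinesq.EnergyBounds (C ‖v₀‖ ‖θ₀‖) θ₀ v θ) ∧
      ∀ p : ℝ≥0∞, 1 ≤ p → MemLp θ₀ p volume →
        ∃ (v : ℝ → Boussinesq.L2Vector) (θ : ℝ → Boussinesq.L2Scalar),
          Boussinesq.IsGlobalWeakSolution v₀ θ₀ v θ ∧
          Boussinesq.EnergyBounds (C ‖v₀‖ ‖θ₀‖) θ₀ v θ ∧
          ∀ t : ℝ, 0 ≤ t →
            MemLp (θ t) p volume ∧ eLpNorm (θ t) p volume ≤ eLpNorm θ₀ p volume := by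
  refine ⟨fun a b ↦ 2 * (a ^ 2 + b ^ 2), fun v₀ θ₀ _ ↦ ?_⟩
  -- One limit serves both items and every p, since the scheme does not depend on p.
  obtain ⟨δ, η, v, θ, h⟩ := Boussinesq.exists_isLimit v₀ θ₀
  refine ⟨⟨v, θ, h.isGlobalWeakSolution, h.energyBounds⟩, fun p hp hθ ↦
    ⟨v, θ, h.isGlobalWeakSolution, h.energyBounds, fun t ht ↦ ?_⟩⟩
  have hle := h.eLpNorm_temperature_le ht hp
  exact ⟨⟨Lp.aestronglyMeasurable _, hle.trans_lt hθ.2⟩, hle⟩
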